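/- Let $T>0$, let $G_1,G_2,\Gamma$ be real rational matrices of sizes $q\times p$, $q\times m$, $p\times q$, and fix arbitrary norms on $\mathbb R^p,\mathbb R^q,\mathbb R^m$. Capital letters denote (one-sided) Laplace transforms, $\rho$ is the spectral radius. Assume * $G_1,G_2$ are strictly proper (they tend to $0$ as $s\to\infty$), and $G_1$ has relative degree one, i.e. $\lim_{s\to\infty}sG_1(s)$ has full rank; * the limit $\lim_{s\to\infty}s^{-1}\Gamma(s)$ exists. The nominal system is $Y=G_1U+G_2D$ with a rational $D(s)=d_0+\widehat D(s)$, $0\ne d_0\in\mathbb R^m$, $\widehat D$ strictly proper. The uncertain iterative process on $[0,T]$ is, for $k=0,1,2,\dots$, $$Y_k=G_1U_k+G_2(D+\Theta_k),\qquad U_{k+1}=U_k+\Gamma\,(Y_d-Y_k),\qquad e_k=y_d-y_k,$$ with $u_0\in C([0,T],\mathbb R^p)$, $y_d\in C^1([0,T],\mathbb R^q)$, and rational $\Theta_k(s)=\theta_k+\widehat\Theta_k(s)$ such that $\|\theta_k\|\le\beta_\theta$ and $\|\widehat\theta_k(t)\|\le\beta_{\widehat\theta}$ for all $k$ and all $t\in[0,T]$,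 where $\widehat\theta_k=\mathcal L^{-1}[\widehat\Theta_k]$. Laplace transforms of signals on $[0,T]$ are those of prolongations to $[0,\infty)$ (for $y_d$ and $u_0$: prolongations that are $C^1$, resp. continuous, and have Laplace transforms, for $y_d$ together with its derivative). The inputs $u_k$ are a continuous function plus a Dirac impulse at $t=0$, which is not seen at times $t>0$. The trajectory $y_d$ is trackable for the nominal system: there is an input function $u_d$ (a *desired input*) with $G_1U_d=Y_d-G_2D$ on $[0,T]$, i.e. for suitable prolongations of $u_d$ and $y_d$. 1. Let $q\ge p$, let $\Gamma G_1$ have a limit as $s\to\infty$, and let $\rho\big(I-\lim_{s\to\infty}\Gamma(s)G_1(s)\big)<1$. Then $\Gamma G_1$ is nonsingular, and there are continuous functions $\beta_e,\beta_u:[0,\infty)^2\to[0,\infty)$ vanishing at $(0,0)$, which depend only on $G_1,G_2,\Gamma,T$ and the norms, such that for all $D,y_d,u_0,(\Theta_k),\beta_\theta,\beta_{\widehat\theta}$ as above the process exists, and every such process satisfies $$\limsup_{k\to\infty}\sup_{0\le t\le T}\|e_k(t)\|\le\beta_e(\beta_\theta,\beta_{\widehat\theta}),\qquad \limsup_{k\to\infty}\sup_{0<t\le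 T}\|u_k(t)-u_\infty(t)\|\le\beta_u(\beta_\theta,\beta_{\widehat\theta}),$$ where $u_\infty$ is continuous and $U_\infty=[\Gamma G_1]^{-1}\Gamma\,[Y_d-G_2D]$. Moreover $u_\infty$ is a desired input; $G_1^{\top}G_1$ is nonsingular, and every desired input equals $u_\infty$ almost everywhere on $[0,T]$ and is given by $U_d=[G_1^{\top}G_1]^{-1}G_1^{\top}[Y_d-G_2D]$. If $\beta_\theta=\beta_{\widehat\theta}=0$, then the $u_k$ contain no impulse, $u_k\to u_\infty$ and $y_k\to y_d$ uniformly on $[0,T]$. 2. Let $q\le p$, let the first $q$ columns of $\Phi_1(0)$, $\Phi_1=\mathcal L^{-1}[G_1]$, form a nonsingular matrix, let $G_1\Gamma$ have a limit as $s\to\infty$, and let $\rho\big(I-\lim_{s\to\infty}G_1(s)\Gamma(s)\big)<1$. Then $G_1\Gamma$ is nonsingular, and the same existence statement and the same two bounds hold (with $\beta_e,\beta_u$ as in 1) for a continuous $u_\infty$ with $$U_\infty=\Gamma[G_1\Gamma]^{-1}[Y_d-G_2D]+\widetilde\Gamma U_0,$$ where, with $G_1=[G_{11}\ G_{12}]$,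 $\Gamma=[\Gamma_1^{\top}\ \Gamma_2^{\top}]^{\top}$ ($G_{11},\Gamma_1$ of size $q\times q$), $$\widetilde\Gamma=\begin{bmatrix}G_{11}^{-1}G_{12}\Gamma_2[G_1\Gamma]^{-1}G_{11} & -G_{11}^{-1}G_{12}\{I-\Gamma_2[G_1\Gamma]^{-1}G_{12}\}\\ -\Gamma_2[G_1\Gamma]^{-1}G_{11} & I-\Gamma_2[G_1\Gamma]^{-1}G_{12}\end{bmatrix}.$$ Moreover $u_\infty$ is a desired input, and $u_\infty=u_0$ on $[0,T]$ whenever $u_0$ is itself a desired input (so the limit inputs are exactly the continuous desired inputs). If $\beta_\theta=\beta_{\widehat\theta}=0$, then the $u_k$ contain no impulse, $u_k\to u_\infty$ and $y_k\to y_d$ uniformly on $[0,T]$. -/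

import Mathlib

open Set Filter Topology MeasureTheory
open scoped NNReal ENNReal Matrix

noncomputable section

namespace ILC

/-! ### Rational matrices in the Laplace variable -/

/-- `lim_{s → ∞} g(s) = a` for a rational function `g`. -/
def HasLimAtInfty (g : RatFunc ℝ) (a : ℝ) : Prop :=
  Tendsto (fun s : ℝ => g.eval (RingHom.id ℝ) s) atTop (𝓝 a)

/-- `lim_{s → ∞} G(s) = L` for a rational matrix `G`, entry by entry. -/
def MatHasLimAtInfty {a b : ℕ} (G : Matrix (Fin a) (Fin b) (RatFunc ℝ))
    (L : Matrix (Fin a) (Fin b) ℝ) : Prop :=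
  ∀ i j, HasLimAtInfty (G i j) (L i j)

/-- Strictly proper rational matrices: `lim_{s → ∞} G(s) = 0`. -/
def StrictlyProper {a b : ℕ} (G : Matrix (Fin a) (Fin b) (RatFunc ℝ)) : Prop :=
  MatHasLimAtInfty G 0

/-- The complex matrix `G(s)`. -/
def evalMat {a b : ℕ} (G : Matrix (Fin a) (Fin b) (RatFunc ℝ)) (s : ℂ) :
    Matrix (Fin a) (Fin b) ℂ :=
  G.map fun g => g.eval (algebraMap ℝ ℂ) s

/-- The complex vector `D(s)`. -/
def evalVec {a : ℕ} (D : Fin a → RatFunc ℝ) (s : ℂ) : Fin a → ℂ :=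
  fun i => (D i).eval (algebraMap ℝ ℂ) s

/-- The spectral radius (over `ℂ`) of a real square matrix. -/
def specRadius {n : ℕ} (M : Matrix (Fin n) (Fin n) ℝ) : ℝ≥0∞ :=
  spectralRadius ℂ (M.map (algebraMap ℝ ℂ))

/-! ### One-sided Laplace transforms -/

/-- `Re s → +∞`. Identities between Laplace transforms and rational functions are
required for all `s` in some right half-plane. -/
def halfPlanes : Filter ℂ := comap Complex.re atTop

/-- The Laplace integral of `f` converges absolutely in some right half-plane. -/
def Transformable {n : ℕ} (f : ℝ → Fin n → ℝ) : Prop :=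
  ∃ σ : ℝ, IntegrableOn (fun t => Real.exp (-σ * t) • f t) (Ioi 0)

/-- The Laplace transform `∫_0^∞ e^{-st} f(t) dt`. -/
def laplace {n : ℕ} (f : ℝ → Fin n → ℝ) (s : ℂ) : Fin n → ℂ :=
  fun i => ∫ t in Ioi (0 : ℝ), Complex.exp (-s * t) * (f t i : ℂ)

/-- A continuous function on `[0, ∞)` that has a Laplace transform. -/
def IsContSignal {n : ℕ} (f : ℝ → Fin n → ℝ) : Prop :=
  ContinuousOn f (Ici 0) ∧ Transformable f

/-- `f = 𝓛⁻¹[F]`, in its continuous version, for a vector `F` of rational functions. -/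
def IsInverseLaplace {n : ℕ} (f : ℝ → Fin n → ℝ) (F : Fin n → RatFunc ℝ) : Prop :=
  IsContSignal f ∧ ∀ᶠ s in halfPlanes, laplace f s = evalVec F s

/-- `Φ = 𝓛⁻¹[G]` for a rational matrix `G`, column by column. -/
def IsImpulseResponse {a b : ℕ} (Φ : ℝ → Matrix (Fin a) (Fin b) ℝ)
    (G : Matrix (Fin a) (Fin b) (RatFunc ℝ)) : Prop :=
  ∀ j, IsInverseLaplace (fun t i => Φ t i j) (fun i => G i j)

/-- A signal `impulse · δ(t) + reg(t)`: a Dirac impulse at time `0` plus a function. -/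
structure Signal (n : ℕ) where
  impulse : Fin n → ℝ
  reg : ℝ → Fin n → ℝ

/-- The Laplace transform of `impulse · δ(t) + reg(t)`. -/
def Signal.transform {n : ℕ} (x : Signal n) (s : ℂ) : Fin n → ℂ :=
  fun i => (x.impulse i : ℂ) + laplace x.reg s i

/-! ### Conditions on the system -/

/-- The disturbance is `D(s) = d₀ + D̂(s)`, `d₀ ≠ 0` constant and `D̂` strictly proper. -/
def NominalDisturbance {m : ℕ} (D : Fin m → RatFunc ℝ) : Prop :=
  ∃ (d₀ : Fin m → ℝ) (Dhat : Fin m → RatFunc ℝ), d₀ ≠ 0 ∧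
    (∀ i, HasLimAtInfty (Dhat i) 0) ∧ ∀ i, D i = RatFunc.C (d₀ i) + Dhat i

/-- Relative degree one: the leading coefficient `lim_{s → ∞} s G(s)` of the expansion of `G`
at infinity has full rank. -/
def RelativeDegreeOne {q p : ℕ} (G : Matrix (Fin q) (Fin p) (RatFunc ℝ)) : Prop :=
  ∃ M : Matrix (Fin q) (Fin p) ℝ,
    MatHasLimAtInfty ((RatFunc.X : RatFunc ℝ) • G) M ∧ M.rank = min q p

/-- The splitting of `p` indices into the first `q` and the last `p - q`. -/
def split {q p : ℕ} (h : q ≤ p) : Fin q ⊕ Fin (p - q) ≃ Fin p :=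
  finSumFinEquiv.trans (finCongr (Nat.add_sub_of_le h))

/-- The block of the first `q` columns. -/
def leftCols {R : Type} {a q p : ℕ} (h : q ≤ p) (G : Matrix (Fin a) (Fin p) R) :
    Matrix (Fin a) (Fin q) R :=
  G.submatrix id (split h ∘ Sum.inl)

/-- The block of the last `p - q` columns. -/
def rightCols {R : Type} {a q p : ℕ} (h : q ≤ p) (G : Matrix (Fin a) (Fin p) R) :
    Matrix (Fin a) (Fin (p - q)) R :=
  G.submatrix id (split h ∘ Sum.inr)

/-- The block of the last `p - q` rows. -/
def lowerRows {R : Type} {b q p : ℕ} (h : q ≤ p) (G : Matrix (Fin p) (Fin b) R) :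
    Matrix (Fin (p - q)) (Fin b) R :=
  G.submatrix (split h ∘ Sum.inr) id

/-- With `Φ₁ = 𝓛⁻¹[G₁]`, the first `q` columns of `Φ₁(0)` form a nonsingular matrix. -/
def LeftBlockNonsingular {q p : ℕ} (h : q ≤ p) (G₁ : Matrix (Fin q) (Fin p) (RatFunc ℝ)) : Prop :=
  ∃ Φ₁ : ℝ → Matrix (Fin q) (Fin p) ℝ,
    IsImpulseResponse Φ₁ G₁ ∧ (leftCols h (Φ₁ 0)).det ≠ 0

/-- Iteration-varying uncertainties `Θ_k(s) = θ_k + Θ̂_k(s)` with `‖θ_k‖ ≤ bθ` and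
`‖θ̂_k(t)‖ ≤ bθhat` on `[0, T]`, where `θ̂_k = 𝓛⁻¹[Θ̂_k]`. -/
def BoundedUncertainty {m : ℕ} (T : ℝ) (N : Seminorm ℝ (Fin m → ℝ)) (bθ bθhat : ℝ≥0)
    (Θ : ℕ → Fin m → RatFunc ℝ) : Prop :=
  ∀ k, ∃ (θ : Fin m → ℝ) (Θhat : Fin m → RatFunc ℝ) (θhat : ℝ → Fin m → ℝ),
    (∀ i, Θ k i = RatFunc.C (θ i) + Θhat i) ∧ IsInverseLaplace θhat Θhat ∧
    N θ ≤ bθ ∧ ∀ t ∈ Icc 0 T, N (θhat t) ≤ bθhat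

/-! ### Trackability and the iterative process -/

/-- The input `v` generates the output `r` of the system with disturbance `D`:
`G₁(s) V(s) = R(s) - G₂(s) D(s)`. -/
def Generates {p q m : ℕ} (G₁ : Matrix (Fin q) (Fin p) (RatFunc ℝ))
    (G₂ : Matrix (Fin q) (Fin m) (RatFunc ℝ)) (D : Fin m → RatFunc ℝ)
    (v : ℝ → Fin p → ℝ) (r : ℝ → Fin q → ℝ) : Prop :=
  Transformable v ∧ Transformable r ∧
    ∀ᶠ s in halfPlanes, evalMat G₁ s *ᵥ laplace v s = laplace r s - evalMat G₂ s *ᵥ evalVec D s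

/-- `ud` is a desired input for `yd` on `[0, T]`: some prolongation of `ud` to `[0, ∞)`
generates a prolongation of `yd`. -/
def DesiredInput {p q m : ℕ} (T : ℝ) (G₁ : Matrix (Fin q) (Fin p) (RatFunc ℝ))
    (G₂ : Matrix (Fin q) (Fin m) (RatFunc ℝ)) (D : Fin m → RatFunc ℝ)
    (yd : ℝ → Fin q → ℝ) (ud : ℝ → Fin p → ℝ) : Prop :=
  ∃ v r, EqOn v ud (Icc 0 T) ∧ EqOn r yd (Icc 0 T) ∧ Generates G₁ G₂ D v r

/-- `yd` is trackable on `[0, T]`. -/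
def Trackable {p q m : ℕ} (T : ℝ) (G₁ : Matrix (Fin q) (Fin p) (RatFunc ℝ))
    (G₂ : Matrix (Fin q) (Fin m) (RatFunc ℝ)) (D : Fin m → RatFunc ℝ)
    (yd : ℝ → Fin q → ℝ) : Prop :=
  ∃ ud, DesiredInput T G₁ G₂ D yd ud

/-- A run of the learning process on `[0, T]`, with reference `yd`, initial input `u₀` and
disturbance `Dk k` in the `k`-th iteration. Laplace transforms are those of prolongations of the
signals to `[0, ∞)`; `r` is the prolongation of `yd`. -/
structure IsRun {p q m : ℕ} (T : ℝ) (G₁ : Matrix (Fin q) (Fin p) (RatFunc ℝ))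
    (G₂ : Matrix (Fin q) (Fin m) (RatFunc ℝ)) (Γ : Matrix (Fin p) (Fin q) (RatFunc ℝ))
    (Dk : ℕ → Fin m → RatFunc ℝ) (yd : ℝ → Fin q → ℝ) (u₀ : ℝ → Fin p → ℝ)
    (r : ℝ → Fin q → ℝ) (u : ℕ → Signal p) (y : ℕ → ℝ → Fin q → ℝ) : Prop where
  ref_eq : EqOn r yd (Icc 0 T)
  ref_contDiff : ContDiffOn ℝ 1 r (Ici 0)
  ref_transformable : Transformable r
  ref_deriv_transformable : Transformable (deriv r)
  init_impulse : (u 0).impulse = 0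
  init_eq : EqOn (u 0).reg u₀ (Icc 0 T)
  input : ∀ k, IsContSignal (u k).reg
  output : ∀ k, IsContSignal (y k)
  /-- `Y_k(s) = G₁(s) U_k(s) + G₂(s) D_k(s)` -/
  plant : ∀ k, ∀ᶠ s in halfPlanes,
    laplace (y k) s = evalMat G₁ s *ᵥ (u k).transform s + evalMat G₂ s *ᵥ evalVec (Dk k) s
  /-- `U_{k+1}(s) = U_k(s) + Γ(s) E_k(s)`, `E_k(s) = Y_d(s) - Y_k(s)` -/
  update : ∀ k, ∀ᶠ s in halfPlanes,
    (u (k + 1)).transform s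
      = (u k).transform s + evalMat Γ s *ᵥ (laplace r s - laplace (y k) s)

/-- The rational matrix that maps the initial input to its contribution to the limit input
when `q ≤ p`, in block form. -/
def gammaTilde {q p : ℕ} (h : q ≤ p) (G₁ : Matrix (Fin q) (Fin p) (RatFunc ℝ))
    (Γ : Matrix (Fin p) (Fin q) (RatFunc ℝ)) : Matrix (Fin p) (Fin p) (RatFunc ℝ) :=
  let G₁₁ := leftCols h G₁
  let G₁₂ := rightCols h G₁
  let Γ₂ := lowerRows h Γ
  (Matrix.fromBlocks
    (G₁₁⁻¹ * G₁₂ * Γ₂ * (G₁ * Γ)⁻¹ * G₁₁) (-(G₁₁⁻¹ * G₁₂ * (1 - Γ₂ * (G₁ * Γ)⁻¹ * G₁₂)))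
    (-(Γ₂ * (G₁ * Γ)⁻¹ * G₁₁)) (1 - Γ₂ * (G₁ * Γ)⁻¹ * G₁₂)).submatrix
    (split h).symm (split h).symm

/-- `limsup_{k → ∞} sup_{t ∈ S} ‖f_k(t)‖`, as an extended nonnegative number. -/
def limsupSup {n : ℕ} (N : Seminorm ℝ (Fin n → ℝ)) (S : Set ℝ) (f : ℕ → ℝ → Fin n → ℝ) : ℝ≥0∞ :=
  limsup (fun k => ⨆ t ∈ S, ENNReal.ofReal (N (f k t))) atTop

end ILC

end

/-!
# Convergence of iterative learning control under iteration-varying disturbances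

All signals are a Dirac impulse at time `0` plus a continuous function, and a proper rational matrix
`K` acts on such signals: with `K = K₀ + 𝓛[κ]`, `K₀ = lim K(s)`, the action is `K₀ x + κ * x`
(`IsAction`, `MatHasLimAtInfty.exists_isAction`). Transforms determine signals
(`HasTransform.unique`, from the injectivity of the Fourier transform on integrable functions), so
every identity between transforms can be read in the time domain. The improper matrix `Γ` only
occurs through proper products such as `Γ G₁ = (s⁻¹ Γ) (s G₁)`, or applied to `R - G₂ D`. The latter
is harmless because trackability forces `y_d(0) = lim s G₂(s) d₀`, so that `s (R - G₂ D)` is the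
transform of a signal without impulse (`Trackable.apply_zero`, `exists_hasTransform_reference`).

The engine is `exists_iteration_bound`: for `x_{k+1} = A x_k - B w_k` with `ρ(A(∞)) < 1`, the matrix
`A(∞)` is a contraction in an adapted norm, and the memory term of `A` becomes small in the weight
`exp (-λ t)` for large `λ`. Hence `‖x_k(t)‖ ≤ M r ^ k + C (a + b)` with `r < 1` on `[0, T]`, if
`x_0` has no impulse and `a`, `b` bound the impulses and function parts of `w_k`; here `C` and `r`
depend on `A`, `B`, `T` only.

* If `q ≥ p`, this applies to `U_k - U_∞` with `A = 1 - Γ G₁`, `B = Γ G₂`. The reference is matched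
  by `u_∞` on `[0, T]` only. An input `v` that generates a prolongation of `y_d` satisfies
  `(U_∞ - V) / s = ((Γ G₁)⁻¹ (s⁻¹ Γ)) (R - R')` with a proper matrix and a signal `r - r'` that
  vanishes on `[0, T]`. By causality `u_∞` and `v` have the same primitive on `[0, T]`, which gives
  both that `u_∞` is a desired input and its uniqueness.
* If `q ≤ p`, then `Γ̃ = 1 - P` for the projection `P = Γ (G₁ Γ)⁻¹ G₁` (`gammaTilde_eq`), and
  `G₁ U_∞ = R - G₂ D` holds exactly. The errors `V_k = U_k - U_∞` satisfy `P V_k = V_k`, so they are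
  recovered from `X_k = s G₁ V_k` by the proper matrix `(s⁻¹ Γ) (G₁ Γ)⁻¹`, and `X_k` obeys the
  iteration with `A = 1 - G₁ Γ`, `B = (G₁ Γ) (s G₂)`.

In both cases `E_k = -G₁ (U_k - U_∞) - G₂ Θ_k` on `[0, T]` transfers the bound to the output errors
(`exists_gain`).
-/

noncomputable section

namespace ILC

/-! ### The scalar Laplace transform -/

theorem eventually_halfPlanes {P : ℂ → Prop} :
    (∀ᶠ s in halfPlanes, P s) ↔ ∃ σ : ℝ, ∀ s : ℂ, σ ≤ s.re → P s := by
  simp only [halfPlanes, eventually_comap, eventually_atTop]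
  constructor
  · rintro ⟨σ, h⟩
    exact ⟨σ, fun s hs => h s.re hs s rfl⟩
  · rintro ⟨σ, h⟩
    exact ⟨σ, fun b hb s hs => h s (hs ▸ hb)⟩

instance : NeBot halfPlanes :=
  comap_neBot_iff.2 fun t ht => by
    obtain ⟨x, hx⟩ := Filter.nonempty_of_mem ht
    exact ⟨(x : ℂ), by simpa using hx⟩

instance : IsCountablyGenerated halfPlanes :=
  inferInstanceAs (IsCountablyGenerated (comap Complex.re atTop))

/-- The Laplace integrand of `f` is integrable on the line `Re s = σ` for some `σ`. -/
def HasLap (f : ℝ → ℂ) : Prop :=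
  ∃ σ : ℝ, IntegrableOn (fun t : ℝ => Complex.exp (-(σ : ℂ) * t) * f t) (Ioi 0)

/-- The one-sided Laplace transform of a complex-valued function. -/
def lap (f : ℝ → ℂ) (s : ℂ) : ℂ := ∫ t in Ioi (0 : ℝ), Complex.exp (-s * t) * f t

theorem norm_exp_neg_mul (s : ℂ) (t : ℝ) :
    ‖Complex.exp (-s * t)‖ = Real.exp (-s.re * t) := by
  rw [Complex.norm_exp]; simp

theorem integrableOn_laplace_integrand {f : ℝ → ℂ} {σ : ℝ} {s : ℂ} (hs : σ ≤ s.re)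
    (hf : IntegrableOn (fun t : ℝ => Complex.exp (-(σ : ℂ) * t) * f t) (Ioi 0)) :
    IntegrableOn (fun t : ℝ => Complex.exp (-s * t) * f t) (Ioi 0) := by
  have h : IntegrableOn (fun t : ℝ => Complex.exp (-(s - σ) * t) *
      (Complex.exp (-(σ : ℂ) * t) * f t)) (Ioi 0) := by
    refine Integrable.bdd_mul (c := 1) hf ?_ ?_
    · exact Continuous.aestronglyMeasurable (by fun_prop)
    · refine (ae_restrict_iff' measurableSet_Ioi).2 (ae_of_all _ fun t ht => ?_)
      rw [norm_exp_neg_mul, Real.exp_le_one_iff]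
      have : 0 ≤ s.re - σ := sub_nonneg.2 hs
      have h0 : (0 : ℝ) < t := ht
      simp only [Complex.sub_re, Complex.ofReal_re]
      nlinarith
  refine h.congr_fun (fun t _ => ?_) measurableSet_Ioi
  simp only
  rw [← mul_assoc, ← Complex.exp_add]
  congr 2
  ring

theorem HasLap.eventually {f : ℝ → ℂ} (hf : HasLap f) :
    ∀ᶠ s in halfPlanes, IntegrableOn (fun t : ℝ => Complex.exp (-s * t) * f t) (Ioi 0) := by
  obtain ⟨σ, hσ⟩ := hf
  exact eventually_halfPlanes.2 ⟨σ, fun s hs => integrableOn_laplace_integrand hs hσ⟩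

theorem hasLap_iff_eventually {f : ℝ → ℂ} :
    HasLap f ↔ ∀ᶠ s in halfPlanes,
      IntegrableOn (fun t : ℝ => Complex.exp (-s * t) * f t) (Ioi 0) := by
  refine ⟨HasLap.eventually, fun h => ?_⟩
  obtain ⟨σ, hσ⟩ := eventually_halfPlanes.1 h
  exact ⟨σ, hσ σ (by simp)⟩

theorem HasLap.congr {f g : ℝ → ℂ} (hf : HasLap f) (h : f =ᵐ[volume.restrict (Ioi 0)] g) :
    HasLap g := by
  obtain ⟨σ, hσ⟩ := hf
  refine ⟨σ, Integrable.congr hσ ?_⟩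
  filter_upwards [h] with t ht
  rw [ht]

theorem lap_congr {f g : ℝ → ℂ} (h : f =ᵐ[volume.restrict (Ioi 0)] g) : lap f = lap g := by
  ext s
  refine integral_congr_ae ?_
  filter_upwards [h] with t ht
  rw [ht]

theorem HasLap.add {f g : ℝ → ℂ} (hf : HasLap f) (hg : HasLap g) :
    HasLap (fun t => f t + g t) := by
  rw [hasLap_iff_eventually] at *
  filter_upwards [hf, hg] with s h₁ h₂
  exact (h₁.add h₂).congr_fun (fun t _ => by simp [mul_add]) measurableSet_Ioi

theorem HasLap.const_mul {f : ℝ → ℂ} (hf : HasLap f) (c : ℂ) : HasLap (fun t => c * f t) := by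
  rw [hasLap_iff_eventually] at *
  filter_upwards [hf] with s h₁
  refine (Integrable.const_mul h₁ c).congr (ae_of_all _ fun t => ?_)
  simp only
  ring

theorem HasLap.sub {f g : ℝ → ℂ} (hf : HasLap f) (hg : HasLap g) :
    HasLap (fun t => f t - g t) := by
  refine (hf.add (hg.const_mul (-1))).congr (ae_of_all _ fun t => ?_)
  simp only
  ring

theorem lap_add {f g : ℝ → ℂ} (hf : HasLap f) (hg : HasLap g) :
    ∀ᶠ s in halfPlanes, lap (fun t => f t + g t) s = lap f s + lap g s := by
  filter_upwards [hf.eventually, hg.eventually] with s h₁ h₂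
  rw [lap, lap, lap, ← integral_add h₁ h₂]
  simp only [mul_add]

theorem lap_const_mul (f : ℝ → ℂ) (c s : ℂ) : lap (fun t => c * f t) s = c * lap f s := by
  rw [lap, lap, ← integral_const_mul]
  congr 1 with t
  ring

theorem lap_sub {f g : ℝ → ℂ} (hf : HasLap f) (hg : HasLap g) :
    ∀ᶠ s in halfPlanes, lap (fun t => f t - g t) s = lap f s - lap g s := by
  filter_upwards [hf.eventually, hg.eventually] with s h₁ h₂
  rw [lap, lap, lap, ← integral_sub h₁ h₂]
  simp only [mul_sub]

theorem hasLap_zero : HasLap fun _ => 0 := ⟨0, by simp⟩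

theorem HasLap.sum {ι : Type*} (S : Finset ι) {f : ι → ℝ → ℂ} (hf : ∀ i ∈ S, HasLap (f i)) :
    HasLap (fun t => ∑ i ∈ S, f i t) := by
  classical
  induction S using Finset.induction_on with
  | empty => simpa using hasLap_zero
  | insert a S ha ih =>
    simp only [Finset.sum_insert ha]
    exact (hf a (by simp)).add (ih fun i hi => hf i (by simp [hi]))

theorem lap_sum {ι : Type*} (S : Finset ι) {f : ι → ℝ → ℂ} (hf : ∀ i ∈ S, HasLap (f i)) :
    ∀ᶠ s in halfPlanes, lap (fun t => ∑ i ∈ S, f i t) s = ∑ i ∈ S, lap (f i) s := by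
  filter_upwards [(Finset.eventually_all S).2 fun i hi => (hf i hi).eventually] with s hs
  simp only [lap, Finset.mul_sum]
  exact integral_finsetSum S hs

theorem hasLap_of_norm_le {f : ℝ → ℂ} {C σ : ℝ}
    (hm : AEStronglyMeasurable f (volume.restrict (Ioi 0)))
    (hf : ∀ t, 0 < t → ‖f t‖ ≤ C * Real.exp (σ * t)) : HasLap f := by
  refine ⟨σ + 1, Integrable.mono' (g := fun t => C * Real.exp (-1 * t)) ?_ ?_ ?_⟩
  · exact (integrableOn_exp_mul_Ioi (by norm_num) 0).const_mul C
  · exact (Continuous.aestronglyMeasurable (by fun_prop)).mul hm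
  · refine (ae_restrict_iff' measurableSet_Ioi).2 (ae_of_all _ fun t ht => ?_)
    rw [norm_mul, norm_exp_neg_mul]
    refine (mul_le_mul_of_nonneg_left (hf t ht) (Real.exp_pos _).le).trans (le_of_eq ?_)
    rw [mul_left_comm, ← Real.exp_add]
    congr 2
    simp only [Complex.ofReal_re]
    ring

theorem tendsto_lap_zero {f : ℝ → ℂ} (hf : HasLap f) : Tendsto (lap f) halfPlanes (𝓝 0) := by
  obtain ⟨σ, hσ⟩ := hf
  have key : Tendsto (lap f) halfPlanes (𝓝 (∫ _ in Ioi (0 : ℝ), (0 : ℂ))) := by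
    refine tendsto_integral_filter_of_dominated_convergence
      (fun t => ‖Complex.exp (-(σ : ℂ) * t) * f t‖) ?_ ?_ hσ.norm ?_
    · filter_upwards [eventually_halfPlanes.2 ⟨σ, fun s hs => hs⟩] with s hs
      exact (integrableOn_laplace_integrand hs hσ).aestronglyMeasurable
    · filter_upwards [eventually_halfPlanes.2 ⟨σ, fun s hs => hs⟩] with s hs
      refine (ae_restrict_iff' measurableSet_Ioi).2 (ae_of_all _ fun t ht => ?_)
      rw [norm_mul, norm_mul, norm_exp_neg_mul, norm_exp_neg_mul]
      have h0 : (0 : ℝ) < t := ht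
      refine mul_le_mul_of_nonneg_right (Real.exp_le_exp.2 ?_) (norm_nonneg _)
      rw [Complex.ofReal_re]
      nlinarith
    · refine (ae_restrict_iff' measurableSet_Ioi).2 (ae_of_all _ fun t ht => ?_)
      have h0 : (0 : ℝ) < t := ht
      rw [tendsto_zero_iff_norm_tendsto_zero]
      have : Tendsto (fun s : ℂ => Real.exp (-(s.re * t)) * ‖f t‖) halfPlanes (𝓝 (0 * ‖f t‖)) := by
        refine Tendsto.mul_const _ (Real.tendsto_exp_neg_atTop_nhds_zero.comp ?_)
        exact Tendsto.atTop_mul_const h0 tendsto_comap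
      simp only [norm_mul, norm_exp_neg_mul]
      simpa only [neg_mul, zero_mul] using this
  simpa using key

/-! ### Uniqueness -/

open scoped FourierTransform SchwartzMap in
/-- The Fourier transform is injective on integrable functions: by self-adjointness `f` is
orthogonal to the Fourier transform of every Schwartz function, that is, to every Schwartz
function. -/
theorem ae_eq_zero_of_fourier_eq_zero {f : ℝ → ℂ} (hf : Integrable f)
    (h : ∀ ξ, 𝓕 f ξ = 0) : f =ᵐ[volume] 0 := by
  refine ae_eq_zero_of_integral_contDiff_smul_eq_zero hf.locallyIntegrable ?_
  intro g g_smooth g_cpt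
  have hg₁ : HasCompactSupport (Complex.ofRealCLM ∘ g) := g_cpt.comp_left rfl
  have hg₂ : ContDiff ℝ (⊤ : ℕ∞) (Complex.ofRealCLM ∘ g) :=
    Complex.ofRealCLM.contDiff.comp g_smooth
  set φ : 𝓢(ℝ, ℂ) := hg₁.toSchwartzMap hg₂ with hφ
  have hφ' : 𝓕 (𝓕⁻ φ : 𝓢(ℝ, ℂ)) = φ := FourierTransform.fourier_fourierInv_eq φ
  have key := VectorFourier.integral_fourierIntegral_smul_eq_flip (μ := volume) (ν := volume)
    (L := innerₗ ℝ) (f := f) (g := (𝓕⁻ φ : 𝓢(ℝ, ℂ))) Real.continuous_fourierChar continuous_inner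
    hf (𝓕⁻ φ : 𝓢(ℝ, ℂ)).integrable
  have h₁ : ∀ x, VectorFourier.fourierIntegral Real.fourierChar volume (innerₗ ℝ).flip
      (⇑(𝓕⁻ φ : 𝓢(ℝ, ℂ))) x = φ x := by
    intro x
    rw [flip_innerₗ]
    have := congrArg (fun ψ : 𝓢(ℝ, ℂ) => ψ x) hφ'
    simp only [SchwartzMap.fourier_coe] at this
    exact this
  have h₂ : ∀ ξ, VectorFourier.fourierIntegral Real.fourierChar volume (innerₗ ℝ) f ξ = 0 := h
  simp only [h₁, h₂, zero_smul, integral_zero] at key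
  rw [key]
  refine integral_congr_ae (ae_of_all _ fun x => ?_)
  simp [hφ, mul_comm]

open scoped FourierTransform in
/-- Lerch's theorem: on a vertical line the Laplace transform is the Fourier transform of an
integrable function. -/
theorem ae_eq_zero_of_lap_eq_zero {f : ℝ → ℂ} (hf : HasLap f)
    (h : ∀ᶠ s in halfPlanes, lap f s = 0) : f =ᵐ[volume.restrict (Ioi 0)] 0 := by
  obtain ⟨σ, hσ⟩ := eventually_halfPlanes.1 (h.and hf.eventually)
  set F : ℝ → ℂ := (Ioi 0).indicator (fun t : ℝ => Complex.exp (-(σ : ℂ) * t) * f t) with hF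
  have hFi : Integrable F := (hσ σ (by simp)).2.integrable_indicator measurableSet_Ioi
  have hF0 : F =ᵐ[volume] 0 := by
    refine ae_eq_zero_of_fourier_eq_zero hFi fun ξ => ?_
    rw [← (hσ (σ + 2 * Real.pi * ξ * Complex.I) (by simp)).1,
      Real.fourier_real_eq_integral_exp_smul,
      lap, ← integral_indicator measurableSet_Ioi]
    congr 1 with t
    by_cases ht : t ∈ Ioi (0 : ℝ)
    · simp only [hF, indicator_of_mem ht, smul_eq_mul]
      rw [← mul_assoc, ← Complex.exp_add]
      congr 2
      push_cast
      ring
    · simp only [hF, indicator_of_notMem ht, smul_zero]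
  refine (ae_restrict_iff' measurableSet_Ioi).2 ?_
  filter_upwards [hF0] with t ht hpos
  simpa [hF, indicator_of_mem hpos] using ht

theorem ae_eq_of_lap_eq {f g : ℝ → ℂ} (hf : HasLap f) (hg : HasLap g)
    (h : ∀ᶠ s in halfPlanes, lap f s = lap g s) : f =ᵐ[volume.restrict (Ioi 0)] g := by
  have := ae_eq_zero_of_lap_eq_zero (hf.sub hg) (by
    filter_upwards [h, lap_sub hf hg] with s h₁ h₂
    rw [h₂, h₁, sub_self])
  filter_upwards [this] with t ht
  simpa [sub_eq_zero] using ht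

/-! ### Convolution -/

/-- The one-sided convolution `∫_0^t φ(t - τ) w(τ) dτ`. -/
def conv (φ w : ℝ → ℂ) (t : ℝ) : ℂ := ∫ τ in (0 : ℝ)..t, φ (t - τ) * w τ

theorem exp_mul_conv (φ w : ℝ → ℂ) (s : ℂ) (t : ℝ) :
    ∫ τ in (0 : ℝ)..t, ContinuousLinearMap.mul ℝ ℂ (Complex.exp (-s * τ) * w τ)
      (Complex.exp (-s * (t - τ : ℝ)) * φ (t - τ)) = Complex.exp (-s * t) * conv φ w t := by
  rw [conv, ← intervalIntegral.integral_const_mul]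
  congr 1 with τ
  have : Complex.exp (-s * t) = Complex.exp (-s * τ) * Complex.exp (-s * (t - τ : ℝ)) := by
    rw [← Complex.exp_add]; congr 1; push_cast; ring
  rw [this, ContinuousLinearMap.mul_apply']
  ring

theorem HasLap.conv {φ w : ℝ → ℂ} (hφ : HasLap φ) (hw : HasLap w) : HasLap (conv φ w) := by
  rw [hasLap_iff_eventually] at *
  filter_upwards [hφ, hw] with s h₁ h₂
  have := (integrable_posConvolution h₂ h₁ (ContinuousLinearMap.mul ℝ ℂ)).integrableOn (s := Ioi 0)
  refine this.congr_fun (fun t ht => ?_) measurableSet_Ioi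
  simp only [posConvolution, indicator_of_mem ht]
  exact exp_mul_conv φ w s t

theorem lap_conv {φ w : ℝ → ℂ} (hφ : HasLap φ) (hw : HasLap w) :
    ∀ᶠ s in halfPlanes, lap (conv φ w) s = lap φ s * lap w s := by
  filter_upwards [hφ.eventually, hw.eventually] with s h₁ h₂
  have := integral_posConvolution h₂ h₁ (ContinuousLinearMap.mul ℝ ℂ)
  simp only [exp_mul_conv] at this
  rw [lap, this, ContinuousLinearMap.mul_apply', mul_comm]
  rfl

theorem continuous_conv {φ w : ℝ → ℂ} (hφ : Continuous φ) (hw : Continuous w) :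
    Continuous (conv φ w) :=
  intervalIntegral.continuous_parametric_intervalIntegral_of_continuous (by fun_prop) continuous_id

theorem lap_exp (a : ℂ) : HasLap (fun t : ℝ => Complex.exp (a * t)) ∧
    ∀ᶠ s in halfPlanes, lap (fun t : ℝ => Complex.exp (a * t)) s = 1 / (s - a) := by
  have hexp : ∀ s : ℂ, (fun t : ℝ => Complex.exp (-s * t) * Complex.exp (a * t)) =
      fun t : ℝ => Complex.exp ((a - s) * t) := by
    intro s; ext t; rw [← Complex.exp_add]; congr 1; ring
  constructor
  · rw [hasLap_iff_eventually, eventually_halfPlanes]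
    refine ⟨a.re + 1, fun s hs => ?_⟩
    rw [hexp]
    exact integrableOn_exp_mul_complex_Ioi (by simp; linarith) 0
  · refine eventually_halfPlanes.2 ⟨a.re + 1, fun s hs => ?_⟩
    rw [lap, hexp, integral_exp_mul_complex_Ioi (by simp; linarith)]
    simp only [Complex.ofReal_zero, mul_zero, Complex.exp_zero]
    rw [← neg_sub s a, neg_div_neg_eq]

theorem hasLap_one : HasLap fun _ => 1 := by simpa using (lap_exp 0).1

theorem lap_one : ∀ᶠ s in halfPlanes, lap (fun _ => 1) s = s⁻¹ := by
  simpa using (lap_exp 0).2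

theorem conv_one_left (f : ℝ → ℂ) :
    conv (fun _ => 1) f = fun t => ∫ τ in (0 : ℝ)..t, f τ := by
  ext t
  simp only [conv, one_mul]

theorem hasLap_integral {f : ℝ → ℂ} (hf : HasLap f) : HasLap fun t => ∫ τ in (0 : ℝ)..t, f τ := by
  simpa only [conv_one_left] using hasLap_one.conv hf

theorem lap_integral {f : ℝ → ℂ} (hf : HasLap f) :
    ∀ᶠ s in halfPlanes, lap (fun t => ∫ τ in (0 : ℝ)..t, f τ) s = s⁻¹ * lap f s := by
  filter_upwards [lap_conv hasLap_one hf, lap_one] with s h₁ h₂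
  rw [← h₂, ← h₁, conv_one_left]

theorem HasLap.integrableOn_Ioc {f : ℝ → ℂ} (hf : HasLap f) (T : ℝ) :
    IntegrableOn f (Ioc 0 T) := by
  obtain ⟨σ, hσ⟩ := hf
  have h := (hσ.mono_set (Ioc_subset_Ioi_self : Ioc 0 T ⊆ Ioi 0)).continuousOn_mul_of_subset
    (g := fun t : ℝ => Complex.exp ((σ : ℂ) * t)) (K := Icc 0 T) (by fun_prop)
    isCompact_Icc measurableSet_Ioc Ioc_subset_Icc_self
  refine h.congr_fun (fun t _ => ?_) measurableSet_Ioc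
  simp only
  rw [← mul_assoc, ← Complex.exp_add]
  simp

/-! ### Evaluation of rational functions near infinity -/

section Germ

variable {S : Type} [Field S] {l : Filter S} (f : ℝ →+* S)

theorem eventually_eval₂_ne_zero (hl : ∀ a : S, ∀ᶠ s in l, s ≠ a) {Q : Polynomial ℝ}
    (hQ : Q ≠ 0) : ∀ᶠ s in l, Q.eval₂ f s ≠ 0 := by
  classical
  have hQ' : Q.map f ≠ 0 := (Polynomial.map_ne_zero_iff f.injective).2 hQ
  filter_upwards [(Finset.eventually_all (Q.map f).roots.toFinset).2 fun a _ => hl a] with s hs h0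
  refine hs s ?_ rfl
  rw [Multiset.mem_toFinset, Polynomial.mem_roots hQ', Polynomial.IsRoot, Polynomial.eval_map]
  exact h0

/-- A rational function has finitely many poles, so it defines a germ along every filter that
leaves each point; this is a ring homomorphism. -/
def evalGerm (hl : ∀ a : S, ∀ᶠ s in l, s ≠ a) : RatFunc ℝ →+* Germ l S where
  toFun g := ((fun s => g.eval f s : S → S) : Germ l S)
  map_zero' := by simp only [RatFunc.eval_zero]; rfl
  map_one' := by simp only [RatFunc.eval_one]; rfl
  map_add' x y := by
    refine Germ.coe_eq.2 ?_
    filter_upwards [eventually_eval₂_ne_zero f hl x.denom_ne_zero,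
      eventually_eval₂_ne_zero f hl y.denom_ne_zero] with s hx hy
    exact RatFunc.eval_add f s hx hy
  map_mul' x y := by
    refine Germ.coe_eq.2 ?_
    filter_upwards [eventually_eval₂_ne_zero f hl x.denom_ne_zero,
      eventually_eval₂_ne_zero f hl y.denom_ne_zero] with s hx hy
    exact RatFunc.eval_mul f s hx hy

theorem eventually_eval_add (hl : ∀ a : S, ∀ᶠ s in l, s ≠ a) (x y : RatFunc ℝ) :
    ∀ᶠ s in l, (x + y).eval f s = x.eval f s + y.eval f s :=
  Germ.coe_eq.1 ((evalGerm f hl).map_add x y)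

theorem eventually_eval_sub (hl : ∀ a : S, ∀ᶠ s in l, s ≠ a) (x y : RatFunc ℝ) :
    ∀ᶠ s in l, (x - y).eval f s = x.eval f s - y.eval f s :=
  Germ.coe_eq.1 ((evalGerm f hl).map_sub x y)

theorem eventually_eval_mul (hl : ∀ a : S, ∀ᶠ s in l, s ≠ a) (x y : RatFunc ℝ) :
    ∀ᶠ s in l, (x * y).eval f s = x.eval f s * y.eval f s :=
  Germ.coe_eq.1 ((evalGerm f hl).map_mul x y)

theorem eventually_map_eval_mul (hl : ∀ a : S, ∀ᶠ s in l, s ≠ a) {a b c : ℕ}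
    (K : Matrix (Fin a) (Fin b) (RatFunc ℝ)) (H : Matrix (Fin b) (Fin c) (RatFunc ℝ)) :
    ∀ᶠ s in l, (K * H).map (fun g => g.eval f s) =
      K.map (fun g => g.eval f s) * H.map (fun g => g.eval f s) := by
  have : ∀ i j, ∀ᶠ s in l, ((K * H) i j).eval f s = ∑ k, (K i k).eval f s * (H k j).eval f s := by
    intro i j
    have h : evalGerm f hl ((K * H) i j) =
        Germ.coeRingHom l (∑ k, (fun s => (K i k).eval f s) * fun s => (H k j).eval f s) := by
      simp only [Matrix.mul_apply, map_sum, map_mul]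
      rfl
    filter_upwards [Germ.coe_eq.1 h] with s hs
    rw [hs]
    simp
  filter_upwards [eventually_all.2 fun i => eventually_all.2 (this i)] with s hs
  ext i j
  rw [Matrix.map_apply, hs, Matrix.mul_apply]
  rfl

theorem eventually_eval_det (hl : ∀ a : S, ∀ᶠ s in l, s ≠ a) {n : ℕ}
    (K : Matrix (Fin n) (Fin n) (RatFunc ℝ)) :
    ∀ᶠ s in l, K.det.eval f s = (K.map fun g => g.eval f s).det := by
  have h : evalGerm f hl K.det =
      Germ.coeRingHom l (Matrix.det (K.map fun g => fun s : S => g.eval f s)) := by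
    rw [RingHom.map_det, RingHom.map_det]
    rfl
  filter_upwards [Germ.coe_eq.1 h] with s hs
  rw [hs]
  exact RingHom.map_det (Pi.evalRingHom (fun _ : S => S) s) _

theorem eventually_map_eval_inv (hl : ∀ a : S, ∀ᶠ s in l, s ≠ a) {n : ℕ}
    {K : Matrix (Fin n) (Fin n) (RatFunc ℝ)} (hK : K.det ≠ 0) :
    ∀ᶠ s in l, K⁻¹.map (fun g => g.eval f s) = (K.map fun g => g.eval f s)⁻¹ := by
  filter_upwards [eventually_map_eval_mul f hl K K⁻¹] with s hs
  rw [Matrix.mul_nonsing_inv K (isUnit_iff_ne_zero.2 hK)] at hs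
  refine (Matrix.inv_eq_right_inv ?_).symm
  rw [← hs]
  ext i j
  by_cases h : i = j <;> simp [h, Matrix.one_apply]

end Germ

theorem eventually_ne_halfPlanes (a : ℂ) : ∀ᶠ s in halfPlanes, s ≠ a :=
  eventually_halfPlanes.2 ⟨a.re + 1, fun s hs h => by rw [h] at hs; linarith⟩

/-! ### Limits of rational matrices at infinity -/

theorem hasLimAtInfty_C (a : ℝ) : HasLimAtInfty (RatFunc.C a) a := by
  simp [HasLimAtInfty]

theorem HasLimAtInfty.sub {g h : RatFunc ℝ} {a b : ℝ} (hg : HasLimAtInfty g a)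
    (hh : HasLimAtInfty h b) : HasLimAtInfty (g - h) (a - b) :=
  (Tendsto.sub hg hh).congr' <| by
    filter_upwards [eventually_eval_sub (RingHom.id ℝ) eventually_ne_atTop g h] with s hs
    exact hs.symm

theorem matHasLimAtInfty_iff {a b : ℕ} {K : Matrix (Fin a) (Fin b) (RatFunc ℝ)}
    {K₀ : Matrix (Fin a) (Fin b) ℝ} : MatHasLimAtInfty K K₀ ↔
      Tendsto (fun s : ℝ => K.map fun g => g.eval (RingHom.id ℝ) s) atTop (𝓝 K₀) :=
  (tendsto_pi_nhds.trans (forall_congr' fun _ => tendsto_pi_nhds)).symm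

theorem MatHasLimAtInfty.mul {a b c : ℕ} {K : Matrix (Fin a) (Fin b) (RatFunc ℝ)}
    {H : Matrix (Fin b) (Fin c) (RatFunc ℝ)} {K₀ H₀} (hK : MatHasLimAtInfty K K₀)
    (hH : MatHasLimAtInfty H H₀) : MatHasLimAtInfty (K * H) (K₀ * H₀) := by
  rw [matHasLimAtInfty_iff] at *
  refine Tendsto.congr' ?_ (((Continuous.matrix_mul continuous_fst continuous_snd).tendsto
    (K₀, H₀)).comp (hK.prodMk_nhds hH))
  filter_upwards [eventually_map_eval_mul (RingHom.id ℝ) eventually_ne_atTop K H] with s hs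
  exact hs.symm

theorem matHasLimAtInfty_one {n : ℕ} :
    MatHasLimAtInfty (1 : Matrix (Fin n) (Fin n) (RatFunc ℝ)) 1 := by
  intro i j
  by_cases h : i = j
  · simpa [h, Matrix.one_apply] using hasLimAtInfty_C 1
  · simpa [h, Matrix.one_apply] using hasLimAtInfty_C 0

theorem MatHasLimAtInfty.sub {a b : ℕ} {K H : Matrix (Fin a) (Fin b) (RatFunc ℝ)} {K₀ H₀}
    (hK : MatHasLimAtInfty K K₀) (hH : MatHasLimAtInfty H H₀) :
    MatHasLimAtInfty (K - H) (K₀ - H₀) :=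
  fun i j => (hK i j).sub (hH i j)

theorem MatHasLimAtInfty.transpose {a b : ℕ} {K : Matrix (Fin a) (Fin b) (RatFunc ℝ)} {K₀}
    (hK : MatHasLimAtInfty K K₀) : MatHasLimAtInfty Kᵀ K₀ᵀ :=
  fun i j => hK j i

theorem MatHasLimAtInfty.unique {a b : ℕ} {K : Matrix (Fin a) (Fin b) (RatFunc ℝ)} {K₀ K₁}
    (h₀ : MatHasLimAtInfty K K₀) (h₁ : MatHasLimAtInfty K K₁) : K₀ = K₁ := by
  ext i j
  exact tendsto_nhds_unique (h₀ i j) (h₁ i j)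

theorem MatHasLimAtInfty.det_ne_zero {n : ℕ} {K : Matrix (Fin n) (Fin n) (RatFunc ℝ)} {K₀}
    (hK : MatHasLimAtInfty K K₀) (h₀ : K₀.det ≠ 0) : K.det ≠ 0 := by
  intro h
  rw [matHasLimAtInfty_iff] at hK
  have h₁ : Tendsto (fun s : ℝ => (K.map fun g => g.eval (RingHom.id ℝ) s).det) atTop
      (𝓝 K₀.det) := ((Continuous.matrix_det continuous_id).tendsto K₀).comp hK
  have h₂ : (fun s : ℝ => (K.map fun g => g.eval (RingHom.id ℝ) s).det) =ᶠ[atTop] fun _ => 0 := by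
    filter_upwards [eventually_eval_det (RingHom.id ℝ) eventually_ne_atTop K] with s hs
    rw [← hs, h, RatFunc.eval_zero]
  exact h₀ (tendsto_nhds_unique (h₁.congr' h₂) tendsto_const_nhds)

theorem MatHasLimAtInfty.inv {n : ℕ} {K : Matrix (Fin n) (Fin n) (RatFunc ℝ)} {K₀}
    (hK : MatHasLimAtInfty K K₀) (h₀ : K₀.det ≠ 0) : MatHasLimAtInfty K⁻¹ K₀⁻¹ := by
  have hdet := hK.det_ne_zero h₀
  rw [matHasLimAtInfty_iff] at *
  refine Tendsto.congr' (f₁ := fun s : ℝ => (K.map fun g => g.eval (RingHom.id ℝ) s)⁻¹) ?_ ?_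
  · filter_upwards [eventually_map_eval_inv (RingHom.id ℝ) eventually_ne_atTop hdet] with s hs
    exact hs.symm
  · simp only [Matrix.inv_def, Ring.inverse_eq_inv']
    refine Tendsto.smul ?_ (((Continuous.matrix_adjugate continuous_id).tendsto K₀).comp hK)
    exact Tendsto.inv₀ (((Continuous.matrix_det continuous_id).tendsto K₀).comp hK) h₀

theorem HasLimAtInfty.degree_lt {g : RatFunc ℝ} (hg : HasLimAtInfty g 0) :
    g.num.degree < g.denom.degree :=
  (Polynomial.div_tendsto_atTop_zero_iff_degree_lt _ _ g.denom_ne_zero).1 hg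

theorem HasLimAtInfty.exists_X_mul {g : RatFunc ℝ} (hg : HasLimAtInfty g 0) :
    ∃ a, HasLimAtInfty (RatFunc.X * g) a := by
  have hdeg : (Polynomial.X * g.num).degree ≤ g.denom.degree := by
    rw [Polynomial.degree_mul, Polynomial.degree_X, add_comm]
    exact Nat.WithBot.add_one_le_of_lt hg.degree_lt
  have heval : (fun s : ℝ => (Polynomial.X * g.num).eval s / g.denom.eval s) =ᶠ[atTop]
      fun s => (RatFunc.X * g).eval (RingHom.id ℝ) s := by
    filter_upwards [eventually_eval_mul (RingHom.id ℝ) eventually_ne_atTop RatFunc.X g] with s hs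
    rw [hs, RatFunc.eval_X, RatFunc.eval, Polynomial.eval_mul, Polynomial.eval_X, mul_div_assoc]
    rfl
  rcases hdeg.lt_or_eq with h | h
  · exact ⟨_, (Polynomial.div_tendsto_atTop_zero_of_degree_lt _ _ h).congr' heval⟩
  · exact ⟨_, (Polynomial.div_tendsto_atTop_leadingCoeff_div_of_degree_eq _ _ h).congr' heval⟩

theorem StrictlyProper.exists_X_smul {a b : ℕ} {G : Matrix (Fin a) (Fin b) (RatFunc ℝ)}
    (hG : StrictlyProper G) :
    ∃ M : Matrix (Fin a) (Fin b) ℝ, MatHasLimAtInfty ((RatFunc.X : RatFunc ℝ) • G) M := by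
  choose M hM using fun i j => (hG i j).exists_X_mul
  exact ⟨M, hM⟩

/-! ### Inverse Laplace transforms of rational functions -/

/-- Partial fractions, one pole at a time: `P / ((s - r) a)` is a constant multiple of
`1 / (s - r)` plus a product of `1 / (s - r)` with a strictly proper fraction over `a`, and a
product of transforms is the transform of a convolution. -/
theorem exists_lap_eq_div (Q : Polynomial ℂ) : Q ≠ 0 → ∀ P : Polynomial ℂ, P.degree < Q.degree →
    ∃ κ : ℝ → ℂ, Continuous κ ∧ HasLap κ ∧
      ∀ᶠ s in halfPlanes, lap κ s = P.eval s / Q.eval s := by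
  induction Q using WfDvdMonoid.induction_on_irreducible with
  | zero => exact fun h => absurd rfl h
  | unit u hu =>
    intro _ P hP
    rw [Polynomial.isUnit_iff_degree_eq_zero.1 hu] at hP
    have : P = 0 := by
      by_contra h
      exact absurd (Polynomial.zero_le_degree_iff.2 h) (not_le.2 hP)
    exact ⟨fun _ => 0, continuous_const, hasLap_zero, by simp [this, lap]⟩
  | mul a i ha hi ih =>
    intro _ P hP
    obtain ⟨κ, hκc, hκ, hκe⟩ := ih ha (P % a) (EuclideanDomain.mod_lt P ha)
    have hi1 := IsAlgClosed.degree_eq_one_of_irreducible ℂ hi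
    have hq : (P / a).degree ≤ 0 := by
      rw [Polynomial.degree_mul, hi1] at hP
      by_contra! hlt
      have h1 : (1 : WithBot ℕ) ≤ (P / a).degree :=
        Nat.WithBot.one_le_iff_zero_lt.2 hlt
      have hle : a.degree ≤ P.degree := by
        by_contra! hc
        rw [(Polynomial.div_eq_zero_iff ha).2 hc] at hlt
        simp at hlt
      have := Polynomial.degree_add_div ha hle
      rw [← this, add_comm] at hP
      exact absurd (add_le_add_left h1 a.degree) (not_le.2 hP)
    obtain ⟨c, r, hc, hir⟩ : ∃ c r : ℂ, c ≠ 0 ∧ ∀ s, i.eval s = c * (s - r) := by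
      have h := Polynomial.eq_X_add_C_of_degree_eq_one hi1
      have hc : i.leadingCoeff ≠ 0 := Polynomial.leadingCoeff_ne_zero.2 hi.ne_zero
      refine ⟨i.leadingCoeff, -(i.coeff 0 / i.leadingCoeff), hc, fun s => ?_⟩
      conv_lhs => rw [h]
      simp only [Polynomial.eval_add, Polynomial.eval_mul, Polynomial.eval_C, Polynomial.eval_X]
      field_simp
      ring
    obtain ⟨hel, hee⟩ := lap_exp r
    set q : ℂ := (P / a).coeff 0
    have hP' : ∀ s, P.eval s = a.eval s * q + (P % a).eval s := by
      intro s
      conv_lhs => rw [← EuclideanDomain.div_add_mod P a, Polynomial.eq_C_of_degree_le_zero hq]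
      simp [q]
    refine ⟨fun t => q / c * Complex.exp (r * t) +
      c⁻¹ * conv (fun t : ℝ => Complex.exp (r * t)) κ t, ?_, ?_, ?_⟩
    · have := continuous_conv (φ := fun t : ℝ => Complex.exp (r * t)) (by fun_prop) hκc
      fun_prop
    · exact (hel.const_mul _).add ((hel.conv hκ).const_mul _)
    · have hne : ∀ᶠ s in halfPlanes, a.eval s ≠ 0 := by
        classical
        filter_upwards [(Finset.eventually_all a.roots.toFinset).2 fun z _ =>
          eventually_ne_halfPlanes z] with s hs h0
        exact hs s (by rw [Multiset.mem_toFinset, Polynomial.mem_roots ha]; exact h0) rfl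
      filter_upwards [hee, hκe, lap_conv hel hκ, eventually_ne_halfPlanes r, hne,
        lap_add (hel.const_mul (q / c)) ((hel.conv hκ).const_mul c⁻¹)] with s h₁ h₂ h₃ h₄ h₅ h₆
      rw [h₆, lap_const_mul, lap_const_mul, h₃, h₁, h₂, hP', Polynomial.eval_mul, hir]
      have : s - r ≠ 0 := sub_ne_zero.2 h₄
      field_simp

/-- A real rational function takes conjugate values at conjugate points, so the real part of a
complex inverse transform is again an inverse transform. -/
theorem HasLimAtInfty.exists_lap_eq {g : RatFunc ℝ} (hg : HasLimAtInfty g 0) :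
    ∃ κ : ℝ → ℝ, Continuous κ ∧ HasLap (fun t => (κ t : ℂ)) ∧
      ∀ᶠ s in halfPlanes, lap (fun t => (κ t : ℂ)) s = g.eval (algebraMap ℝ ℂ) s := by
  obtain ⟨κ, hκc, hκ, hκe⟩ := exists_lap_eq_div (g.denom.map (algebraMap ℝ ℂ))
    ((Polynomial.map_ne_zero_iff (algebraMap ℝ ℂ).injective).2 g.denom_ne_zero)
    (g.num.map (algebraMap ℝ ℂ)) (by simpa only [Polynomial.degree_map] using hg.degree_lt)
  replace hκe : ∀ᶠ s in halfPlanes, lap κ s = g.eval (algebraMap ℝ ℂ) s := by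
    filter_upwards [hκe] with s hs
    rw [hs, RatFunc.eval, Polynomial.eval_map, Polynomial.eval_map]
  set σ := starRingEnd ℂ
  have hexp : ∀ s (t : ℝ), Complex.exp (-s * t) * σ (κ t) =
      σ (Complex.exp (-(σ s) * t) * κ t) := by
    intro s t
    simp [σ, ← Complex.exp_conj]
  have hconj : ∀ s, lap (fun t => σ (κ t)) s = σ (lap κ (σ s)) := by
    intro s
    rw [lap, lap, ← integral_conj]
    simp only [hexp]
    rfl
  have hconjL : HasLap fun t => σ (κ t) := by
    obtain ⟨τ, hτ⟩ := eventually_halfPlanes.1 hκ.eventually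
    refine ⟨τ, ?_⟩
    simp only [hexp]
    exact (Complex.conjLIE.toContinuousLinearEquiv.toContinuousLinearMap.integrable_comp
      (hτ (σ τ) (by simp [σ])))
  have hgconj : ∀ s, σ (g.eval (algebraMap ℝ ℂ) (σ s)) = g.eval (algebraMap ℝ ℂ) s := by
    intro s
    have hp : ∀ P : Polynomial ℝ, σ (P.eval₂ (algebraMap ℝ ℂ) (σ s)) =
        P.eval₂ (algebraMap ℝ ℂ) s := by
      intro P
      rw [Polynomial.hom_eval₂]
      congr 1
      · ext x; simp [σ]
      · simp [σ]
    rw [RatFunc.eval, map_div₀, hp, hp, RatFunc.eval]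
  have hre : (fun t => ((κ t).re : ℂ)) = fun t => 2⁻¹ * (κ t + σ (κ t)) := by
    ext t
    rw [Complex.add_conj, Complex.ofReal_mul, Complex.ofReal_ofNat,
      inv_mul_cancel_left₀ two_ne_zero]
  refine ⟨fun t => (κ t).re, by fun_prop, ?_, ?_⟩
  · rw [hre]
    exact (hκ.add hconjL).const_mul _
  · rw [hre]
    obtain ⟨τ, hτ⟩ := eventually_halfPlanes.1 hκe
    filter_upwards [lap_add hκ hconjL, eventually_halfPlanes.2 ⟨τ, fun s hs => hs⟩] with s h₁ h₂
    rw [lap_const_mul, h₁, hconj, hτ s h₂, hτ (σ s) (by simpa [σ] using h₂), hgconj]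
    ring

/-! ### Vector signals and their transforms -/

theorem laplace_apply {n : ℕ} (f : ℝ → Fin n → ℝ) (s : ℂ) (i : Fin n) :
    laplace f s i = lap (fun t => (f t i : ℂ)) s := rfl

theorem transformable_iff {n : ℕ} {f : ℝ → Fin n → ℝ} :
    Transformable f ↔ ∀ i, HasLap fun t => (f t i : ℂ) := by
  have hcast : ∀ (σ : ℝ) i, (fun t : ℝ => Complex.exp (-(σ : ℂ) * t) * (f t i : ℂ)) =
      fun t : ℝ => ((Real.exp (-σ * t) * f t i : ℝ) : ℂ) := by
    intro σ i
    ext t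
    push_cast
    rfl
  constructor
  · rintro ⟨σ, hσ⟩ i
    refine ⟨σ, ?_⟩
    rw [hcast]
    exact (Integrable.eval hσ i).ofReal
  · intro h
    obtain ⟨σ, hσ⟩ := eventually_halfPlanes.1 (eventually_all.2 fun i => (h i).eventually)
    refine ⟨σ, Integrable.of_eval fun i => ?_⟩
    have := hσ σ (by simp) i
    rw [hcast] at this
    exact this.re.congr (ae_of_all _ fun t => Complex.ofReal_re _)

theorem Transformable.integrableOn {n : ℕ} {f : ℝ → Fin n → ℝ} (hf : Transformable f) (T : ℝ) :
    IntegrableOn f (Ioc 0 T) :=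
  Integrable.of_eval fun i => by
    simpa using ((transformable_iff.1 hf i).integrableOn_Ioc T).re

theorem Transformable.intervalIntegrable {n : ℕ} {f : ℝ → Fin n → ℝ} (hf : Transformable f)
    {T : ℝ} (hT : 0 ≤ T) : IntervalIntegrable f volume 0 T :=
  (intervalIntegrable_iff_integrableOn_Ioc_of_le hT).2 (hf.integrableOn T)

theorem Transformable.congr {n : ℕ} {f g : ℝ → Fin n → ℝ} (hf : Transformable f)
    (h : f =ᵐ[volume.restrict (Ioi 0)] g) : Transformable g :=
  transformable_iff.2 fun i => (transformable_iff.1 hf i).congr <| by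
    filter_upwards [h] with t ht
    rw [ht]

theorem laplace_congr {n : ℕ} {f g : ℝ → Fin n → ℝ}
    (h : f =ᵐ[volume.restrict (Ioi 0)] g) : laplace f = laplace g := by
  ext s i
  rw [laplace_apply, laplace_apply, lap_congr]
  filter_upwards [h] with t ht
  rw [ht]

theorem ae_eq_of_laplace_eq {n : ℕ} {f g : ℝ → Fin n → ℝ} (hf : Transformable f)
    (hg : Transformable g) (h : ∀ᶠ s in halfPlanes, laplace f s = laplace g s) :
    f =ᵐ[volume.restrict (Ioi 0)] g := by
  have : ∀ i, ∀ᵐ t ∂volume.restrict (Ioi 0), (f t i : ℂ) = g t i := fun i =>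
    ae_eq_of_lap_eq (transformable_iff.1 hf i) (transformable_iff.1 hg i) <| by
      filter_upwards [h] with s hs
      rw [← laplace_apply, hs, laplace_apply]
  filter_upwards [ae_all_iff.2 this] with t ht
  ext i
  exact_mod_cast ht i

theorem ae_Ioi_of_eqOn_Ici {n : ℕ} {f g : ℝ → Fin n → ℝ} (h : EqOn f g (Ici 0)) :
    f =ᵐ[volume.restrict (Ioi 0)] g :=
  (ae_restrict_iff' measurableSet_Ioi).2 (ae_of_all _ fun _ ht => h (Ioi_subset_Ici_self ht))

/-- The function part of `x` is a continuous signal and the transform of `x` is `X` in some right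
half-plane. -/
def HasTransform {n : ℕ} (x : Signal n) (X : ℂ → Fin n → ℂ) : Prop :=
  IsContSignal x.reg ∧ ∀ᶠ s in halfPlanes, x.transform s = X s

theorem HasTransform.congr {n : ℕ} {x : Signal n} {X Y : ℂ → Fin n → ℂ} (h : HasTransform x X)
    (hXY : ∀ᶠ s in halfPlanes, X s = Y s) : HasTransform x Y :=
  ⟨h.1, by filter_upwards [h.2, hXY] with s h₁ h₂; rw [h₁, h₂]⟩

theorem hasTransform_self {n : ℕ} {x : Signal n} (hx : IsContSignal x.reg) :
    HasTransform x x.transform := ⟨hx, Eventually.of_forall fun _ => rfl⟩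

theorem transform_of_impulse_eq_zero {n : ℕ} {x : Signal n} (hx : x.impulse = 0) :
    x.transform = laplace x.reg := by
  ext s i
  simp [Signal.transform, hx]

/-- A function, as a signal without impulse. -/
def ofFun {n : ℕ} (f : ℝ → Fin n → ℝ) : Signal n := ⟨0, f⟩

theorem transform_ofFun {n : ℕ} (f : ℝ → Fin n → ℝ) : (ofFun f).transform = laplace f :=
  transform_of_impulse_eq_zero rfl

theorem hasTransform_ofFun {n : ℕ} {f : ℝ → Fin n → ℝ} (hf : IsContSignal f) :
    HasTransform (ofFun f) (laplace f) :=
  ⟨hf, Eventually.of_forall fun _ => by rw [transform_ofFun]⟩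

theorem tendsto_transform {n : ℕ} {x : Signal n} (hx : IsContSignal x.reg) (i : Fin n) :
    Tendsto (fun s => x.transform s i) halfPlanes (𝓝 (x.impulse i)) := by
  simpa using! (tendsto_lap_zero (transformable_iff.1 hx.2 i)).const_add (x.impulse i : ℂ)

/-- The impulse is the limit of the transform, and the function part is determined by Lerch's
theorem and continuity. -/
theorem HasTransform.unique {n : ℕ} {x y : Signal n} {X Y : ℂ → Fin n → ℂ}
    (hx : HasTransform x X) (hy : HasTransform y Y) (h : ∀ᶠ s in halfPlanes, X s = Y s) :
    x.impulse = y.impulse ∧ EqOn x.reg y.reg (Ici 0) := by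
  have heq : ∀ᶠ s in halfPlanes, x.transform s = y.transform s := by
    filter_upwards [hx.2, hy.2, h] with s h₁ h₂ h₃
    rw [h₁, h₂, h₃]
  have himp : x.impulse = y.impulse := by
    ext i
    have := tendsto_nhds_unique ((tendsto_transform hx.1 i).congr' <| by
      filter_upwards [heq] with s hs
      rw [hs]) (tendsto_transform hy.1 i)
    exact_mod_cast this
  refine ⟨himp, ?_⟩
  have hae := ae_eq_of_laplace_eq hx.1.2 hy.1.2 <| by
    filter_upwards [heq] with s hs
    ext i
    simpa [Signal.transform, himp] using congrFun hs i
  rw [restrict_Ioi_eq_restrict_Ici] at hae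
  refine Measure.eqOn_of_ae_eq hae hx.1.1 hy.1.1 ?_
  rw [interior_Ici, closure_Ioi]

instance {n : ℕ} : Add (Signal n) := ⟨fun x y => ⟨x.impulse + y.impulse, x.reg + y.reg⟩⟩

instance {n : ℕ} : Sub (Signal n) := ⟨fun x y => ⟨x.impulse - y.impulse, x.reg - y.reg⟩⟩

@[simp] theorem add_impulse {n : ℕ} (x y : Signal n) :
    (x + y).impulse = x.impulse + y.impulse := rfl

@[simp] theorem add_reg {n : ℕ} (x y : Signal n) (t : ℝ) :
    (x + y).reg t = x.reg t + y.reg t := rfl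

@[simp] theorem sub_impulse {n : ℕ} (x y : Signal n) :
    (x - y).impulse = x.impulse - y.impulse := rfl

@[simp] theorem sub_reg {n : ℕ} (x y : Signal n) (t : ℝ) :
    (x - y).reg t = x.reg t - y.reg t := rfl

theorem HasTransform.add {n : ℕ} {x y : Signal n} {X Y : ℂ → Fin n → ℂ} (hx : HasTransform x X)
    (hy : HasTransform y Y) : HasTransform (x + y) fun s => X s + Y s := by
  have hx' := transformable_iff.1 hx.1.2
  have hy' := transformable_iff.1 hy.1.2
  refine ⟨⟨hx.1.1.add hy.1.1, transformable_iff.2 fun i => ?_⟩, ?_⟩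
  · simpa using (hx' i).add (hy' i)
  · filter_upwards [hx.2, hy.2, eventually_all.2 fun i => lap_add (hx' i) (hy' i)] with s h₁ h₂ h₃
    ext i
    rw [← h₁, ← h₂]
    have := h₃ i
    simp only [Signal.transform, laplace_apply, add_reg, add_impulse, Pi.add_apply,
      Complex.ofReal_add, this]
    ring

theorem HasTransform.sub {n : ℕ} {x y : Signal n} {X Y : ℂ → Fin n → ℂ} (hx : HasTransform x X)
    (hy : HasTransform y Y) : HasTransform (x - y) fun s => X s - Y s := by
  have hx' := transformable_iff.1 hx.1.2
  have hy' := transformable_iff.1 hy.1.2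
  refine ⟨⟨hx.1.1.sub hy.1.1, transformable_iff.2 fun i => ?_⟩, ?_⟩
  · simpa using (hx' i).sub (hy' i)
  · filter_upwards [hx.2, hy.2, eventually_all.2 fun i => lap_sub (hx' i) (hy' i)] with s h₁ h₂ h₃
    ext i
    rw [← h₁, ← h₂]
    have := h₃ i
    simp only [Signal.transform, laplace_apply, sub_reg, sub_impulse, Pi.sub_apply,
      Complex.ofReal_sub, this]
    ring

/-! ### Integration and differentiation -/

/-- The primitive that vanishes at time `0`. -/
def prim {n : ℕ} (f : ℝ → Fin n → ℝ) (t : ℝ) : Fin n → ℝ := ∫ τ in (0 : ℝ)..t, f τ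

theorem prim_congr {n : ℕ} {f g : ℝ → Fin n → ℝ} {T : ℝ} (h : EqOn f g (Icc 0 T)) :
    EqOn (prim f) (prim g) (Icc 0 T) := fun t ht => by
  refine intervalIntegral.integral_congr fun τ hτ => ?_
  rw [uIcc_of_le ht.1] at hτ
  exact h ⟨hτ.1, hτ.2.trans ht.2⟩

theorem prim_apply {n : ℕ} {f : ℝ → Fin n → ℝ} (hf : Transformable f) {t : ℝ} (ht : 0 ≤ t)
    (i : Fin n) : prim f t i = ∫ τ in (0 : ℝ)..t, f τ i := by
  rw [prim, intervalIntegral.integral_of_le ht, intervalIntegral.integral_of_le ht,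
    eval_integral fun j => (hf.integrableOn t).eval j]

theorem isContSignal_prim {n : ℕ} {f : ℝ → Fin n → ℝ} (hf : Transformable f) :
    IsContSignal (prim f) := by
  constructor
  · have hc : Continuous fun t => ∫ τ in (0 : ℝ)..t, (Ioi 0).indicator f τ := by
      refine intervalIntegral.continuous_primitive (fun a b => ?_) 0
      rw [intervalIntegrable_iff, IntegrableOn, integrable_indicator_iff measurableSet_Ioi,
        IntegrableOn, Measure.restrict_restrict measurableSet_Ioi]
      exact (hf.integrableOn (max a b)).mono_set fun t ht => ⟨ht.1, ht.2.2⟩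
    refine hc.continuousOn.congr fun t ht => ?_
    have ht' : (0 : ℝ) ≤ t := ht
    beta_reduce
    rw [prim, intervalIntegral.integral_of_le ht', intervalIntegral.integral_of_le ht']
    exact setIntegral_congr_fun measurableSet_Ioc fun τ hτ => by
      simp only [indicator_of_mem (Ioc_subset_Ioi_self hτ)]
  · refine transformable_iff.2 fun i => (hasLap_integral (transformable_iff.1 hf i)).congr ?_
    refine (ae_restrict_iff' measurableSet_Ioi).2 (ae_of_all _ fun t ht => ?_)
    beta_reduce
    rw [prim_apply hf (le_of_lt ht), intervalIntegral.integral_ofReal]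

theorem laplace_prim {n : ℕ} {f : ℝ → Fin n → ℝ} (hf : Transformable f) :
    ∀ᶠ s in halfPlanes, laplace (prim f) s = s⁻¹ • laplace f s := by
  filter_upwards [eventually_all.2 fun i => lap_integral (transformable_iff.1 hf i)] with s hs
  ext i
  rw [Pi.smul_apply, laplace_apply, smul_eq_mul, laplace_apply, ← hs i, lap_congr]
  refine (ae_restrict_iff' measurableSet_Ioi).2 (ae_of_all _ fun t ht => ?_)
  beta_reduce
  rw [prim_apply hf (le_of_lt ht), intervalIntegral.integral_ofReal]

/-- The primitive of a signal; an impulse becomes a step. -/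
def integ {n : ℕ} (x : Signal n) : Signal n := ⟨0, fun t => x.impulse + prim x.reg t⟩

theorem isContSignal_const {n : ℕ} (c : Fin n → ℝ) : IsContSignal fun _ => c :=
  ⟨continuousOn_const, transformable_iff.2 fun i => by
    simpa using hasLap_one.const_mul (c i : ℂ)⟩

theorem HasTransform.integ {n : ℕ} {x : Signal n} {X : ℂ → Fin n → ℂ} (hx : HasTransform x X) :
    HasTransform (integ x) fun s => s⁻¹ • X s := by
  have h := (hasTransform_ofFun (isContSignal_const x.impulse)).add
    (hasTransform_ofFun (isContSignal_prim hx.1.2))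
  have he : ofFun (fun _ => x.impulse) + ofFun (prim x.reg) = ILC.integ x := by
    simp only [ofFun, ILC.integ, HAdd.hAdd, Add.add]
    congr 1
    ext i
    exact zero_add 0
  rw [he] at h
  refine h.congr ?_
  filter_upwards [hx.2, laplace_prim hx.1.2, lap_one] with s h₁ h₂ h₃
  rw [h₂, ← h₁]
  ext i
  have : laplace (fun _ => x.impulse) s i = x.impulse i * s⁻¹ := by
    rw [laplace_apply, ← h₃, ← lap_const_mul]
    simp
  simp only [Pi.add_apply, Pi.smul_apply, this, Signal.transform, smul_eq_mul]
  ring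

/-- The derivative of a `C¹` function on `[0, ∞)`, as a signal: the initial value contributes an
impulse. -/
theorem hasTransform_deriv {n : ℕ} {r : ℝ → Fin n → ℝ} (hr : ContDiffOn ℝ 1 r (Ici 0))
    (hr' : Transformable (deriv r)) :
    HasTransform ⟨r 0, derivWithin r (Ici 0)⟩ fun s => s • laplace r s := by
  have hcont : ContinuousOn (derivWithin r (Ici 0)) (Ici 0) :=
    hr.continuousOn_derivWithin (uniqueDiffOn_Ici 0) le_rfl
  have hae : deriv r =ᵐ[volume.restrict (Ioi 0)] derivWithin r (Ici 0) :=
    (ae_restrict_iff' measurableSet_Ioi).2 (ae_of_all _ fun t ht =>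
      (derivWithin_of_mem_nhds (Ici_mem_nhds ht)).symm)
  have hx : IsContSignal (derivWithin r (Ici 0)) := ⟨hcont, hr'.congr hae⟩
  have hxT := hasTransform_self (x := ⟨r 0, derivWithin r (Ici 0)⟩) hx
  have heq : EqOn (integ ⟨r 0, derivWithin r (Ici 0)⟩).reg r (Ici 0) := by
    intro t ht
    have ht' : (0 : ℝ) ≤ t := ht
    have := intervalIntegral.integral_eq_sub_of_hasDeriv_right_of_le ht'
      (hr.continuousOn.mono Icc_subset_Ici_self) (f' := derivWithin r (Ici 0))
      (fun τ hτ => ((hr.differentiableOn one_ne_zero τ (le_of_lt hτ.1)).hasDerivWithinAt).mono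
        ((Ioi_subset_Ici_self).trans (Ici_subset_Ici.2 hτ.1.le)))
      (hx.2.intervalIntegrable ht')
    simp only [integ, prim]
    rw [this]
    abel
  refine hxT.congr ?_
  filter_upwards [hxT.integ.2, eventually_ne_halfPlanes 0] with s h₁ h₂
  rw [transform_of_impulse_eq_zero rfl, laplace_congr (ae_Ioi_of_eqOn_Ici heq)] at h₁
  rw [h₁, smul_smul, mul_inv_cancel₀ h₂, one_smul]

/-- A function whose primitive vanishes on `[0, T]` vanishes almost everywhere there: after
truncation at `T` its primitive, hence its transform, is zero. -/
theorem ae_eq_of_prim_eqOn {n : ℕ} {f g : ℝ → Fin n → ℝ} {T : ℝ}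
    (hf : Transformable f) (hg : Transformable g)
    (h : EqOn (prim f) (prim g) (Icc 0 T)) : f =ᵐ[volume.restrict (Icc 0 T)] g := by
  have htr : ∀ {f : ℝ → Fin n → ℝ}, Transformable f → Transformable ((Iic T).indicator f) := by
    rintro f ⟨σ, hσ⟩
    refine ⟨σ, (hσ.indicator (measurableSet_Iic (a := T))).congr (ae_of_all _ fun t => ?_)⟩
    by_cases ht : t ∈ Iic T <;> simp [ht]
  have hprim : ∀ {f : ℝ → Fin n → ℝ}, ∀ t, 0 ≤ t →
      prim ((Iic T).indicator f) t = ∫ τ in Ioc 0 (min t T), f τ := by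
    intro f t ht
    rw [prim, intervalIntegral.integral_of_le ht, setIntegral_indicator measurableSet_Iic,
      Ioc_inter_Iic]
  have heq : EqOn (prim ((Iic T).indicator f)) (prim ((Iic T).indicator g)) (Ici 0) := by
    intro t ht
    rw [hprim t ht, hprim t ht]
    rcases le_total 0 T with hT | hT
    · have hm : 0 ≤ min t T := le_min ht hT
      have := h (show min t T ∈ Icc 0 T from ⟨hm, min_le_right _ _⟩)
      simpa only [prim, intervalIntegral.integral_of_le hm] using this
    · rw [Ioc_eq_empty_of_le ((min_le_right t T).trans hT)]
      simp
  have hae := ae_eq_of_laplace_eq (htr hf) (htr hg) <| by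
    filter_upwards [laplace_prim (htr hf), laplace_prim (htr hg), eventually_ne_halfPlanes 0]
      with s h₁ h₂ h₃
    rw [laplace_congr (ae_Ioi_of_eqOn_Ici heq), h₂] at h₁
    exact (smul_right_injective _ (inv_ne_zero h₃) h₁).symm
  rw [restrict_Ioi_eq_restrict_Ici, ae_eq_restrict_iff_indicator_ae_eq measurableSet_Ici] at hae
  rw [ae_eq_restrict_iff_indicator_ae_eq measurableSet_Icc]
  filter_upwards [hae] with t ht
  by_cases h₁ : t ∈ Icc 0 T
  · simpa [indicator_of_mem h₁, indicator_of_mem (show t ∈ Ici (0 : ℝ) from h₁.1),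
      indicator_of_mem (show t ∈ Iic T from h₁.2)] using ht
  · simp [indicator_of_notMem h₁]

/-! ### Action of a proper rational matrix on signals -/

/-- `F` is multiplication of transforms by the proper rational matrix `K` with `K(∞) = K₀`:
instantaneously it multiplies by `K₀`, and the remaining memory term is controlled by the impulse
and by the past. -/
structure IsAction {a b : ℕ} (K : Matrix (Fin a) (Fin b) (RatFunc ℝ))
    (K₀ : Matrix (Fin a) (Fin b) ℝ) (F : Signal b → Signal a) : Prop where
  transform : ∀ {x X}, HasTransform x X → HasTransform (F x) fun s => evalMat K s *ᵥ X s
  impulse : ∀ x, (F x).impulse = K₀ *ᵥ x.impulse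
  memory : ∀ T, ∃ C, 0 ≤ C ∧ ∀ x : Signal b, ContinuousOn x.reg (Ici 0) → ∀ t ∈ Icc 0 T,
    ‖(F x).reg t - K₀ *ᵥ x.reg t‖ ≤ C * (‖x.impulse‖ + ∫ τ in (0 : ℝ)..t, ‖x.reg τ‖)

/-- The convolution `∫_0^t φ(t - τ) w(τ) dτ` of real functions. -/
def realConv (φ w : ℝ → ℝ) (t : ℝ) : ℝ := ∫ τ in (0 : ℝ)..t, φ (t - τ) * w τ

theorem ofReal_realConv (φ w : ℝ → ℝ) (t : ℝ) :
    (realConv φ w t : ℂ) = conv (fun τ => φ τ) (fun τ => w τ) t := by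
  rw [realConv, conv, ← intervalIntegral.integral_ofReal]
  simp

theorem continuousOn_realConv {φ w : ℝ → ℝ} (hφ : Continuous φ) (hw : ContinuousOn w (Ici 0)) :
    ContinuousOn (realConv φ w) (Ici 0) := by
  have hw' : Continuous fun t => w (max 0 t) :=
    hw.comp_continuous (by fun_prop) fun t => le_max_left 0 t
  have hc : Continuous (realConv φ fun t => w (max 0 t)) :=
    intervalIntegral.continuous_parametric_intervalIntegral_of_continuous
      ((hφ.comp (continuous_fst.sub continuous_snd)).mul (hw'.comp continuous_snd)) continuous_id
  refine hc.continuousOn.congr fun t ht => intervalIntegral.integral_congr fun τ hτ => ?_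
  rw [uIcc_of_le ht] at hτ
  simp only [max_eq_right hτ.1]

theorem abs_realConv_le {φ w W : ℝ → ℝ} {A T t : ℝ} (hA : ∀ τ ∈ Icc 0 T, |φ τ| ≤ A)
    (hw : ∀ τ, |w τ| ≤ W τ) (hW : ContinuousOn W (Ici 0)) (ht : t ∈ Icc 0 T) :
    |realConv φ w t| ≤ A * ∫ τ in (0 : ℝ)..t, W τ := by
  rw [← intervalIntegral.integral_const_mul, ← Real.norm_eq_abs, realConv]
  refine intervalIntegral.norm_integral_le_of_norm_le ht.1 (ae_of_all _ fun τ hτ => ?_) ?_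
  · rw [norm_mul, Real.norm_eq_abs, Real.norm_eq_abs]
    have h₁ := hA (t - τ) ⟨by linarith [hτ.2], by linarith [hτ.1, ht.2]⟩
    exact mul_le_mul h₁ (hw τ) (abs_nonneg _) ((abs_nonneg _).trans h₁)
  · refine ContinuousOn.intervalIntegrable ?_
    rw [uIcc_of_le ht.1]
    exact continuousOn_const.mul (hW.mono Icc_subset_Ici_self)

theorem MatHasLimAtInfty.exists_isAction {a b : ℕ} {K : Matrix (Fin a) (Fin b) (RatFunc ℝ)}
    {K₀ : Matrix (Fin a) (Fin b) ℝ} (hK : MatHasLimAtInfty K K₀) : ∃ F, IsAction K K₀ F := by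
  have hK' : ∀ i j, HasLimAtInfty (K i j - RatFunc.C (K₀ i j)) 0 := fun i j => by
    simpa using (hK i j).sub (hasLimAtInfty_C (K₀ i j))
  choose κ hκc hκ hκe using fun i j => (hK' i j).exists_lap_eq
  refine ⟨fun x => ⟨K₀ *ᵥ x.impulse, fun t i => ∑ j, (K₀ i j * x.reg t j +
    (x.impulse j * κ i j t + realConv (κ i j) (fun τ => x.reg τ j) t))⟩, ?_, fun x => rfl, ?_⟩
  · intro x X hx
    have hxc : ∀ j, ContinuousOn (fun t => x.reg t j) (Ici 0) := continuousOn_pi.1 hx.1.1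
    have hxl := transformable_iff.1 hx.1.2
    have hcl : ∀ i j, HasLap fun t => (realConv (κ i j) (fun τ => x.reg τ j) t : ℂ) := fun i j => by
      simpa only [ofReal_realConv] using (hκ i j).conv (hxl j)
    have hterm : ∀ i j, HasLap fun t => ((K₀ i j : ℂ) * x.reg t j + ((x.impulse j : ℂ) * κ i j t +
        (realConv (κ i j) (fun τ => x.reg τ j) t : ℂ))) := fun i j =>
      ((hxl j).const_mul _).add (((hκ i j).const_mul _).add (hcl i j))
    refine ⟨⟨continuousOn_pi.2 fun i => continuousOn_finsetSum Finset.univ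
      (f := fun j t => K₀ i j * x.reg t j +
        (x.impulse j * κ i j t + realConv (κ i j) (fun τ => x.reg τ j) t)) fun j _ => ?_,
      transformable_iff.2 fun i => ?_⟩, ?_⟩
    · exact (continuousOn_const.mul (hxc j)).add ((continuousOn_const.mul
        (hκc i j).continuousOn).add (continuousOn_realConv (hκc i j) (hxc j)))
    · simpa using HasLap.sum Finset.univ fun j _ => hterm i j
    · have e₁ : ∀ i, ∀ᶠ s in halfPlanes, _ := fun i =>
        lap_sum Finset.univ fun j (_ : j ∈ Finset.univ) => hterm i j
      have e₂ : ∀ i j, ∀ᶠ s in halfPlanes, _ := fun i j =>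
        lap_add ((hxl j).const_mul (K₀ i j : ℂ)) (((hκ i j).const_mul (x.impulse j)).add (hcl i j))
      have e₃ : ∀ i j, ∀ᶠ s in halfPlanes, _ := fun i j =>
        lap_add ((hκ i j).const_mul (x.impulse j)) (hcl i j)
      have e₄ : ∀ i j, ∀ᶠ s in halfPlanes, _ := fun i j => lap_conv (hκ i j) (hxl j)
      have e₅ : ∀ i j, ∀ᶠ s in halfPlanes, _ := fun i j =>
        eventually_eval_sub (algebraMap ℝ ℂ) eventually_ne_halfPlanes (K i j)
          (RatFunc.C (K₀ i j))
      simp only [← eventually_all] at e₁ e₂ e₃ e₄ e₅ hκe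
      filter_upwards [e₁, e₂, e₃, e₄, e₅, hκe, hx.2] with s e₁ e₂ e₃ e₄ e₅ e₆ e₇
      ext i
      rw [← e₇]
      simp only [Signal.transform, laplace_apply, Complex.ofReal_sum, Complex.ofReal_add,
        Complex.ofReal_mul, Matrix.mulVec, dotProduct, evalMat, Matrix.map_apply]
      rw [e₁ i, ← Finset.sum_add_distrib]
      refine Finset.sum_congr rfl fun j _ => ?_
      rw [e₂, lap_const_mul, e₃, lap_const_mul]
      simp only [ofReal_realConv]
      rw [e₄, e₆, e₅, RatFunc.eval_C]
      simp only [Complex.coe_algebraMap]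
      ring
  · intro T
    have hbd : ∀ i j, ∃ A, ∀ τ ∈ Icc 0 T, |κ i j τ| ≤ A := fun i j =>
      isCompact_Icc.exists_bound_of_continuousOn (hκc i j).continuousOn
    choose A hA using hbd
    refine ⟨∑ i, ∑ j, |A i j|, by positivity, fun x hxc t ht => ?_⟩
    have hI : 0 ≤ ∫ τ in (0 : ℝ)..t, ‖x.reg τ‖ :=
      intervalIntegral.integral_nonneg ht.1 fun _ _ => norm_nonneg _
    refine (pi_norm_le_iff_of_nonneg (by positivity)).2 fun i => ?_
    have hsum : ((fun t i => ∑ j, (K₀ i j * x.reg t j + (x.impulse j * κ i j t +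
        realConv (κ i j) (fun τ => x.reg τ j) t))) t - K₀ *ᵥ x.reg t) i =
        ∑ j, (x.impulse j * κ i j t + realConv (κ i j) (fun τ => x.reg τ j) t) := by
      simp [Matrix.mulVec, dotProduct, Finset.sum_add_distrib]
    calc _ = ‖∑ j, (x.impulse j * κ i j t + realConv (κ i j) (fun τ => x.reg τ j) t)‖ :=
          congrArg _ hsum
      _ ≤ ∑ j, |A i j| * (‖x.impulse‖ + ∫ τ in (0 : ℝ)..t, ‖x.reg τ‖) := by
          refine norm_sum_le_of_le _ fun j _ => ?_
          rw [mul_add, mul_comm |A i j|]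
          refine (norm_add_le _ _).trans (add_le_add ?_ ?_)
          · rw [norm_mul]
            exact mul_le_mul (norm_le_pi_norm _ j) ((hA i j t ht).trans (le_abs_self _))
              (norm_nonneg _) (norm_nonneg _)
          · exact abs_realConv_le (fun τ hτ => (hA i j τ hτ).trans (le_abs_self _))
              (fun τ => norm_le_pi_norm (x.reg τ) j) hxc.norm ht
      _ ≤ _ := by
          rw [← Finset.sum_mul]
          refine mul_le_mul_of_nonneg_right ?_ (by positivity)
          exact Finset.single_le_sum (f := fun i => ∑ j, |A i j|)
            (fun i _ => by positivity) (Finset.mem_univ i)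

/-- Causality: the output at times in `[0, T]` only depends on the input at these times. -/
theorem IsAction.eqOn_zero {a b : ℕ} {K : Matrix (Fin a) (Fin b) (RatFunc ℝ)} {K₀ F}
    (hF : IsAction K K₀ F) {x : Signal b} {T : ℝ} (hx : ContinuousOn x.reg (Ici 0))
    (h₀ : x.impulse = 0) (h : ∀ t ∈ Icc 0 T, x.reg t = 0) : ∀ t ∈ Icc 0 T, (F x).reg t = 0 := by
  intro t ht
  obtain ⟨C, -, hC⟩ := hF.memory T
  have hint : ∫ τ in (0 : ℝ)..t, ‖x.reg τ‖ = 0 := by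
    refine (intervalIntegral.integral_congr (g := fun _ => 0) fun τ hτ => ?_).trans
      intervalIntegral.integral_zero
    rw [uIcc_of_le ht.1] at hτ
    simp [h τ ⟨hτ.1, hτ.2.trans ht.2⟩]
  have := hC x hx t ht
  rw [hint, h₀, h t ht] at this
  simpa using this

theorem IsAction.reg_zero {a b : ℕ} {K : Matrix (Fin a) (Fin b) (RatFunc ℝ)} {K₀ F}
    (hF : IsAction K K₀ F) {x : Signal b} (hx : ContinuousOn x.reg (Ici 0))
    (h₀ : x.impulse = 0) : (F x).reg 0 = K₀ *ᵥ x.reg 0 := by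
  obtain ⟨C, -, hC⟩ := hF.memory 0
  have := hC x hx 0 (by simp)
  rw [h₀] at this
  simpa [sub_eq_zero] using this

/-! ### Norms on coordinate spaces -/

theorem exists_seminorm_le {n : ℕ} (N : Seminorm ℝ (Fin n → ℝ)) :
    ∃ C, 0 ≤ C ∧ ∀ x, N x ≤ C * ‖x‖ := by
  refine ⟨∑ i, N (Pi.single i 1), Finset.sum_nonneg fun i _ => apply_nonneg N _, fun x => ?_⟩
  have hx : x = ∑ i, x i • (Pi.single i 1 : Fin n → ℝ) := by
    ext j
    simp [Finset.sum_apply, Pi.single_apply]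
  calc N x = N (∑ i, x i • (Pi.single i 1 : Fin n → ℝ)) := by rw [← hx]
    _ ≤ ∑ i, N (x i • (Pi.single i 1 : Fin n → ℝ)) :=
        Finset.le_sum_of_subadditive N (map_zero N).le (map_add_le_add N) _ _
    _ ≤ ∑ i, N (Pi.single i 1) * ‖x‖ := by
        refine Finset.sum_le_sum fun i _ => ?_
        rw [map_smul_eq_mul, mul_comm]
        exact mul_le_mul_of_nonneg_left (norm_le_pi_norm x i) (apply_nonneg N _)
    _ = _ := by rw [Finset.sum_mul]

theorem continuous_seminorm {n : ℕ} (N : Seminorm ℝ (Fin n → ℝ)) : Continuous N := by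
  obtain ⟨C, hC, h⟩ := exists_seminorm_le N
  refine Seminorm.continuous_of_le (q := C.toNNReal • normSeminorm ℝ (Fin n → ℝ)) ?_ fun x => ?_
  · exact (continuous_const.mul continuous_norm : Continuous fun x : Fin n → ℝ => C.toNNReal * ‖x‖)
  · simpa [NNReal.smul_def, hC] using h x

theorem exists_norm_le_seminorm {n : ℕ} (N : Seminorm ℝ (Fin n → ℝ)) (hN : ∀ x, N x = 0 → x = 0) :
    ∃ C, 0 ≤ C ∧ ∀ x, ‖x‖ ≤ C * N x := by
  rcases (Metric.sphere (0 : Fin n → ℝ) 1).eq_empty_or_nonempty with h | h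
  · refine ⟨0, le_rfl, fun x => ?_⟩
    have hx : x = 0 := by
      by_contra hx
      have : ‖x‖⁻¹ • x ∈ Metric.sphere (0 : Fin n → ℝ) 1 := by
        rw [mem_sphere_zero_iff_norm, norm_smul, norm_inv, norm_norm,
          inv_mul_cancel₀ (norm_ne_zero_iff.2 hx)]
      rw [h] at this
      exact this
    simp [hx]
  · obtain ⟨z, hz, hmin⟩ := (isCompact_sphere (0 : Fin n → ℝ) 1).exists_isMinOn h
      (continuous_seminorm N).continuousOn
    have hz0 : 0 < N z := by
      refine lt_of_le_of_ne (apply_nonneg N z) fun h0 => ?_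
      rw [hN z h0.symm] at hz
      simp at hz
    refine ⟨(N z)⁻¹, inv_nonneg.2 hz0.le, fun x => ?_⟩
    rcases eq_or_ne x 0 with rfl | hx
    · simp
    have hx' : 0 < ‖x‖ := norm_pos_iff.2 hx
    have hmem : ‖x‖⁻¹ • x ∈ Metric.sphere (0 : Fin n → ℝ) 1 := by
      rw [mem_sphere_zero_iff_norm, norm_smul, norm_inv, norm_norm, inv_mul_cancel₀ hx'.ne']
    have := hmin hmem
    simp only [mem_ofPred_eq, map_smul_eq_mul, norm_inv, norm_norm] at this
    rw [inv_mul_eq_div, le_div_iff₀ hz0]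
    rwa [inv_mul_eq_div, le_div_iff₀ hx', mul_comm] at this

theorem exists_norm_mulVec_le {a b : ℕ} (M : Matrix (Fin a) (Fin b) ℝ) :
    ∃ C, 0 ≤ C ∧ ∀ x, ‖M *ᵥ x‖ ≤ C * ‖x‖ :=
  ⟨‖(Matrix.mulVecLin M).toContinuousLinearMap‖, norm_nonneg _, fun x =>
    (Matrix.mulVecLin M).toContinuousLinearMap.le_opNorm x⟩

open scoped Matrix.Norms.Operator in
/-- Gelfand's formula: some power of a matrix of spectral radius less than `1` is a strict
contraction. -/
theorem exists_norm_pow_mulVec_le {n : ℕ} {M : Matrix (Fin n) (Fin n) ℝ} (hM : specRadius M < 1) :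
    ∃ r : ℝ, 0 < r ∧ r < 1 ∧ ∃ k : ℕ, 0 < k ∧ ∀ x, ‖M ^ k *ᵥ x‖ ≤ r ^ k * ‖x‖ := by
  set Mc : Matrix (Fin n) (Fin n) ℂ := M.map (algebraMap ℝ ℂ) with hMc
  obtain ⟨r, hr₁, hr₂⟩ := ENNReal.lt_iff_exists_nnreal_btwn.1 hM
  have hr0 : 0 < r := by
    rw [← ENNReal.coe_pos]; exact lt_of_le_of_lt zero_le hr₁
  have hlim := spectrum.pow_nnnorm_pow_one_div_tendsto_nhds_spectralRadius Mc
  obtain ⟨k, hk, hk0⟩ := ((hlim.eventually_lt_const hr₁).and (eventually_gt_atTop 0)).exists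
  have hle : ‖Mc ^ k‖ ≤ (r : ℝ) ^ k := by
    have h1 : ((‖Mc ^ k‖₊ : ℝ≥0∞) ^ (1 / k : ℝ)) ^ (k : ℝ) ≤ (r : ℝ≥0∞) ^ (k : ℝ) :=
      ENNReal.rpow_le_rpow hk.le (by positivity)
    rw [← ENNReal.rpow_mul, one_div, inv_mul_cancel₀ (by positivity), ENNReal.rpow_one,
      ENNReal.rpow_natCast, ← ENNReal.coe_pow, ENNReal.coe_le_coe] at h1
    exact_mod_cast h1
  refine ⟨r, hr0, by exact_mod_cast hr₂, k, hk0, fun x => ?_⟩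
  have hnorm : ∀ y : Fin n → ℝ, ‖fun i => (y i : ℂ)‖ = ‖y‖ := by
    intro y
    simp [Pi.norm_def]
  have hmap : (fun i => ((M ^ k *ᵥ x) i : ℂ)) = Mc ^ k *ᵥ fun i => (x i : ℂ) := by
    have h2 : Mc ^ k = (M ^ k).map (algebraMap ℝ ℂ) :=
      (map_pow (algebraMap ℝ ℂ).mapMatrix M k).symm
    rw [h2]
    ext i
    simp [Matrix.mulVec, dotProduct]
  rw [← hnorm, hmap, ← hnorm x]
  exact (Matrix.linfty_opNorm_mulVec _ _).trans
    (mul_le_mul_of_nonneg_right hle (norm_nonneg _))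

/-- A norm in which a matrix of spectral radius less than `1` is a strict contraction. -/
theorem exists_adapted_seminorm {n : ℕ} {M : Matrix (Fin n) (Fin n) ℝ} (hM : specRadius M < 1) :
    ∃ (N : Seminorm ℝ (Fin n → ℝ)) (r : ℝ), 0 < r ∧ r < 1 ∧ (∀ x, ‖x‖ ≤ N x) ∧
      ∀ x, N (M *ᵥ x) ≤ r * N x := by
  obtain ⟨r, hr0, hr1, k, hk, h⟩ := exists_norm_pow_mulVec_le hM
  refine ⟨Seminorm.of (fun x => ∑ j ∈ Finset.range k, r⁻¹ ^ j * ‖M ^ j *ᵥ x‖) ?_ ?_, r, hr0, hr1,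
    fun x => ?_, fun x => ?_⟩
  · intro x y
    rw [← Finset.sum_add_distrib]
    refine Finset.sum_le_sum fun j _ => ?_
    rw [← mul_add, Matrix.mulVec_add]
    exact mul_le_mul_of_nonneg_left (norm_add_le _ _) (by positivity)
  · intro c x
    rw [Finset.mul_sum]
    refine Finset.sum_congr rfl fun j _ => ?_
    rw [Matrix.mulVec_smul, norm_smul]
    ring
  · have := Finset.single_le_sum (f := fun j => r⁻¹ ^ j * ‖M ^ j *ᵥ x‖)
      (fun j _ => by positivity) (Finset.mem_range.2 hk)
    simpa using! this
  · change ∑ j ∈ Finset.range k, r⁻¹ ^ j * ‖M ^ j *ᵥ (M *ᵥ x)‖ ≤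
      r * ∑ j ∈ Finset.range k, r⁻¹ ^ j * ‖M ^ j *ᵥ x‖
    have hshift : ∑ j ∈ Finset.range k, r⁻¹ ^ j * ‖M ^ j *ᵥ (M *ᵥ x)‖ =
        r * ∑ j ∈ Finset.range k, r⁻¹ ^ (j + 1) * ‖M ^ (j + 1) *ᵥ x‖ := by
      rw [Finset.mul_sum]
      refine Finset.sum_congr rfl fun j _ => ?_
      rw [Matrix.mulVec_mulVec, ← pow_succ, pow_succ r⁻¹]
      field_simp
    rw [hshift]
    refine mul_le_mul_of_nonneg_left ?_ hr0.le
    have h1 := Finset.sum_range_succ (fun j => r⁻¹ ^ j * ‖M ^ j *ᵥ x‖) k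
    have h2 := Finset.sum_range_succ' (fun j => r⁻¹ ^ j * ‖M ^ j *ᵥ x‖) k
    have h3 : r⁻¹ ^ k * ‖M ^ k *ᵥ x‖ ≤ ‖x‖ := by
      rw [inv_pow, inv_mul_le_iff₀ (by positivity)]
      exact h x
    simp only [pow_zero, Matrix.one_mulVec, one_mul] at h2
    linarith

theorem det_ne_zero_of_specRadius_lt {n : ℕ} {L : Matrix (Fin n) (Fin n) ℝ}
    (hL : specRadius (1 - L) < 1) : L.det ≠ 0 := by
  intro h0
  obtain ⟨x, hx, hLx⟩ := Matrix.exists_mulVec_eq_zero_iff.2 h0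
  obtain ⟨N, r, hr0, hr1, hN, hNL⟩ := exists_adapted_seminorm hL
  have h := hNL x
  rw [Matrix.sub_mulVec, Matrix.one_mulVec, hLx, sub_zero] at h
  have : 0 < ‖x‖ := norm_pos_iff.2 hx
  nlinarith [hN x]

/-! ### Perturbed linear iterations -/

set_option maxHeartbeats 800000 in
/-- The iteration `x_{k+1} = A x_k - B w_k` with `ρ(A(∞)) < 1` contracts up to the size of the
perturbation when `x_0` has no impulse: in an adapted norm `A(∞)` is a contraction, and in the
weight `exp (-λ t)` the memory term of `A` has an arbitrarily small norm for large `λ`. -/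
theorem exists_iteration_bound {n m : ℕ} {A : Matrix (Fin n) (Fin n) (RatFunc ℝ)} {A₀ F}
    {B : Matrix (Fin n) (Fin m) (RatFunc ℝ)} {B₀ H} (hF : IsAction A A₀ F) (hH : IsAction B B₀ H)
    (hρ : specRadius A₀ < 1) (T : ℝ) :
    ∃ C ρ : ℝ, 0 ≤ C ∧ 0 ≤ ρ ∧ ρ < 1 ∧ ∀ (x : ℕ → Signal n) (w : ℕ → Signal m) (a b : ℝ),
      (∀ k, IsContSignal (x k).reg) → (∀ k, IsContSignal (w k).reg) → (x 0).impulse = 0 →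
      (∀ k, (x (k + 1)).impulse = (F (x k) - H (w k)).impulse) →
      (∀ k, EqOn (x (k + 1)).reg (F (x k) - H (w k)).reg (Ici 0)) →
      0 ≤ a → 0 ≤ b → (∀ k, ‖(w k).impulse‖ ≤ a) → (∀ k, ∀ t ∈ Icc 0 T, ‖(w k).reg t‖ ≤ b) →
      ∃ M, 0 ≤ M ∧ ∀ k, ‖(x k).impulse‖ ≤ C * (a + b) ∧
        ∀ t ∈ Icc 0 T, ‖(x k).reg t‖ ≤ M * ρ ^ k + C * (a + b) := by
  obtain ⟨N, r, hr0, hr1, hN, hNA⟩ := exists_adapted_seminorm hρ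
  obtain ⟨c, hc0, hc⟩ := exists_seminorm_le N
  obtain ⟨β, hβ0, hβ⟩ := exists_norm_mulVec_le B₀
  obtain ⟨CF, hCF0, hCF⟩ := hF.memory T
  obtain ⟨CH, hCH0, hCH⟩ := hH.memory T
  have hr1' : 0 < 1 - r := sub_pos.2 hr1
  -- the weight makes the memory term of `A` smaller than half of the contraction margin
  set lam : ℝ := 2 * (c * CF) / (1 - r) + 1 with hlam
  have hlam0 : 0 < lam := by positivity
  have hlam' : c * CF / lam ≤ (1 - r) / 2 := by
    rw [div_le_iff₀ hlam0, hlam]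
    have : (1 - r) / 2 * (2 * (c * CF) / (1 - r) + 1) = c * CF + (1 - r) / 2 := by
      field_simp
    rw [this]
    linarith
  set ρ : ℝ := (1 + r) / 2 with hρdef
  have hρ0 : 0 ≤ ρ := by positivity
  have hρ1 : ρ < 1 := by rw [hρdef]; linarith
  have hρ1' : 0 < 1 - ρ := sub_pos.2 hρ1
  set I : ℝ := c * β / (1 - r) with hI
  have hI0 : 0 ≤ I := by positivity
  set E : ℝ := c * CF * I + c * β + c * CH * (1 + |T|) with hE
  have hE0 : 0 ≤ E := by positivity
  refine ⟨Real.exp (lam * |T|) * (E / (1 - ρ)) + I, ρ, by positivity, hρ0, hρ1, ?_⟩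
  intro x w a b hx hw hx0 himp hreg ha hb hwa hwb
  obtain ⟨M₀, hM₀⟩ := isCompact_Icc.exists_bound_of_continuousOn
    ((hx 0).1.mono (Icc_subset_Ici_self : Icc 0 T ⊆ Ici 0))
  have hNimp : ∀ k, N (x k).impulse ≤ I * a := by
    intro k
    induction k with
    | zero => rw [hx0, map_zero]; positivity
    | succ k ih =>
      rw [himp k, sub_impulse, hF.impulse, hH.impulse]
      have h1 : N (B₀ *ᵥ (w k).impulse) ≤ c * (β * a) :=
        (hc _).trans (mul_le_mul_of_nonneg_left
          ((hβ _).trans (mul_le_mul_of_nonneg_left (hwa k) hβ0)) hc0)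
      have h2 : r * I + c * β = I := by rw [hI]; field_simp; ring
      calc _ ≤ N (A₀ *ᵥ (x k).impulse) + N (B₀ *ᵥ (w k).impulse) := map_sub_le_add N _ _
        _ ≤ r * (I * a) + c * (β * a) :=
            add_le_add ((hNA _).trans (mul_le_mul_of_nonneg_left ih hr0.le)) h1
        _ = (r * I + c * β) * a := by ring
        _ = I * a := by rw [h2]
  have hNreg : ∀ k, ∀ t ∈ Icc 0 T, N ((x k).reg t) ≤
      (c * |M₀| * ρ ^ k + E / (1 - ρ) * (a + b)) * Real.exp (lam * t) := by
    intro k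
    induction k with
    | zero =>
      intro t ht
      have h1 : N ((x 0).reg t) ≤ c * |M₀| :=
        (hc _).trans (mul_le_mul_of_nonneg_left ((hM₀ t ht).trans (le_abs_self _)) hc0)
      have h2 : 1 ≤ Real.exp (lam * t) := Real.one_le_exp (mul_nonneg hlam0.le ht.1)
      have h3 : 0 ≤ E / (1 - ρ) * (a + b) := by positivity
      have h4 : 0 ≤ c * |M₀| := by positivity
      rw [pow_zero, mul_one]
      exact h1.trans ((le_add_of_nonneg_right h3).trans
        (le_mul_of_one_le_right (add_nonneg h4 h3) h2))
    | succ k ih =>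
      intro t ht
      set Mk : ℝ := c * |M₀| * ρ ^ k + E / (1 - ρ) * (a + b) with hMk
      have hMk0 : 0 ≤ Mk := by positivity
      set e : ℝ := Real.exp (lam * t) with he
      have he1 : 1 ≤ e := Real.one_le_exp (mul_nonneg hlam0.le ht.1)
      have hintx : ∫ τ in (0 : ℝ)..t, ‖(x k).reg τ‖ ≤ Mk * e / lam := by
        have hcont : ContinuousOn (fun τ => ‖(x k).reg τ‖) (uIcc 0 t) := by
          rw [uIcc_of_le ht.1]
          exact ((hx k).1.mono Icc_subset_Ici_self).norm
        calc _ ≤ ∫ τ in (0 : ℝ)..t, Mk * Real.exp (lam * τ) := by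
              refine intervalIntegral.integral_mono_on ht.1 hcont.intervalIntegrable
                (Continuous.intervalIntegrable (by fun_prop) _ _) fun τ hτ => ?_
              exact (hN _).trans (ih τ ⟨hτ.1, hτ.2.trans ht.2⟩)
          _ = Mk * ((e - 1) / lam) := by
              rw [intervalIntegral.integral_const_mul,
                intervalIntegral.integral_comp_mul_left _ hlam0.ne', integral_exp]
              simp [he, div_eq_inv_mul]
          _ ≤ Mk * e / lam := by
              rw [mul_div_assoc]
              gcongr
              linarith
      have hintw : ∫ τ in (0 : ℝ)..t, ‖(w k).reg τ‖ ≤ |T| * b := by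
        have hcont : ContinuousOn (fun τ => ‖(w k).reg τ‖) (uIcc 0 t) := by
          rw [uIcc_of_le ht.1]
          exact ((hw k).1.mono Icc_subset_Ici_self).norm
        calc _ ≤ ∫ _ in (0 : ℝ)..t, b := by
              refine intervalIntegral.integral_mono_on ht.1 hcont.intervalIntegrable
                (Continuous.intervalIntegrable (by fun_prop) _ _) fun τ hτ => ?_
              exact hwb k τ ⟨hτ.1, hτ.2.trans ht.2⟩
          _ ≤ |T| * b := by
              rw [intervalIntegral.integral_const, smul_eq_mul, sub_zero]
              exact mul_le_mul_of_nonneg_right (ht.2.trans (le_abs_self T)) hb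
      have hdecomp : (x (k + 1)).reg t = A₀ *ᵥ (x k).reg t +
          ((F (x k)).reg t - A₀ *ᵥ (x k).reg t) -
          (B₀ *ᵥ (w k).reg t + ((H (w k)).reg t - B₀ *ᵥ (w k).reg t)) := by
        rw [hreg k ht.1, sub_reg]
        abel
      have h1 : N (A₀ *ᵥ (x k).reg t) ≤ r * (Mk * e) :=
        (hNA _).trans (mul_le_mul_of_nonneg_left (ih t ht) hr0.le)
      have h2 : N ((F (x k)).reg t - A₀ *ᵥ (x k).reg t) ≤ c * (CF * (I * a + Mk * e / lam)) :=
        (hc _).trans (mul_le_mul_of_nonneg_left ((hCF _ (hx k).1 t ht).trans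
          (mul_le_mul_of_nonneg_left (add_le_add ((hN _).trans (hNimp k)) hintx) hCF0)) hc0)
      have h3 : N (B₀ *ᵥ (w k).reg t) ≤ c * (β * b) :=
        (hc _).trans (mul_le_mul_of_nonneg_left
          ((hβ _).trans (mul_le_mul_of_nonneg_left (hwb k t ht) hβ0)) hc0)
      have h4 : N ((H (w k)).reg t - B₀ *ᵥ (w k).reg t) ≤ c * (CH * (a + |T| * b)) :=
        (hc _).trans (mul_le_mul_of_nonneg_left ((hCH _ (hw k).1 t ht).trans
          (mul_le_mul_of_nonneg_left (add_le_add (hwa k) hintw) hCH0)) hc0)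
      have h5 : N ((x (k + 1)).reg t) ≤ r * (Mk * e) + c * (CF * (I * a + Mk * e / lam)) +
          (c * (β * b) + c * (CH * (a + |T| * b))) := by
        rw [hdecomp]
        refine (map_sub_le_add N _ _).trans (add_le_add ?_ ?_)
        · exact (map_add_le_add N _ _).trans (add_le_add h1 h2)
        · exact (map_add_le_add N _ _).trans (add_le_add h3 h4)
      have h6 : c * CF * I * a + c * β * b + c * CH * (a + |T| * b) ≤ E * (a + b) := by
        have k1 : 0 ≤ c * CF * I * b := by positivity
        have k2 : 0 ≤ c * β * a := by positivity
        have k3 : 0 ≤ c * CH * (b + |T| * a) := by positivity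
        rw [hE]
        linarith
      have h7 : r * (Mk * e) + c * CF / lam * (Mk * e) ≤ ρ * (Mk * e) := by
        have h := mul_le_mul_of_nonneg_right hlam' (show 0 ≤ Mk * e by positivity)
        rw [hρdef]
        linarith
      have h8 : 0 ≤ E * (a + b) := by positivity
      have h9 : ρ * Mk + E * (a + b) = c * |M₀| * ρ ^ (k + 1) + E / (1 - ρ) * (a + b) := by
        rw [hMk]
        field_simp
        ring
      have h10 : c * (CF * (I * a + Mk * e / lam)) =
          c * CF * I * a + c * CF / lam * (Mk * e) := by ring
      have h11 : E * (a + b) ≤ E * (a + b) * e := le_mul_of_one_le_right h8 he1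
      rw [← h9]
      linarith
  refine ⟨Real.exp (lam * |T|) * (c * |M₀|), by positivity, fun k => ⟨?_, fun t ht => ?_⟩⟩
  · refine ((hN _).trans (hNimp k)).trans ?_
    have h1 : 0 ≤ Real.exp (lam * |T|) * (E / (1 - ρ)) := by positivity
    linarith [mul_nonneg h1 (add_nonneg ha hb), mul_nonneg hI0 hb]
  · refine ((hN _).trans (hNreg k t ht)).trans ?_
    have h1 : Real.exp (lam * t) ≤ Real.exp (lam * |T|) :=
      Real.exp_le_exp.2 (mul_le_mul_of_nonneg_left (ht.2.trans (le_abs_self T)) hlam0.le)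
    have h2 : 0 ≤ c * |M₀| * ρ ^ k + E / (1 - ρ) * (a + b) := by positivity
    have h3 := mul_le_mul_of_nonneg_left h1 h2
    linarith [mul_nonneg hI0 (add_nonneg ha hb)]

/-! ### Evaluation of rational matrices in right half-planes -/

theorem evalMat_mul {a b c : ℕ} (K : Matrix (Fin a) (Fin b) (RatFunc ℝ))
    (H : Matrix (Fin b) (Fin c) (RatFunc ℝ)) :
    ∀ᶠ s in halfPlanes, evalMat (K * H) s = evalMat K s * evalMat H s :=
  eventually_map_eval_mul (algebraMap ℝ ℂ) eventually_ne_halfPlanes K H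

theorem evalMat_sub {a b : ℕ} (K H : Matrix (Fin a) (Fin b) (RatFunc ℝ)) :
    ∀ᶠ s in halfPlanes, evalMat (K - H) s = evalMat K s - evalMat H s := by
  filter_upwards [eventually_all.2 fun i => eventually_all.2 fun j =>
    eventually_eval_sub (algebraMap ℝ ℂ) eventually_ne_halfPlanes (K i j) (H i j)] with s hs
  ext i j
  exact hs i j

theorem evalMat_one {n : ℕ} (s : ℂ) :
    evalMat (1 : Matrix (Fin n) (Fin n) (RatFunc ℝ)) s = 1 := by
  ext i j
  by_cases h : i = j <;> simp [evalMat, h, Matrix.one_apply]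

theorem evalMat_X_smul {a b : ℕ} (K : Matrix (Fin a) (Fin b) (RatFunc ℝ)) :
    ∀ᶠ s in halfPlanes, evalMat ((RatFunc.X : RatFunc ℝ) • K) s = s • evalMat K s := by
  filter_upwards [eventually_all.2 fun i => eventually_all.2 fun j =>
    eventually_eval_mul (algebraMap ℝ ℂ) eventually_ne_halfPlanes RatFunc.X (K i j)] with s hs
  ext i j
  simpa [evalMat] using hs i j

theorem evalMat_X_inv_smul {a b : ℕ} (K : Matrix (Fin a) (Fin b) (RatFunc ℝ)) :
    ∀ᶠ s in halfPlanes, evalMat ((RatFunc.X : RatFunc ℝ)⁻¹ • K) s = s⁻¹ • evalMat K s := by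
  filter_upwards [evalMat_X_smul ((RatFunc.X : RatFunc ℝ)⁻¹ • K), eventually_ne_halfPlanes 0]
    with s hs h0
  rw [smul_smul, mul_inv_cancel₀ RatFunc.X_ne_zero, one_smul] at hs
  rw [hs, smul_smul, inv_mul_cancel₀ h0, one_smul]

theorem evalVec_add {a : ℕ} (D E : Fin a → RatFunc ℝ) :
    ∀ᶠ s in halfPlanes, evalVec (D + E) s = evalVec D s + evalVec E s := by
  filter_upwards [eventually_all.2 fun i =>
    eventually_eval_add (algebraMap ℝ ℂ) eventually_ne_halfPlanes (D i) (E i)] with s hs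
  ext i
  exact hs i

theorem X_inv_smul_mul_X_smul {a b c : ℕ} (K : Matrix (Fin a) (Fin b) (RatFunc ℝ))
    (H : Matrix (Fin b) (Fin c) (RatFunc ℝ)) :
    ((RatFunc.X : RatFunc ℝ)⁻¹ • K) * ((RatFunc.X : RatFunc ℝ) • H) = K * H := by
  rw [Matrix.smul_mul, Matrix.mul_smul, smul_smul, inv_mul_cancel₀ RatFunc.X_ne_zero, one_smul]

/-! ### Disturbances as signals -/

theorem hasTransform_of_inverseLaplace {m : ℕ} {D : Fin m → RatFunc ℝ} {θ : Fin m → ℝ}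
    {Dhat : Fin m → RatFunc ℝ} {f : ℝ → Fin m → ℝ} (hD : ∀ i, D i = RatFunc.C (θ i) + Dhat i)
    (hf : IsInverseLaplace f Dhat) : HasTransform ⟨θ, f⟩ (evalVec D) := by
  refine ⟨hf.1, ?_⟩
  filter_upwards [hf.2, evalVec_add (fun i => RatFunc.C (θ i)) Dhat] with s h₁ h₂
  have hD' : D = (fun i => RatFunc.C (θ i)) + Dhat := funext hD
  rw [hD', h₂, ← h₁]
  ext i
  simp [Signal.transform, evalVec]

theorem exists_isInverseLaplace {m : ℕ} {D : Fin m → RatFunc ℝ} (hD : ∀ i, HasLimAtInfty (D i) 0) :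
    ∃ f, IsInverseLaplace f D := by
  choose κ hκc hκ hκe using fun i => (hD i).exists_lap_eq
  refine ⟨fun t i => κ i t, ⟨continuousOn_pi.2 fun i => (hκc i).continuousOn,
    transformable_iff.2 hκ⟩, ?_⟩
  filter_upwards [eventually_all.2 hκe] with s hs
  ext i
  exact hs i

theorem NominalDisturbance.exists_hasTransform {m : ℕ} {D : Fin m → RatFunc ℝ}
    (hD : NominalDisturbance D) : ∃ d : Signal m, HasTransform d (evalVec D) := by
  obtain ⟨d₀, Dhat, -, hDhat, h⟩ := hD
  obtain ⟨f, hf⟩ := exists_isInverseLaplace hDhat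
  exact ⟨_, hasTransform_of_inverseLaplace h hf⟩

theorem BoundedUncertainty.exists_signals {m : ℕ} {T : ℝ} {N : Seminorm ℝ (Fin m → ℝ)} {a b : ℝ≥0}
    {Θ : ℕ → Fin m → RatFunc ℝ} (hΘ : BoundedUncertainty T N a b Θ) :
    ∃ w : ℕ → Signal m, ∀ k, HasTransform (w k) (evalVec (Θ k)) ∧ N (w k).impulse ≤ a ∧
      ∀ t ∈ Icc 0 T, N ((w k).reg t) ≤ b := by
  choose θ Θhat θhat h₁ h₂ h₃ h₄ using hΘ
  exact ⟨fun k => ⟨θ k, θhat k⟩, fun k =>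
    ⟨hasTransform_of_inverseLaplace (h₁ k) (h₂ k), h₃ k, h₄ k⟩⟩

/-! ### Actions: causality and bounds -/

theorem IsAction.causal {a b : ℕ} {K : Matrix (Fin a) (Fin b) (RatFunc ℝ)} {K₀ F}
    (hF : IsAction K K₀ F) {x y : Signal b} {T : ℝ} (hx : IsContSignal x.reg)
    (hy : IsContSignal y.reg) (h₀ : x.impulse = y.impulse) (h : EqOn x.reg y.reg (Icc 0 T)) :
    EqOn (F x).reg (F y).reg (Icc 0 T) := by
  have hx' := hasTransform_self hx
  have hy' := hasTransform_self hy
  have hd := (hF.transform (hx'.sub hy')).unique ((hF.transform hx').sub (hF.transform hy'))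
    (Eventually.of_forall fun s => Matrix.mulVec_sub _ _ _)
  intro t ht
  have := hF.eqOn_zero (T := T) (hx'.sub hy').1.1 (by simp [h₀])
    (fun τ hτ => by simp [h hτ]) t ht
  rw [hd.2 ht.1, sub_reg] at this
  exact sub_eq_zero.1 this

theorem IsAction.exists_bound {a b : ℕ} {K : Matrix (Fin a) (Fin b) (RatFunc ℝ)} {K₀ F}
    (hF : IsAction K K₀ F) (T : ℝ) : ∃ C, 0 ≤ C ∧ ∀ (x : Signal b) (α β : ℝ),
      IsContSignal x.reg → ‖x.impulse‖ ≤ α → (∀ t ∈ Icc 0 T, ‖x.reg t‖ ≤ β) →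
      ‖(F x).impulse‖ ≤ C * α ∧ ∀ t ∈ Icc 0 T, ‖(F x).reg t‖ ≤ C * (α + β) := by
  obtain ⟨k, hk0, hk⟩ := exists_norm_mulVec_le K₀
  obtain ⟨C, hC0, hC⟩ := hF.memory T
  refine ⟨k + C * (1 + |T|), by positivity, fun x α β hx hα hβ => ⟨?_, fun t ht => ?_⟩⟩
  · rw [hF.impulse]
    refine (hk _).trans (mul_le_mul ?_ hα (norm_nonneg _) (by positivity))
    have : 0 ≤ C * (1 + |T|) := by positivity
    linarith
  · have hα0 : 0 ≤ α := (norm_nonneg _).trans hα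
    have hβ0 : 0 ≤ β := (norm_nonneg _).trans (hβ t ht)
    have hint : ∫ τ in (0 : ℝ)..t, ‖x.reg τ‖ ≤ |T| * β := by
      have hcont : ContinuousOn (fun τ => ‖x.reg τ‖) (uIcc 0 t) := by
        rw [uIcc_of_le ht.1]
        exact (hx.1.mono Icc_subset_Ici_self).norm
      calc _ ≤ ∫ _ in (0 : ℝ)..t, β := by
            refine intervalIntegral.integral_mono_on ht.1 hcont.intervalIntegrable
              (Continuous.intervalIntegrable (by fun_prop) _ _) fun τ hτ => ?_
            exact hβ τ ⟨hτ.1, hτ.2.trans ht.2⟩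
        _ ≤ |T| * β := by
            rw [intervalIntegral.integral_const, smul_eq_mul, sub_zero]
            exact mul_le_mul_of_nonneg_right (ht.2.trans (le_abs_self T)) hβ0
    have h₁ : ‖(F x).reg t - K₀ *ᵥ x.reg t‖ ≤ C * (α + |T| * β) :=
      (hC x hx.1 t ht).trans (mul_le_mul_of_nonneg_left (add_le_add hα hint) hC0)
    have h₂ : ‖K₀ *ᵥ x.reg t‖ ≤ k * β := (hk _).trans (mul_le_mul_of_nonneg_left (hβ t ht) hk0)
    have h₃ : ‖(F x).reg t‖ ≤ ‖(F x).reg t - K₀ *ᵥ x.reg t‖ + ‖K₀ *ᵥ x.reg t‖ := by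
      simpa using norm_add_le ((F x).reg t - K₀ *ᵥ x.reg t) (K₀ *ᵥ x.reg t)
    have h₄ : 0 ≤ k * α := by positivity
    have h₅ : 0 ≤ C * |T| * α := by positivity
    have h₆ : 0 ≤ C * β := by positivity
    linarith

/-! ### Outputs of the nominal system -/

/-- The output generated by an input that is only integrable depends on its primitive alone,
because `G₁ V = (s G₁) (V / s)` with `s G₁` proper; it is continuous, and starts at
`lim s G₂(s) d₀`. -/
theorem exists_output {p q m : ℕ} {G₁ : Matrix (Fin q) (Fin p) (RatFunc ℝ)}
    {G₂ : Matrix (Fin q) (Fin m) (RatFunc ℝ)} {D : Fin m → RatFunc ℝ} {d : Signal m}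
    {M₂ : Matrix (Fin q) (Fin m) ℝ} (hG₁ : StrictlyProper G₁)
    (hM₂ : MatHasLimAtInfty ((RatFunc.X : RatFunc ℝ) • G₂) M₂)
    (hd : HasTransform d (evalVec D)) :
    ∃ out : (ℝ → Fin p → ℝ) → ℝ → Fin q → ℝ,
      (∀ v, Transformable v → IsContSignal (out v) ∧ Generates G₁ G₂ D v (out v) ∧
        out v 0 = M₂ *ᵥ d.impulse) ∧
      ∀ T v v', Transformable v → Transformable v' → EqOn (prim v) (prim v') (Icc 0 T) →
        EqOn (out v) (out v') (Icc 0 T) := by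
  obtain ⟨M₁, hM₁⟩ := hG₁.exists_X_smul
  obtain ⟨A₁, hA₁⟩ := hM₁.exists_isAction
  obtain ⟨A₂, hA₂⟩ := hM₂.exists_isAction
  refine ⟨fun v => (A₁ (ofFun (prim v)) + integ (A₂ d)).reg, fun v hv => ?_,
    fun T v v' hv hv' h t ht => ?_⟩
  · have hp := hasTransform_ofFun (isContSignal_prim hv)
    have hT := (hA₁.transform hp).add (hA₂.transform hd).integ
    have himp : (A₁ (ofFun (prim v)) + integ (A₂ d)).impulse = 0 := by
      simp [hA₁.impulse, ofFun, integ]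
    refine ⟨hT.1, ⟨hv, hT.1.2, ?_⟩, ?_⟩
    · filter_upwards [hT.2, evalMat_X_smul G₁, evalMat_X_smul G₂, laplace_prim hv,
        eventually_ne_halfPlanes 0] with s h₁ h₂ h₃ h₄ h₅
      rw [transform_of_impulse_eq_zero himp] at h₁
      rw [h₁, h₂, h₃, h₄, Matrix.smul_mulVec, Matrix.mulVec_smul, smul_smul,
        Matrix.smul_mulVec, smul_smul, mul_inv_cancel₀ h₅, inv_mul_cancel₀ h₅, one_smul, one_smul,
        add_sub_cancel_right]
    · have h₀ : (A₁ (ofFun (prim v))).reg 0 = 0 := by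
        rw [hA₁.reg_zero hp.1.1 rfl]
        simp [ofFun, prim]
      simp [h₀, integ, hA₂.impulse, prim]
  · have := hA₁.causal (x := ofFun (prim v)) (y := ofFun (prim v')) (isContSignal_prim hv)
      (isContSignal_prim hv') rfl h ht
    simp only [add_reg, this]

/-- If an input generates a prolongation of the continuous function `yd`, then the continuous
output that it generates agrees with `yd` at all times in `[0, T]`. -/
theorem Generates.eqOn_of_isContSignal {p q m : ℕ} {G₁ : Matrix (Fin q) (Fin p) (RatFunc ℝ)}
    {G₂ : Matrix (Fin q) (Fin m) (RatFunc ℝ)} {D : Fin m → RatFunc ℝ} {v : ℝ → Fin p → ℝ}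
    {r r' yd : ℝ → Fin q → ℝ} {T : ℝ} (hT : 0 < T) (h : Generates G₁ G₂ D v r)
    (h' : Generates G₁ G₂ D v r') (hr : EqOn r yd (Icc 0 T)) (hyd : ContinuousOn yd (Icc 0 T))
    (hr' : IsContSignal r') : EqOn r' yd (Icc 0 T) := by
  have hae := ae_eq_of_laplace_eq h'.2.1 h.2.1 <| by
    filter_upwards [h.2.2, h'.2.2] with s h₁ h₂
    rw [h₁] at h₂
    exact (sub_left_inj.1 h₂).symm
  rw [restrict_Ioi_eq_restrict_Ici] at hae
  refine Measure.eqOn_of_ae_eq (μ := volume) ?_ (hr'.1.mono Icc_subset_Ici_self) hyd ?_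
  · filter_upwards [ae_restrict_of_ae_restrict_of_subset Icc_subset_Ici_self hae,
      ae_restrict_mem measurableSet_Icc] with t h₁ h₂
    rw [h₁, hr h₂]
  · rw [interior_Icc, closure_Ioo hT.ne]

/-- The initial value of a trackable trajectory. -/
theorem Trackable.apply_zero {p q m : ℕ} {G₁ : Matrix (Fin q) (Fin p) (RatFunc ℝ)}
    {G₂ : Matrix (Fin q) (Fin m) (RatFunc ℝ)} {D : Fin m → RatFunc ℝ} {d : Signal m}
    {M₂ : Matrix (Fin q) (Fin m) ℝ} (hG₁ : StrictlyProper G₁)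
    (hM₂ : MatHasLimAtInfty ((RatFunc.X : RatFunc ℝ) • G₂) M₂)
    (hd : HasTransform d (evalVec D)) {T : ℝ} (hT : 0 < T) {yd : ℝ → Fin q → ℝ}
    (hyd : ContinuousOn yd (Icc 0 T)) (h : Trackable T G₁ G₂ D yd) :
    yd 0 = M₂ *ᵥ d.impulse := by
  obtain ⟨ud, v, r, -, hr, hvr⟩ := h
  obtain ⟨out, hout, -⟩ := exists_output hG₁ hM₂ hd
  obtain ⟨h₁, h₂, h₃⟩ := hout v hvr.1
  rw [← h₃, hvr.eqOn_of_isContSignal hT h₂ hr hyd h₁ ⟨le_rfl, hT.le⟩]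

/-- Multiplication by `s` turns `R - G₂ D` into the transform of a signal; the initial value of
`r` makes the impulses of `s R` and `s G₂ D` cancel. -/
theorem exists_hasTransform_reference {q m : ℕ} {G₂ : Matrix (Fin q) (Fin m) (RatFunc ℝ)}
    {D : Fin m → RatFunc ℝ} {d : Signal m} {M₂ : Matrix (Fin q) (Fin m) ℝ}
    (hM₂ : MatHasLimAtInfty ((RatFunc.X : RatFunc ℝ) • G₂) M₂) (hd : HasTransform d (evalVec D))
    {r : ℝ → Fin q → ℝ} (hr : ContDiffOn ℝ 1 r (Ici 0)) (hr' : Transformable (deriv r))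
    (h₀ : r 0 = M₂ *ᵥ d.impulse) :
    ∃ z : Signal q, z.impulse = 0 ∧
      HasTransform z fun s => s • (laplace r s - evalMat G₂ s *ᵥ evalVec D s) := by
  obtain ⟨A₂, hA₂⟩ := hM₂.exists_isAction
  refine ⟨⟨r 0, derivWithin r (Ici 0)⟩ - A₂ d, by simp [hA₂.impulse, h₀], ?_⟩
  refine ((hasTransform_deriv hr hr').sub (hA₂.transform hd)).congr ?_
  filter_upwards [evalMat_X_smul G₂] with s hs
  rw [hs, smul_sub, Matrix.smul_mulVec]

/-! ### Prolongations and existence of the process -/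

theorem transformable_of_norm_le {n : ℕ} {f : ℝ → Fin n → ℝ} (hf : Continuous f) {C : ℝ}
    (hC : ∀ t, 0 < t → ‖f t‖ ≤ C * Real.exp t) : Transformable f :=
  transformable_iff.2 fun i => hasLap_of_norm_le (C := C) (σ := 1)
    (Continuous.aestronglyMeasurable (by fun_prop)) fun t ht => by
      simpa using (norm_le_pi_norm (f t) i).trans (hC t ht)

theorem exists_continuous_prolongation {n : ℕ} {T : ℝ} (hT : 0 < T) {f : ℝ → Fin n → ℝ}
    (hf : ContinuousOn f (Icc 0 T)) :
    ∃ (g : ℝ → Fin n → ℝ) (C : ℝ), Continuous g ∧ EqOn g f (Icc 0 T) ∧ 0 ≤ C ∧ ∀ t, ‖g t‖ ≤ C := by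
  obtain ⟨C, hC⟩ := isCompact_Icc.exists_bound_of_continuousOn hf
  have hg : Continuous fun t => f (projIcc 0 T hT.le t) :=
    hf.comp_continuous (by fun_prop) fun t => (projIcc 0 T hT.le t).2
  refine ⟨_, C, hg, fun t ht => ?_, (norm_nonneg _).trans (hC 0 ⟨le_rfl, hT.le⟩), fun t => ?_⟩
  · simp only [projIcc_of_mem hT.le ht]
  · exact hC _ (projIcc 0 T hT.le t).2

theorem exists_isContSignal_prolongation {n : ℕ} {T : ℝ} (hT : 0 < T) {f : ℝ → Fin n → ℝ}
    (hf : ContinuousOn f (Icc 0 T)) : ∃ g, IsContSignal g ∧ EqOn g f (Icc 0 T) := by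
  obtain ⟨g, C, hg, hgf, hC0, hC⟩ := exists_continuous_prolongation hT hf
  refine ⟨g, ⟨hg.continuousOn, transformable_of_norm_le (C := C) hg fun t ht => ?_⟩, hgf⟩
  exact (hC t).trans (le_mul_of_one_le_right hC0 (Real.one_le_exp ht.le))

theorem exists_contDiff_prolongation {n : ℕ} {T : ℝ} (hT : 0 < T) {f : ℝ → Fin n → ℝ}
    (hf : ContDiffOn ℝ 1 f (Icc 0 T)) : ∃ r : ℝ → Fin n → ℝ, EqOn r f (Icc 0 T) ∧
      ContDiffOn ℝ 1 r (Ici 0) ∧ Transformable r ∧ Transformable (deriv r) := by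
  have hu : UniqueDiffOn ℝ (Icc 0 T) := uniqueDiffOn_Icc hT
  obtain ⟨g, C, hg, hgf, hC0, hC⟩ :=
    exists_continuous_prolongation hT (hf.continuousOn_derivWithin hu le_rfl)
  have hderiv : ∀ t, HasDerivAt (fun t => f 0 + prim g t) (g t) t := fun t =>
    (intervalIntegral.integral_hasDerivAt_right (hg.intervalIntegrable _ _)
      (hg.stronglyMeasurableAtFilter _ _) hg.continuousAt).const_add _
  have hd : deriv (fun t => f 0 + prim g t) = g := funext fun t => (hderiv t).deriv
  have hrC : ContDiff ℝ 1 fun t => f 0 + prim g t :=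
    contDiff_one_iff_deriv.2 ⟨fun t => (hderiv t).differentiableAt, by rwa [hd]⟩
  refine ⟨fun t => f 0 + prim g t, fun t ht => ?_, hrC.contDiffOn, ?_, ?_⟩
  · have := intervalIntegral.integral_eq_sub_of_hasDeriv_right_of_le ht.1 (f := f) (f' := g)
      (hf.continuousOn.mono (Icc_subset_Icc_right ht.2)) (fun τ hτ => ?_)
      (hg.intervalIntegrable _ _)
    · simp only [prim, this]
      abel
    · have hτT : τ ∈ Icc 0 T := ⟨hτ.1.le, hτ.2.le.trans ht.2⟩
      have hnhds : Icc 0 T ∈ 𝓝 τ := Icc_mem_nhds hτ.1 (hτ.2.trans_le ht.2)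
      rw [hgf hτT]
      exact ((hf.differentiableOn one_ne_zero τ hτT).hasDerivWithinAt.hasDerivAt
        hnhds).hasDerivWithinAt
  · refine transformable_of_norm_le (C := ‖f 0‖ + C) hrC.continuous fun t ht => ?_
    have h₁ : ‖prim g t‖ ≤ C * t := by
      rw [prim]
      simpa [abs_of_pos ht] using intervalIntegral.norm_integral_le_of_norm_le_const
        (a := 0) (b := t) (f := g) (C := C) fun τ _ => hC τ
    have h₂ : t + 1 ≤ Real.exp t := Real.add_one_le_exp t
    have h₃ : ‖f 0‖ * 1 ≤ ‖f 0‖ * Real.exp t :=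
      mul_le_mul_of_nonneg_left (by linarith) (norm_nonneg _)
    have h₄ : C * t ≤ C * Real.exp t := mul_le_mul_of_nonneg_left (by linarith) hC0
    have := norm_add_le (f 0) (prim g t)
    linarith
  · rw [hd]
    exact transformable_of_norm_le (C := C) hg fun t ht =>
      (hC t).trans (le_mul_of_one_le_right hC0 (Real.one_le_exp ht.le))

/-- The learning law produces signals: `Γ (R - G₂ D) = (s⁻¹ Γ) (s (R - G₂ D))`, and `Γ G₁`, `Γ G₂`
are proper. -/
theorem exists_isRun {p q m : ℕ} {T : ℝ} (hT : 0 < T) {G₁ : Matrix (Fin q) (Fin p) (RatFunc ℝ)}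
    {G₂ : Matrix (Fin q) (Fin m) (RatFunc ℝ)} {Γ : Matrix (Fin p) (Fin q) (RatFunc ℝ)}
    (hG₁ : StrictlyProper G₁) (hG₂ : StrictlyProper G₂) {Γ₀ : Matrix (Fin p) (Fin q) ℝ}
    (hΓ : MatHasLimAtInfty ((RatFunc.X : RatFunc ℝ)⁻¹ • Γ) Γ₀)
    {D : Fin m → RatFunc ℝ} {Θ : ℕ → Fin m → RatFunc ℝ} {d : Signal m} {w : ℕ → Signal m}
    {yd : ℝ → Fin q → ℝ} {u₀ : ℝ → Fin p → ℝ} (hd : HasTransform d (evalVec D))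
    (hw : ∀ k, HasTransform (w k) (evalVec (Θ k))) (hyd : ContDiffOn ℝ 1 yd (Icc 0 T))
    (hu₀ : ContinuousOn u₀ (Icc 0 T)) (htr : Trackable T G₁ G₂ D yd) :
    ∃ r u y, IsRun T G₁ G₂ Γ (fun k => D + Θ k) yd u₀ r u y := by
  obtain ⟨M₁, hM₁⟩ := hG₁.exists_X_smul
  obtain ⟨M₂, hM₂⟩ := hG₂.exists_X_smul
  obtain ⟨r, hr, hrC, hrL, hrL'⟩ := exists_contDiff_prolongation hT hyd
  obtain ⟨u0, hu0, hu0e⟩ := exists_isContSignal_prolongation hT hu₀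
  obtain ⟨z, -, hz⟩ := exists_hasTransform_reference hM₂ hd hrC hrL' (by
    rw [hr ⟨le_rfl, hT.le⟩, htr.apply_zero hG₁ hM₂ hd hT hyd.continuousOn])
  obtain ⟨P, hP⟩ := (X_inv_smul_mul_X_smul Γ G₁ ▸ hΓ.mul hM₁).exists_isAction
  obtain ⟨S, hS⟩ := (X_inv_smul_mul_X_smul Γ G₂ ▸ hΓ.mul hM₂).exists_isAction
  obtain ⟨Q, hQ⟩ := hΓ.exists_isAction
  obtain ⟨B₁, hB₁⟩ := MatHasLimAtInfty.exists_isAction hG₁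
  obtain ⟨B₂, hB₂⟩ := MatHasLimAtInfty.exists_isAction hG₂
  set u : ℕ → Signal p := fun k =>
    Nat.rec (ofFun u0) (fun k x => x - P x + Q z - S (w k)) k with hu
  have husucc : ∀ k, u (k + 1) = u k - P (u k) + Q z - S (w k) := fun k => rfl
  have hstep : ∀ k, IsContSignal (u k).reg → HasTransform (u (k + 1)) _ := fun k hk => by
    rw [husucc]
    exact (((hasTransform_self hk).sub (hP.transform (hasTransform_self hk))).add
      (hQ.transform hz)).sub (hS.transform (hw k))
  have hcont : ∀ k, IsContSignal (u k).reg := by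
    intro k
    induction k with
    | zero => exact hu0
    | succ k ih => exact (hstep k ih).1
  have hyT : ∀ k, HasTransform (B₁ (u k) + B₂ (d + w k)) _ := fun k =>
    (hB₁.transform (hasTransform_self (hcont k))).add (hB₂.transform (hd.add (hw k)))
  have hyimp : ∀ k, (B₁ (u k) + B₂ (d + w k)).impulse = 0 := fun k => by
    simp [hB₁.impulse, hB₂.impulse]
  have hplant : ∀ k, ∀ᶠ s in halfPlanes, laplace (B₁ (u k) + B₂ (d + w k)).reg s =
      evalMat G₁ s *ᵥ (u k).transform s + evalMat G₂ s *ᵥ evalVec (D + Θ k) s := by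
    intro k
    filter_upwards [(hyT k).2, evalVec_add D (Θ k)] with s h₁ h₂
    rw [← transform_of_impulse_eq_zero (hyimp k), h₁, h₂]
  refine ⟨r, u, fun k => (B₁ (u k) + B₂ (d + w k)).reg, hr, hrC, hrL, hrL', rfl, hu0e, hcont,
    fun k => (hyT k).1, hplant, fun k => ?_⟩
  filter_upwards [(hstep k (hcont k)).2, hplant k, evalVec_add D (Θ k), evalMat_mul Γ G₁,
    evalMat_mul Γ G₂, evalMat_X_inv_smul Γ, eventually_ne_halfPlanes 0]
    with s h₁ h₂ h₃ h₄ h₅ h₆ h₇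
  rw [h₁, h₂, h₃, h₄, h₅, h₆, Matrix.smul_mulVec, Matrix.mulVec_smul, smul_smul,
    inv_mul_cancel₀ h₇, one_smul]
  simp only [Matrix.mulVec_sub, Matrix.mulVec_add, ← Matrix.mulVec_mulVec]
  abel

/-! ### Rational matrix identities -/

theorem mul_inv_cancel_left_of_det {n a : ℕ} {M : Matrix (Fin n) (Fin n) (RatFunc ℝ)}
    (hM : M.det ≠ 0) (N : Matrix (Fin n) (Fin a) (RatFunc ℝ)) : M * (M⁻¹ * N) = N :=
  Matrix.mul_nonsing_inv_cancel_left M N (isUnit_iff_ne_zero.2 hM)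

theorem det_transpose_mul_self_ne_zero {q p : ℕ} {G : Matrix (Fin q) (Fin p) (RatFunc ℝ)}
    {M : Matrix (Fin q) (Fin p) ℝ} (hM : MatHasLimAtInfty ((RatFunc.X : RatFunc ℝ) • G) M)
    (hinj : ∀ x, M *ᵥ x = 0 → x = 0) : (Gᵀ * G).det ≠ 0 := by
  have h₀ : (Mᵀ * M).det ≠ 0 := by
    intro h
    obtain ⟨x, hx, hMx⟩ := Matrix.exists_mulVec_eq_zero_iff.2 h
    refine hx (hinj x ?_)
    rw [← Matrix.mulVec_mulVec] at hMx
    have h₁ : (M *ᵥ x) ⬝ᵥ (M *ᵥ x) = 0 := by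
      rw [Matrix.dotProduct_mulVec, ← Matrix.mulVec_transpose, hMx, zero_dotProduct]
    exact dotProduct_self_eq_zero.1 h₁
  have h := (hM.transpose.mul hM).det_ne_zero h₀
  rw [Matrix.transpose_smul, Matrix.smul_mul, Matrix.mul_smul, smul_smul, Matrix.det_smul] at h
  exact right_ne_zero_of_mul h

/-- The initial value theorem for the impulse response: `Φ(0) = lim s G(s)`, since `G` is the
response of `s G` to a step. -/
theorem IsImpulseResponse.apply_zero {q p : ℕ} {Φ : ℝ → Matrix (Fin q) (Fin p) ℝ}
    {G : Matrix (Fin q) (Fin p) (RatFunc ℝ)} (hΦ : IsImpulseResponse Φ G)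
    {M : Matrix (Fin q) (Fin p) ℝ} (hM : MatHasLimAtInfty ((RatFunc.X : RatFunc ℝ) • G) M) :
    Φ 0 = M := by
  obtain ⟨A, hA⟩ := hM.exists_isAction
  ext i j
  have hstep := hasTransform_ofFun (isContSignal_const (Pi.single j (1 : ℝ) : Fin p → ℝ))
  have h := (hasTransform_ofFun (hΦ j).1).unique (hA.transform hstep) <| by
    filter_upwards [(hΦ j).2, evalMat_X_smul G, lap_one, eventually_ne_halfPlanes 0]
      with s h₁ h₂ h₃ h₄
    have hl : laplace (fun _ => (Pi.single j (1 : ℝ) : Fin p → ℝ)) s = s⁻¹ • Pi.single j 1 := by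
      ext k
      by_cases hk : k = j
      · subst hk
        simpa [laplace_apply] using h₃
      · simp [laplace_apply, hk, lap]
    rw [h₁, h₂, hl, Matrix.smul_mulVec, Matrix.mulVec_smul, smul_smul, mul_inv_cancel₀ h₄, one_smul]
    ext k
    simp [evalVec, evalMat]
  have h₀ := congrFun (h.2 (self_mem_Ici : (0 : ℝ) ∈ Ici 0)) i
  rw [hA.reg_zero hstep.1.1 rfl] at h₀
  simpa [ofFun] using h₀

theorem LeftBlockNonsingular.det_leftCols_ne_zero {q p : ℕ} {h : q ≤ p}
    {G : Matrix (Fin q) (Fin p) (RatFunc ℝ)} (hG : StrictlyProper G)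
    (hleft : LeftBlockNonsingular h G) : (leftCols h G).det ≠ 0 := by
  obtain ⟨Φ, hΦ, hdet⟩ := hleft
  obtain ⟨M, hM⟩ := hG.exists_X_smul
  rw [hΦ.apply_zero hM] at hdet
  have hlim : MatHasLimAtInfty ((RatFunc.X : RatFunc ℝ) • leftCols h G) (leftCols h M) :=
    fun i j => hM i _
  have := hlim.det_ne_zero hdet
  rw [Matrix.det_smul] at this
  exact right_ne_zero_of_mul this

/-- The block matrix `gammaTilde` is the complementary projection `1 - Γ (G₁ Γ)⁻¹ G₁`. -/
theorem gammaTilde_eq {q p : ℕ} (h : q ≤ p) {G : Matrix (Fin q) (Fin p) (RatFunc ℝ)}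
    {Γ : Matrix (Fin p) (Fin q) (RatFunc ℝ)} (h₁ : (leftCols h G).det ≠ 0)
    (h₂ : (G * Γ).det ≠ 0) : gammaTilde h G Γ = 1 - Γ * (G * Γ)⁻¹ * G := by
  set N := (G * Γ)⁻¹
  set G₁₁ := leftCols h G
  set G₁₂ := rightCols h G
  set Γ₂ := lowerRows h Γ
  set Γ₁ : Matrix (Fin q) (Fin q) (RatFunc ℝ) := Γ.submatrix (split h ∘ Sum.inl) id
  have hG : G.submatrix id (split h) = Matrix.fromCols G₁₁ G₁₂ := by
    ext i (j | j) <;> rfl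
  have hΓ : Γ.submatrix (split h) id = Matrix.fromRows Γ₁ Γ₂ := by
    ext (i | i) j <;> rfl
  have hsum : G₁₁ * Γ₁ + G₁₂ * Γ₂ = G * Γ := by
    rw [← Matrix.fromCols_mul_fromRows, ← hG, ← hΓ, Matrix.submatrix_mul_equiv,
      Matrix.submatrix_id_id]
  have hcancel : G₁₁⁻¹ * G₁₁ = 1 := Matrix.nonsing_inv_mul _ (isUnit_iff_ne_zero.2 h₁)
  have hmul : (G₁₁ * Γ₁ + G₁₂ * Γ₂) * N = 1 := by
    rw [hsum]
    exact Matrix.mul_nonsing_inv _ (isUnit_iff_ne_zero.2 h₂)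
  -- the upper rows are eliminated by means of `G₁ Γ (G₁ Γ)⁻¹ = 1`
  have hup : Γ₁ * N = G₁₁⁻¹ * (1 - G₁₂ * (Γ₂ * N)) := by
    have : G₁₁ * (Γ₁ * N) = 1 - G₁₂ * (Γ₂ * N) := by
      rw [eq_sub_iff_add_eq, ← Matrix.mul_assoc, ← Matrix.mul_assoc, ← Matrix.add_mul, hmul]
    rw [← this, ← Matrix.mul_assoc, hcancel, Matrix.one_mul]
  have hblock : (1 - Γ * N * G).submatrix (split h) (split h) =
      Matrix.fromBlocks (G₁₁⁻¹ * G₁₂ * Γ₂ * N * G₁₁) (-(G₁₁⁻¹ * (G₁₂ * (1 - Γ₂ * N * G₁₂))))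
        (-(Γ₂ * N * G₁₁)) (1 - Γ₂ * N * G₁₂) := by
    have hprod : (Γ * N * G).submatrix (split h) (split h) =
        Matrix.fromBlocks (Γ₁ * N * G₁₁) (Γ₁ * N * G₁₂) (Γ₂ * N * G₁₁) (Γ₂ * N * G₁₂) := by
      rw [← Matrix.fromRows_mul_fromCols, ← Matrix.fromRows_mul, ← hG, ← hΓ]
      rfl
    have hone : (1 : Matrix (Fin p) (Fin p) (RatFunc ℝ)).submatrix (split h) (split h) =
        Matrix.fromBlocks 1 0 0 1 := by
      rw [Matrix.submatrix_one_equiv, Matrix.fromBlocks_one]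
    have hsub : (1 - Γ * N * G).submatrix (split h) (split h) =
        (1 : Matrix (Fin p) (Fin p) (RatFunc ℝ)).submatrix (split h) (split h) -
          (Γ * N * G).submatrix (split h) (split h) := rfl
    rw [hsub, hprod, hone, sub_eq_add_neg, Matrix.fromBlocks_neg, Matrix.fromBlocks_add, hup]
    congr 1
    · rw [Matrix.mul_assoc G₁₁⁻¹, Matrix.sub_mul, Matrix.mul_sub, Matrix.one_mul, hcancel]
      simp only [Matrix.mul_assoc]
      abel
    · rw [zero_add, Matrix.mul_assoc G₁₁⁻¹, Matrix.sub_mul, Matrix.one_mul, Matrix.mul_sub G₁₂,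
        Matrix.mul_one]
      simp only [Matrix.mul_assoc]
    · rw [zero_add]
    · rw [← sub_eq_add_neg]
  have hgt : gammaTilde h G Γ = (Matrix.fromBlocks (G₁₁⁻¹ * G₁₂ * Γ₂ * N * G₁₁)
      (-(G₁₁⁻¹ * G₁₂ * (1 - Γ₂ * N * G₁₂))) (-(Γ₂ * N * G₁₁))
      (1 - Γ₂ * N * G₁₂)).submatrix (split h).symm (split h).symm := rfl
  rw [hgt, Matrix.mul_assoc G₁₁⁻¹ G₁₂ (1 - _), ← hblock, Matrix.submatrix_submatrix]
  simp

/-! ### From bounds in the sup norm to the limits superior -/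

theorem limsupSup_le {n : ℕ} {N : Seminorm ℝ (Fin n → ℝ)} {c M ρ K : ℝ} (hc : 0 ≤ c)
    (hN : ∀ x, N x ≤ c * ‖x‖) (hρ0 : 0 ≤ ρ) (hρ1 : ρ < 1) {S : Set ℝ} {f : ℕ → ℝ → Fin n → ℝ}
    (hf : ∀ k, ∀ t ∈ S, ‖f k t‖ ≤ M * ρ ^ k + K) : limsupSup N S f ≤ ENNReal.ofReal (c * K) := by
  have hlim : Tendsto (fun k : ℕ => ENNReal.ofReal (c * (M * ρ ^ k + K))) atTop
      (𝓝 (ENNReal.ofReal (c * K))) := by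
    refine ENNReal.tendsto_ofReal ?_
    simpa using (((tendsto_pow_atTop_nhds_zero_of_lt_one hρ0 hρ1).const_mul M).add_const
      K).const_mul c
  rw [← hlim.limsup_eq]
  refine limsup_le_limsup (Eventually.of_forall fun k => iSup₂_le fun t ht => ?_)
  exact ENNReal.ofReal_le_ofReal ((hN _).trans (mul_le_mul_of_nonneg_left (hf k t ht) hc))

theorem tendstoUniformlyOn_of_norm_le {n : ℕ} {M ρ : ℝ} (hρ0 : 0 ≤ ρ) (hρ1 : ρ < 1) {S : Set ℝ}
    {f : ℕ → ℝ → Fin n → ℝ} {g : ℝ → Fin n → ℝ}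
    (hf : ∀ k, ∀ t ∈ S, ‖g t - f k t‖ ≤ M * ρ ^ k) : TendstoUniformlyOn f g atTop S := by
  rw [Metric.tendstoUniformlyOn_iff]
  intro ε hε
  have hlim : Tendsto (fun k : ℕ => M * ρ ^ k) atTop (𝓝 0) := by
    simpa using (tendsto_pow_atTop_nhds_zero_of_lt_one hρ0 hρ1).const_mul M
  filter_upwards [hlim.eventually_lt_const hε] with k hk t ht
  rw [dist_eq_norm]
  exact (hf k t ht).trans_lt hk

/-- A bound on the input errors controls the output errors as well, because
`E_k = -G₁ (U_k - U_∞) - G₂ Θ_k` on `[0, T]` when `u_∞` generates `yd` there. -/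
theorem exists_gain {p q m : ℕ} (T : ℝ) (Np : Seminorm ℝ (Fin p → ℝ)) (Nq : Seminorm ℝ (Fin q → ℝ))
    {G₁ : Matrix (Fin q) (Fin p) (RatFunc ℝ)} {G₂ : Matrix (Fin q) (Fin m) (RatFunc ℝ)}
    (Γ : Matrix (Fin p) (Fin q) (RatFunc ℝ)) (hG₁ : StrictlyProper G₁) (hG₂ : StrictlyProper G₂)
    {C ρ c : ℝ} (hC : 0 ≤ C) (hρ0 : 0 ≤ ρ) (hρ1 : ρ < 1) (hc : 0 ≤ c) :
    ∃ κ : ℝ≥0, ∀ {D : Fin m → RatFunc ℝ} {Θ : ℕ → Fin m → RatFunc ℝ} {w : ℕ → Signal m}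
      {bθ bθhat : ℝ≥0} {yd : ℝ → Fin q → ℝ} {u₀ : ℝ → Fin p → ℝ} {r r' : ℝ → Fin q → ℝ}
      {u : ℕ → Signal p} {y : ℕ → ℝ → Fin q → ℝ} {uinf : ℝ → Fin p → ℝ} {M : ℝ},
      IsRun T G₁ G₂ Γ (fun k => D + Θ k) yd u₀ r u y →
      (∀ k, HasTransform (w k) (evalVec (Θ k))) → (∀ k, ‖(w k).impulse‖ ≤ c * bθ) →
      (∀ k, ∀ t ∈ Icc 0 T, ‖(w k).reg t‖ ≤ c * bθhat) → IsContSignal uinf → IsContSignal r' →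
      Generates G₁ G₂ D uinf r' → EqOn r' yd (Icc 0 T) → 0 ≤ M →
      (∀ k, ‖(u k).impulse‖ ≤ C * (c * bθ + c * bθhat) ∧ ∀ t ∈ Icc 0 T,
        ‖(u k).reg t - uinf t‖ ≤ M * ρ ^ k + C * (c * bθ + c * bθhat)) →
      limsupSup Nq (Icc 0 T) (fun k t => yd t - y k t) ≤ ((κ * (bθ + bθhat) : ℝ≥0) : ℝ≥0∞) ∧
      limsupSup Np (Ioc 0 T) (fun k t => (u k).reg t - uinf t)
        ≤ ((κ * (bθ + bθhat) : ℝ≥0) : ℝ≥0∞) ∧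
      (bθ = 0 → bθhat = 0 → (∀ k, (u k).impulse = 0) ∧
        TendstoUniformlyOn (fun k => (u k).reg) uinf atTop (Icc 0 T) ∧
        TendstoUniformlyOn y yd atTop (Icc 0 T)) := by
  obtain ⟨B₁, hB₁⟩ := MatHasLimAtInfty.exists_isAction hG₁
  obtain ⟨B₂, hB₂⟩ := MatHasLimAtInfty.exists_isAction hG₂
  obtain ⟨C₁, hC₁0, hC₁⟩ := hB₁.exists_bound T
  obtain ⟨C₂, hC₂0, hC₂⟩ := hB₂.exists_bound T
  obtain ⟨cp, hcp0, hcp⟩ := exists_seminorm_le Np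
  obtain ⟨cq, hcq0, hcq⟩ := exists_seminorm_le Nq
  set E : ℝ := 2 * C₁ * C + C₂ with hE
  have hE0 : 0 ≤ E := by positivity
  obtain ⟨κ, hκdef⟩ : ∃ κ : ℝ≥0, (κ : ℝ) = cq * E * c + cp * C * c := ⟨⟨_, by positivity⟩, rfl⟩
  refine ⟨κ, ?_⟩
  intro D Θ w bθ bθhat yd u₀ r r' u y uinf M hrun hw hwa hwb huinf hr' hgen hr'yd hM hbd
  have hb0 : (0 : ℝ) ≤ bθ + bθhat := by positivity
  have hr : IsContSignal r := ⟨hrun.ref_contDiff.continuousOn, hrun.ref_transformable⟩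
  have herr : ∀ k, ∀ t ∈ Icc 0 T,
      ‖yd t - y k t‖ ≤ C₁ * M * ρ ^ k + E * (c * bθ + c * bθhat) := by
    intro k t ht
    have hv := (hasTransform_self (hrun.input k)).sub (hasTransform_ofFun huinf)
    have heq := ((hasTransform_ofFun hr).sub (hasTransform_ofFun (hrun.output k))).unique
      (((hasTransform_ofFun hr).sub (hasTransform_ofFun hr')).sub
        ((hB₁.transform hv).add (hB₂.transform (hw k)))) <| by
      filter_upwards [hrun.plant k, evalVec_add D (Θ k), hgen.2.2] with s h₁ h₂ h₃
      have h₄ : laplace r' s = evalMat G₁ s *ᵥ laplace uinf s + evalMat G₂ s *ᵥ evalVec D s := by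
        rw [h₃, sub_add_cancel]
      rw [h₁, h₂, h₄]
      simp only [Matrix.mulVec_sub, Matrix.mulVec_add]
      abel
    have h₁ : yd t - y k t =
        -((B₁ (u k - ofFun uinf)).reg t + (B₂ (w k)).reg t) := by
      have := heq.2 ht.1
      simp only [sub_reg, add_reg, ofFun] at this
      rw [← hrun.ref_eq ht, this, hrun.ref_eq ht, hr'yd ht, sub_self, zero_sub]
      rfl
    have h₂ := (hC₁ (u k - ofFun uinf) _ _ hv.1 (by simpa [ofFun] using (hbd k).1)
      (hbd k).2).2 t ht
    have h₃ := (hC₂ (w k) _ _ (hw k).1 (hwa k) (hwb k)).2 t ht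
    rw [h₁, norm_neg]
    refine (norm_add_le _ _).trans ((add_le_add h₂ h₃).trans (le_of_eq ?_))
    rw [hE]
    ring
  have hinp : ∀ k, ∀ t ∈ Icc 0 T,
      ‖(u k).reg t - uinf t‖ ≤ M * ρ ^ k + C * (c * bθ + c * bθhat) := fun k => (hbd k).2
  have hκ : ∀ K : ℝ, K ≤ cq * E * c + cp * C * c → ENNReal.ofReal (K * (bθ + bθhat)) ≤
      ((κ * (bθ + bθhat) : ℝ≥0) : ℝ≥0∞) := by
    intro K hK
    rw [← ENNReal.ofReal_coe_nnreal]
    refine ENNReal.ofReal_le_ofReal ?_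
    simpa [hκdef] using mul_le_mul_of_nonneg_right hK hb0
  refine ⟨?_, ?_, fun h₁ h₂ => ?_⟩
  · refine (limsupSup_le hcq0 hcq hρ0 hρ1 herr).trans ?_
    rw [show cq * (E * (c * bθ + c * bθhat)) = cq * E * c * (bθ + bθhat) by ring]
    exact hκ _ (le_add_of_nonneg_right (by positivity))
  · refine (limsupSup_le hcp0 hcp hρ0 hρ1 fun k t ht => hinp k t (Ioc_subset_Icc_self ht)).trans ?_
    rw [show cp * (C * (c * bθ + c * bθhat)) = cp * C * c * (bθ + bθhat) by ring]
    exact hκ _ (le_add_of_nonneg_left (by positivity))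
  · subst h₁ h₂
    simp only [NNReal.coe_zero, mul_zero, add_zero] at hbd herr hinp
    refine ⟨fun k => norm_le_zero_iff.1 (hbd k).1,
      tendstoUniformlyOn_of_norm_le hρ0 hρ1 (M := M) ?_,
      tendstoUniformlyOn_of_norm_le hρ0 hρ1 (M := C₁ * M) herr⟩
    intro k t ht
    rw [norm_sub_rev]
    exact hinp k t ht

/-! ### Convergence of the inputs -/

/-- One step of the learning law, for the error with respect to an input `uinf` that reproduces
the reference after multiplication by `Γ`. -/
theorem IsRun.input_error_succ {p q m : ℕ} {T : ℝ} {G₁ : Matrix (Fin q) (Fin p) (RatFunc ℝ)}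
    {G₂ : Matrix (Fin q) (Fin m) (RatFunc ℝ)} {Γ : Matrix (Fin p) (Fin q) (RatFunc ℝ)}
    {D : Fin m → RatFunc ℝ} {Θ : ℕ → Fin m → RatFunc ℝ} {yd : ℝ → Fin q → ℝ} {u₀ : ℝ → Fin p → ℝ}
    {r : ℝ → Fin q → ℝ} {u : ℕ → Signal p} {y : ℕ → ℝ → Fin q → ℝ} {uinf : ℝ → Fin p → ℝ}
    (hrun : IsRun T G₁ G₂ Γ (fun k => D + Θ k) yd u₀ r u y)
    (huinf : ∀ᶠ s in halfPlanes, evalMat Γ s *ᵥ (evalMat G₁ s *ᵥ laplace uinf s) =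
      evalMat Γ s *ᵥ (laplace r s - evalMat G₂ s *ᵥ evalVec D s)) (k : ℕ) :
    ∀ᶠ s in halfPlanes, (u (k + 1)).transform s - laplace uinf s =
      ((u k).transform s - laplace uinf s) -
        evalMat Γ s *ᵥ (evalMat G₁ s *ᵥ ((u k).transform s - laplace uinf s)) -
        evalMat Γ s *ᵥ (evalMat G₂ s *ᵥ evalVec (Θ k) s) := by
  filter_upwards [hrun.update k, hrun.plant k, evalVec_add D (Θ k), huinf] with s h₁ h₂ h₃ h₄
  rw [h₁, h₂, h₃]
  simp only [Matrix.mulVec_sub, Matrix.mulVec_add] at h₄ ⊢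
  rw [h₄]
  abel

/-- The case `q ≥ p`: the input errors obey an iteration with `1 - Γ G₁`. -/
theorem exists_input_bound_left {p q m : ℕ} (T : ℝ) {G₁ : Matrix (Fin q) (Fin p) (RatFunc ℝ)}
    {G₂ : Matrix (Fin q) (Fin m) (RatFunc ℝ)} {Γ : Matrix (Fin p) (Fin q) (RatFunc ℝ)}
    {Γ₀ : Matrix (Fin p) (Fin q) ℝ} (hG₂ : StrictlyProper G₂)
    (hΓ : MatHasLimAtInfty ((RatFunc.X : RatFunc ℝ)⁻¹ • Γ) Γ₀)
    {L : Matrix (Fin p) (Fin p) ℝ} (hL : MatHasLimAtInfty (Γ * G₁) L)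
    (hρ : specRadius (1 - L) < 1) :
    ∃ C ρ : ℝ, 0 ≤ C ∧ 0 ≤ ρ ∧ ρ < 1 ∧ ∀ {D : Fin m → RatFunc ℝ} {Θ : ℕ → Fin m → RatFunc ℝ}
      {w : ℕ → Signal m} {a b : ℝ} {yd : ℝ → Fin q → ℝ} {u₀ : ℝ → Fin p → ℝ} {r : ℝ → Fin q → ℝ}
      {u : ℕ → Signal p} {y : ℕ → ℝ → Fin q → ℝ} {uinf : ℝ → Fin p → ℝ},
      IsRun T G₁ G₂ Γ (fun k => D + Θ k) yd u₀ r u y →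
      (∀ k, HasTransform (w k) (evalVec (Θ k))) → 0 ≤ a → 0 ≤ b → (∀ k, ‖(w k).impulse‖ ≤ a) →
      (∀ k, ∀ t ∈ Icc 0 T, ‖(w k).reg t‖ ≤ b) → IsContSignal uinf →
      (∀ᶠ s in halfPlanes, evalMat Γ s *ᵥ (evalMat G₁ s *ᵥ laplace uinf s) =
        evalMat Γ s *ᵥ (laplace r s - evalMat G₂ s *ᵥ evalVec D s)) →
      ∃ M, 0 ≤ M ∧ ∀ k, ‖(u k).impulse‖ ≤ C * (a + b) ∧
        ∀ t ∈ Icc 0 T, ‖(u k).reg t - uinf t‖ ≤ M * ρ ^ k + C * (a + b) := by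
  obtain ⟨M₂, hM₂⟩ := hG₂.exists_X_smul
  obtain ⟨F, hF⟩ := (matHasLimAtInfty_one.sub hL).exists_isAction
  obtain ⟨H, hH⟩ := (X_inv_smul_mul_X_smul Γ G₂ ▸ hΓ.mul hM₂).exists_isAction
  obtain ⟨C, ρ, hC, hρ0, hρ1, h⟩ := exists_iteration_bound hF hH hρ T
  refine ⟨C, ρ, hC, hρ0, hρ1,
    fun {D Θ w a b yd u₀ r u y uinf} hrun hw ha hb hwa hwb huinf heq => ?_⟩
  have hv : ∀ k, HasTransform (u k - ofFun uinf) _ := fun k =>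
    (hasTransform_self (hrun.input k)).sub (hasTransform_ofFun huinf)
  have hstep : ∀ k, _ := fun k => (hv (k + 1)).unique ((hF.transform (hv k)).sub
    (hH.transform (hw k))) <| by
      filter_upwards [hrun.input_error_succ heq k, evalMat_sub 1 (Γ * G₁), evalMat_mul Γ G₁,
        evalMat_mul Γ G₂] with s h₁ h₂ h₃ h₄
      rw [h₁, h₂, h₃, h₄, evalMat_one, Matrix.sub_mulVec, Matrix.one_mulVec]
      simp only [Matrix.mulVec_mulVec]
  obtain ⟨M, hM, hbd⟩ := h (fun k => u k - ofFun uinf) w a b (fun k => (hv k).1)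
    (fun k => (hw k).1) (by simp [hrun.init_impulse, ofFun]) (fun k => (hstep k).1)
    (fun k => (hstep k).2) ha hb hwa hwb
  exact ⟨M, hM, fun k => ⟨by simpa [ofFun] using (hbd k).1, (hbd k).2⟩⟩

/-- The case `q ≤ p`: with `P = Γ (G₁ Γ)⁻¹ G₁`, the input errors stay in the range of the
projection `P`, so that they can be recovered from `s G₁ (U_k - U_∞)`, which obeys an iteration
with `1 - G₁ Γ`. -/
theorem exists_input_bound_right {p q m : ℕ} (T : ℝ) {G₁ : Matrix (Fin q) (Fin p) (RatFunc ℝ)}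
    {G₂ : Matrix (Fin q) (Fin m) (RatFunc ℝ)} {Γ : Matrix (Fin p) (Fin q) (RatFunc ℝ)}
    {Γ₀ : Matrix (Fin p) (Fin q) ℝ} (hG₁ : StrictlyProper G₁) (hG₂ : StrictlyProper G₂)
    (hΓ : MatHasLimAtInfty ((RatFunc.X : RatFunc ℝ)⁻¹ • Γ) Γ₀)
    {L : Matrix (Fin q) (Fin q) ℝ} (hL : MatHasLimAtInfty (G₁ * Γ) L)
    (hρ : specRadius (1 - L) < 1) :
    ∃ C ρ : ℝ, 0 ≤ C ∧ 0 ≤ ρ ∧ ρ < 1 ∧ ∀ {D : Fin m → RatFunc ℝ} {Θ : ℕ → Fin m → RatFunc ℝ}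
      {w : ℕ → Signal m} {a b : ℝ} {yd : ℝ → Fin q → ℝ} {u₀ : ℝ → Fin p → ℝ} {r : ℝ → Fin q → ℝ}
      {u : ℕ → Signal p} {y : ℕ → ℝ → Fin q → ℝ} {uinf : ℝ → Fin p → ℝ},
      IsRun T G₁ G₂ Γ (fun k => D + Θ k) yd u₀ r u y →
      (∀ k, HasTransform (w k) (evalVec (Θ k))) → 0 ≤ a → 0 ≤ b → (∀ k, ‖(w k).impulse‖ ≤ a) →
      (∀ k, ∀ t ∈ Icc 0 T, ‖(w k).reg t‖ ≤ b) → IsContSignal uinf →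
      (∀ᶠ s in halfPlanes, evalMat G₁ s *ᵥ laplace uinf s =
        laplace r s - evalMat G₂ s *ᵥ evalVec D s) →
      (∀ᶠ s in halfPlanes, (u 0).transform s - laplace uinf s =
        evalMat Γ s *ᵥ (evalMat (G₁ * Γ)⁻¹ s *ᵥ
          (evalMat G₁ s *ᵥ ((u 0).transform s - laplace uinf s)))) →
      ∃ M, 0 ≤ M ∧ ∀ k, ‖(u k).impulse‖ ≤ C * (a + b) ∧
        ∀ t ∈ Icc 0 T, ‖(u k).reg t - uinf t‖ ≤ M * ρ ^ k + C * (a + b) := by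
  have hLdet := det_ne_zero_of_specRadius_lt hρ
  have hdet := hL.det_ne_zero hLdet
  obtain ⟨M₁, hM₁⟩ := hG₁.exists_X_smul
  obtain ⟨M₂, hM₂⟩ := hG₂.exists_X_smul
  obtain ⟨A₁, hA₁⟩ := hM₁.exists_isAction
  obtain ⟨F, hF⟩ := (matHasLimAtInfty_one.sub hL).exists_isAction
  obtain ⟨H, hH⟩ := (hL.mul hM₂).exists_isAction
  obtain ⟨K, hK⟩ := (hΓ.mul (hL.inv hLdet)).exists_isAction
  obtain ⟨CK, hCK0, hCK⟩ := hK.exists_bound T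
  obtain ⟨C, ρ, hC, hρ0, hρ1, h⟩ := exists_iteration_bound hF hH hρ T
  refine ⟨2 * CK * C, ρ, by positivity, hρ0, hρ1,
    fun {D Θ w a b yd u₀ r u y uinf} hrun hw ha hb hwa hwb huinf heq hproj => ?_⟩
  have hv : ∀ k, HasTransform (u k - ofFun uinf) fun s => (u k).transform s - laplace uinf s :=
    fun k => (hasTransform_self (hrun.input k)).sub (hasTransform_ofFun huinf)
  have hsucc : ∀ k, _ := fun k => hrun.input_error_succ (heq.mono fun s hs => by rw [hs]) k
  -- the input errors are fixed by the projection
  have hfix : ∀ k, ∀ᶠ s in halfPlanes, (u k).transform s - laplace uinf s =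
      evalMat Γ s *ᵥ (evalMat (G₁ * Γ)⁻¹ s *ᵥ
        (evalMat G₁ s *ᵥ ((u k).transform s - laplace uinf s))) := by
    intro k
    induction k with
    | zero => exact hproj
    | succ k ih =>
      have hinv := evalMat_mul (G₁ * Γ)⁻¹ (G₁ * Γ)
      rw [Matrix.nonsing_inv_mul _ (isUnit_iff_ne_zero.2 hdet)] at hinv
      filter_upwards [ih, hsucc k, hinv, evalMat_mul G₁ Γ] with s h₁ h₂ h₃ h₄
      rw [evalMat_one, h₄] at h₃
      have h₅ : ∀ x, evalMat (G₁ * Γ)⁻¹ s *ᵥ (evalMat G₁ s *ᵥ (evalMat Γ s *ᵥ x)) = x := by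
        intro x
        rw [Matrix.mulVec_mulVec, Matrix.mulVec_mulVec, Matrix.mul_assoc, ← h₃, Matrix.one_mulVec]
      rw [h₂]
      simp only [Matrix.mulVec_sub, h₅] at h₁ ⊢
      rw [← h₁]
  have hx : ∀ k, HasTransform (A₁ (u k - ofFun uinf)) _ := fun k => hA₁.transform (hv k)
  have hstep : ∀ k, _ := fun k => (hx (k + 1)).unique ((hF.transform (hx k)).sub
    (hH.transform (hw k))) <| by
      filter_upwards [hsucc k, evalMat_X_smul G₁, evalMat_X_smul G₂, evalMat_sub 1 (G₁ * Γ),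
        evalMat_mul G₁ Γ, evalMat_mul (G₁ * Γ) ((RatFunc.X : RatFunc ℝ) • G₂)]
        with s h₁ h₂ h₃ h₄ h₅ h₆
      rw [h₁, h₆, h₅, h₄, h₅, h₃, h₂, evalMat_one]
      simp only [Matrix.mulVec_sub, Matrix.sub_mulVec, Matrix.one_mulVec, Matrix.smul_mulVec,
        Matrix.mulVec_smul, ← Matrix.mulVec_mulVec, smul_sub]
      abel
  have himp : ∀ k, (u k - ofFun uinf).impulse = (u k).impulse := fun k => by simp [ofFun]
  obtain ⟨M, hM, hbd⟩ := h (fun k => A₁ (u k - ofFun uinf)) w a b (fun k => (hx k).1)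
    (fun k => (hw k).1) (by simp only [hA₁.impulse, himp, hrun.init_impulse, Matrix.mulVec_zero])
    (fun k => (hstep k).1) (fun k => (hstep k).2) ha hb hwa hwb
  refine ⟨CK * M, by positivity, fun k => ?_⟩
  have hrec := (hv k).unique (hK.transform (hx k)) <| by
    filter_upwards [hfix k, evalMat_mul ((RatFunc.X : RatFunc ℝ)⁻¹ • Γ) (G₁ * Γ)⁻¹,
      evalMat_X_inv_smul Γ, evalMat_X_smul G₁, eventually_ne_halfPlanes 0] with s h₁ h₂ h₃ h₄ h₅
    rw [h₂, h₃, h₄, ← Matrix.mulVec_mulVec, Matrix.smul_mulVec, Matrix.smul_mulVec,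
      Matrix.mulVec_smul, Matrix.mulVec_smul, smul_smul, inv_mul_cancel₀ h₅, one_smul]
    exact h₁
  obtain ⟨h₁, h₂⟩ := hCK (A₁ (u k - ofFun uinf)) _ _ (hx k).1 (hbd k).1 (hbd k).2
  rw [← hrec.1, himp] at h₁
  refine ⟨h₁.trans ?_, fun t ht => ?_⟩
  · have : 0 ≤ CK * (C * (a + b)) := by positivity
    linarith
  · have h₃ := h₂ t ht
    rw [← hrec.2 ht.1] at h₃
    refine h₃.trans (le_of_eq ?_)
    ring

/-- Causality for a transfer matrix `s K` of relative degree `-1`: if the input vanishes on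
`[0, T]`, then so does the primitive of the output. -/
theorem IsAction.prim_eqOn {a b : ℕ} {K : Matrix (Fin a) (Fin b) (RatFunc ℝ)} {K₀ F}
    (hK : IsAction K K₀ F) {T : ℝ} {x : ℝ → Fin b → ℝ} (hx : IsContSignal x)
    (hx₀ : ∀ t ∈ Icc 0 T, x t = 0) {f g : ℝ → Fin a → ℝ} (hf : Transformable f)
    (hg : Transformable g) (h : ∀ᶠ s in halfPlanes,
      s⁻¹ • (laplace f s - laplace g s) = evalMat K s *ᵥ laplace x s) :
    EqOn (prim f) (prim g) (Icc 0 T) := by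
  have heq := ((hasTransform_ofFun (isContSignal_prim hf)).sub
    (hasTransform_ofFun (isContSignal_prim hg))).unique (hK.transform (hasTransform_ofFun hx)) <| by
      filter_upwards [h, laplace_prim hf, laplace_prim hg] with s h₁ h₂ h₃
      rw [h₂, h₃, ← smul_sub, h₁]
  intro t ht
  have h₁ := heq.2 ht.1
  rw [hK.eqOn_zero (x := ofFun x) hx.1 rfl hx₀ t ht] at h₁
  exact sub_eq_zero.1 h₁

end ILC

end

/-! ### Convergence of the learning process -/

theorem corollary3 {p q m : ℕ} (T : ℝ) (hT : 0 < T)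
    -- arbitrary vector norms on the input, output and disturbance spaces
    (Np : Seminorm ℝ (Fin p → ℝ)) (hNp : ∀ x, Np x = 0 → x = 0)
    (Nq : Seminorm ℝ (Fin q → ℝ)) (hNq : ∀ x, Nq x = 0 → x = 0)
    (Nm : Seminorm ℝ (Fin m → ℝ)) (hNm : ∀ x, Nm x = 0 → x = 0)
    (G₁ : Matrix (Fin q) (Fin p) (RatFunc ℝ)) (G₂ : Matrix (Fin q) (Fin m) (RatFunc ℝ))
    (Γ : Matrix (Fin p) (Fin q) (RatFunc ℝ))
    (hG₁ : ILC.StrictlyProper G₁) (hG₂ : ILC.StrictlyProper G₂)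
    (hdeg : ILC.RelativeDegreeOne G₁)
    (hΓ : ∃ Γ₀ : Matrix (Fin p) (Fin q) ℝ,
      ILC.MatHasLimAtInfty ((RatFunc.X : RatFunc ℝ)⁻¹ • Γ) Γ₀) :
    -- the case `q ≥ p`
    (p ≤ q →
      ∀ L : Matrix (Fin p) (Fin p) ℝ, ILC.MatHasLimAtInfty (Γ * G₁) L →
      ILC.specRadius (1 - L) < 1 →
      (Γ * G₁).det ≠ 0 ∧ (G₁ᵀ * G₁).det ≠ 0 ∧
      ∃ βe βu : ℝ≥0 × ℝ≥0 → ℝ≥0, Continuous βe ∧ Continuous βu ∧ βe (0, 0) = 0 ∧ βu (0, 0) = 0 ∧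
        ∀ (D : Fin m → RatFunc ℝ) (Θ : ℕ → Fin m → RatFunc ℝ) (bθ bθhat : ℝ≥0)
          (yd : ℝ → Fin q → ℝ) (u₀ : ℝ → Fin p → ℝ),
          ILC.NominalDisturbance D → ILC.BoundedUncertainty T Nm bθ bθhat Θ →
          ContDiffOn ℝ 1 yd (Set.Icc 0 T) → ContinuousOn u₀ (Set.Icc 0 T) →
          ILC.Trackable T G₁ G₂ D yd →
          (∃ r u y, ILC.IsRun T G₁ G₂ Γ (fun k => D + Θ k) yd u₀ r u y) ∧
          ∀ r u y, ILC.IsRun T G₁ G₂ Γ (fun k => D + Θ k) yd u₀ r u y →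
            ∃ uinf : ℝ → Fin p → ℝ, ILC.IsContSignal uinf ∧
              (∀ᶠ s in ILC.halfPlanes, ILC.laplace uinf s =
                ILC.evalMat ((Γ * G₁)⁻¹ * Γ) s *ᵥ
                  (ILC.laplace r s - ILC.evalMat G₂ s *ᵥ ILC.evalVec D s)) ∧
              ILC.limsupSup Nq (Set.Icc 0 T) (fun k t => yd t - y k t) ≤ βe (bθ, bθhat) ∧
              ILC.limsupSup Np (Set.Ioc 0 T) (fun k t => (u k).reg t - uinf t)
                ≤ βu (bθ, bθhat) ∧
              -- the limit input is the desired input of the nominal system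
              ILC.DesiredInput T G₁ G₂ D yd uinf ∧
              (∀ v r', ILC.Generates G₁ G₂ D v r' → EqOn r' yd (Set.Icc 0 T) →
                v =ᵐ[volume.restrict (Set.Icc 0 T)] uinf ∧
                ∀ᶠ s in ILC.halfPlanes, ILC.laplace v s =
                  ILC.evalMat ((G₁ᵀ * G₁)⁻¹ * G₁ᵀ) s *ᵥ
                    (ILC.laplace r' s - ILC.evalMat G₂ s *ᵥ ILC.evalVec D s)) ∧
              -- without uncertainty, the nominal convergence results
              (bθ = 0 → bθhat = 0 → (∀ k, (u k).impulse = 0) ∧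
                TendstoUniformlyOn (fun k => (u k).reg) uinf atTop (Set.Icc 0 T) ∧
                TendstoUniformlyOn y yd atTop (Set.Icc 0 T))) ∧
    -- the case `q ≤ p`
    (∀ hqp : q ≤ p, ILC.LeftBlockNonsingular hqp G₁ →
      ∀ L : Matrix (Fin q) (Fin q) ℝ, ILC.MatHasLimAtInfty (G₁ * Γ) L →
      ILC.specRadius (1 - L) < 1 →
      (G₁ * Γ).det ≠ 0 ∧
      ∃ βe βu : ℝ≥0 × ℝ≥0 → ℝ≥0, Continuous βe ∧ Continuous βu ∧ βe (0, 0) = 0 ∧ βu (0, 0) = 0 ∧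
        ∀ (D : Fin m → RatFunc ℝ) (Θ : ℕ → Fin m → RatFunc ℝ) (bθ bθhat : ℝ≥0)
          (yd : ℝ → Fin q → ℝ) (u₀ : ℝ → Fin p → ℝ),
          ILC.NominalDisturbance D → ILC.BoundedUncertainty T Nm bθ bθhat Θ →
          ContDiffOn ℝ 1 yd (Set.Icc 0 T) → ContinuousOn u₀ (Set.Icc 0 T) →
          ILC.Trackable T G₁ G₂ D yd →
          (∃ r u y, ILC.IsRun T G₁ G₂ Γ (fun k => D + Θ k) yd u₀ r u y) ∧
          ∀ r u y, ILC.IsRun T G₁ G₂ Γ (fun k => D + Θ k) yd u₀ r u y →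
            ∃ uinf : ℝ → Fin p → ℝ, ILC.IsContSignal uinf ∧
              (∀ᶠ s in ILC.halfPlanes, ILC.laplace uinf s =
                ILC.evalMat (Γ * (G₁ * Γ)⁻¹) s *ᵥ
                  (ILC.laplace r s - ILC.evalMat G₂ s *ᵥ ILC.evalVec D s) +
                ILC.evalMat (ILC.gammaTilde hqp G₁ Γ) s *ᵥ (u 0).transform s) ∧
              ILC.limsupSup Nq (Set.Icc 0 T) (fun k t => yd t - y k t) ≤ βe (bθ, bθhat) ∧
              ILC.limsupSup Np (Set.Ioc 0 T) (fun k t => (u k).reg t - uinf t)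
                ≤ βu (bθ, bθhat) ∧
              -- the limit inputs are exactly the desired inputs of the nominal system
              ILC.DesiredInput T G₁ G₂ D yd uinf ∧
              (ILC.DesiredInput T G₁ G₂ D yd u₀ → EqOn uinf u₀ (Set.Icc 0 T)) ∧
              -- without uncertainty, the nominal convergence results
              (bθ = 0 → bθhat = 0 → (∀ k, (u k).impulse = 0) ∧
                TendstoUniformlyOn (fun k => (u k).reg) uinf atTop (Set.Icc 0 T) ∧
                TendstoUniformlyOn y yd atTop (Set.Icc 0 T))) := by
  obtain ⟨Γ₀, hΓ⟩ := hΓ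
  obtain ⟨M₁, hM₁⟩ := hG₁.exists_X_smul
  obtain ⟨M₂, hM₂⟩ := hG₂.exists_X_smul
  obtain ⟨c, hc0, hc⟩ := ILC.exists_norm_le_seminorm Nm hNm
  have hgain : ∀ κ : ℝ≥0, Continuous fun x : ℝ≥0 × ℝ≥0 => κ * (x.1 + x.2) := fun κ => by fun_prop
  refine ⟨fun _ L hL hρ => ?_, fun hqp hleft L hL hρ => ?_⟩
  · have hLdet := ILC.det_ne_zero_of_specRadius_lt hρ
    have hdet := hL.det_ne_zero hLdet
    have hLM : L = Γ₀ * M₁ := hL.unique (ILC.X_inv_smul_mul_X_smul Γ G₁ ▸ hΓ.mul hM₁)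
    have hdet' : (G₁ᵀ * G₁).det ≠ 0 := by
      refine ILC.det_transpose_mul_self_ne_zero hM₁ fun x hx => ?_
      by_contra hx0
      refine hLdet (Matrix.exists_mulVec_eq_zero_iff.1 ⟨x, hx0, ?_⟩)
      rw [hLM, ← Matrix.mulVec_mulVec, hx, Matrix.mulVec_zero]
    obtain ⟨C, ρ, hC, hρ0, hρ1, hbound⟩ := ILC.exists_input_bound_left T hG₂ hΓ hL hρ
    obtain ⟨κ, hκ⟩ := ILC.exists_gain T Np Nq Γ hG₁ hG₂ hC hρ0 hρ1 hc0
    obtain ⟨K, hK⟩ := ((hL.inv hLdet).mul hΓ).exists_isAction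
    refine ⟨hdet, hdet', _, _, hgain κ, hgain κ, by simp, by simp, ?_⟩
    intro D Θ bθ bθhat yd u₀ hD hΘ hyd hu₀ htr
    obtain ⟨d, hd⟩ := hD.exists_hasTransform
    obtain ⟨w, hw⟩ := hΘ.exists_signals
    have hwa : ∀ k, ‖(w k).impulse‖ ≤ c * bθ := fun k =>
      (hc _).trans (mul_le_mul_of_nonneg_left (hw k).2.1 hc0)
    have hwb : ∀ k, ∀ t ∈ Icc 0 T, ‖(w k).reg t‖ ≤ c * bθhat := fun k t ht =>
      (hc _).trans (mul_le_mul_of_nonneg_left ((hw k).2.2 t ht) hc0)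
    refine ⟨ILC.exists_isRun hT hG₁ hG₂ hΓ hd (fun k => (hw k).1) hyd hu₀ htr, ?_⟩
    intro r u y hrun
    have hr0 : r 0 = M₂ *ᵥ d.impulse := by
      rw [hrun.ref_eq ⟨le_rfl, hT.le⟩, htr.apply_zero hG₁ hM₂ hd hT hyd.continuousOn]
    obtain ⟨z, hz0, hz⟩ := ILC.exists_hasTransform_reference hM₂ hd hrun.ref_contDiff
      hrun.ref_deriv_transformable hr0
    have hKz := hK.transform hz
    have huinf : ∀ᶠ s in ILC.halfPlanes, ILC.laplace (K z).reg s =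
        ILC.evalMat ((Γ * G₁)⁻¹ * Γ) s *ᵥ
          (ILC.laplace r s - ILC.evalMat G₂ s *ᵥ ILC.evalVec D s) := by
      filter_upwards [hKz.2, ILC.evalMat_mul (Γ * G₁)⁻¹ ((RatFunc.X : RatFunc ℝ)⁻¹ • Γ),
        ILC.evalMat_X_inv_smul Γ, ILC.evalMat_mul (Γ * G₁)⁻¹ Γ, ILC.eventually_ne_halfPlanes 0]
        with s h₁ h₂ h₃ h₄ h₅
      rw [ILC.transform_of_impulse_eq_zero (by rw [hK.impulse, hz0, Matrix.mulVec_zero])] at h₁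
      rw [h₁, h₂, h₃, h₄, Matrix.mul_smul, Matrix.smul_mulVec, Matrix.mulVec_smul, smul_smul,
        inv_mul_cancel₀ h₅, one_smul]
    have hΓG : ∀ᶠ s in ILC.halfPlanes,
        ILC.evalMat Γ s *ᵥ (ILC.evalMat G₁ s *ᵥ ILC.laplace (K z).reg s) =
          ILC.evalMat Γ s *ᵥ (ILC.laplace r s - ILC.evalMat G₂ s *ᵥ ILC.evalVec D s) := by
      have h := ILC.evalMat_mul (Γ * G₁) ((Γ * G₁)⁻¹ * Γ)
      rw [ILC.mul_inv_cancel_left_of_det hdet] at h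
      filter_upwards [huinf, h, ILC.evalMat_mul Γ G₁] with s h₁ h₂ h₃
      rw [h₁, Matrix.mulVec_mulVec, ← h₃, Matrix.mulVec_mulVec, ← h₂]
    have hrS : ILC.IsContSignal r := ⟨hrun.ref_contDiff.continuousOn, hrun.ref_transformable⟩
    obtain ⟨out, hout, houtc⟩ := ILC.exists_output hG₁ hM₂ hd
    -- inputs that generate prolongations of `yd` have the same primitive as `u_∞` on `[0, T]`
    have hprim : ∀ v r', ILC.Generates G₁ G₂ D v r' → EqOn r' yd (Set.Icc 0 T) →
        EqOn (ILC.prim (K z).reg) (ILC.prim v) (Icc 0 T) := by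
      intro v r' hv hr'
      obtain ⟨h₁, h₂, -⟩ := hout v hv.1
      have h₃ := hv.eqOn_of_isContSignal hT h₂ hr' hyd.continuousOn h₁
      have hsub := (ILC.hasTransform_ofFun hrS).sub (ILC.hasTransform_ofFun h₁)
      refine hK.prim_eqOn (x := (ILC.ofFun r - ILC.ofFun (out v)).reg) hsub.1
        (fun t ht => ?_) hKz.1.2 hv.1 ?_
      · simp [ILC.ofFun, h₃ ht, hrun.ref_eq ht]
      · have h := ILC.evalMat_mul ((Γ * G₁)⁻¹ * Γ) G₁
        rw [Matrix.mul_assoc, Matrix.nonsing_inv_mul _ (isUnit_iff_ne_zero.2 hdet)] at h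
        filter_upwards [huinf, h₂.2.2, h, hsub.2,
          ILC.evalMat_mul (Γ * G₁)⁻¹ ((RatFunc.X : RatFunc ℝ)⁻¹ • Γ),
          ILC.evalMat_X_inv_smul Γ, ILC.evalMat_mul (Γ * G₁)⁻¹ Γ] with s e₁ e₂ e₃ e₄ e₅ e₆ e₇
        rw [ILC.transform_of_impulse_eq_zero (by simp [ILC.ofFun])] at e₄
        have e₈ : ILC.laplace v s = ILC.evalMat ((Γ * G₁)⁻¹ * Γ) s *ᵥ
            (ILC.laplace (out v) s - ILC.evalMat G₂ s *ᵥ ILC.evalVec D s) := by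
          rw [← e₂, Matrix.mulVec_mulVec, ← e₃, ILC.evalMat_one, Matrix.one_mulVec]
        rw [e₁, e₈, e₄, e₅, e₆, e₇, Matrix.mul_smul, Matrix.smul_mulVec, ← Matrix.mulVec_sub]
        congr 2
        abel
    obtain ⟨ho₁, ho₂, -⟩ := hout (K z).reg hKz.1.2
    have houtyd : EqOn (out (K z).reg) yd (Icc 0 T) := by
      obtain ⟨-, v, r', -, hr', hv⟩ := htr
      obtain ⟨h₁, h₂, -⟩ := hout v hv.1
      exact (houtc T _ _ hKz.1.2 hv.1 (hprim v r' hv hr')).trans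
        (hv.eqOn_of_isContSignal hT h₂ hr' hyd.continuousOn h₁)
    obtain ⟨M, hM, hbd⟩ := hbound hrun (fun k => (hw k).1) (by positivity) (by positivity) hwa hwb
      hKz.1 hΓG
    obtain ⟨he, hu, h0⟩ := hκ hrun (fun k => (hw k).1) hwa hwb hKz.1 ho₁ ho₂ houtyd hM hbd
    refine ⟨(K z).reg, hKz.1, huinf, he, hu, ⟨_, _, fun _ _ => rfl, houtyd, ho₂⟩,
      fun v r' hv hr' => ⟨?_, ?_⟩, h0⟩
    · exact (ILC.ae_eq_of_prim_eqOn hKz.1.2 hv.1 (hprim v r' hv hr')).symm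
    · have h := ILC.evalMat_mul ((G₁ᵀ * G₁)⁻¹ * G₁ᵀ) G₁
      rw [Matrix.mul_assoc, Matrix.nonsing_inv_mul _ (isUnit_iff_ne_zero.2 hdet')] at h
      filter_upwards [hv.2.2, h] with s h₁ h₂
      rw [← h₁, Matrix.mulVec_mulVec, ← h₂, ILC.evalMat_one, Matrix.one_mulVec]
  · have hLdet := ILC.det_ne_zero_of_specRadius_lt hρ
    have hdet := hL.det_ne_zero hLdet
    have hdet₁₁ := hleft.det_leftCols_ne_zero hG₁
    obtain ⟨C, ρ, hC, hρ0, hρ1, hbound⟩ := ILC.exists_input_bound_right T hG₁ hG₂ hΓ hL hρ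
    obtain ⟨κ, hκ⟩ := ILC.exists_gain T Np Nq Γ hG₁ hG₂ hC hρ0 hρ1 hc0
    obtain ⟨K, hK⟩ := (hΓ.mul (hL.inv hLdet)).exists_isAction
    have hPlim := ILC.matHasLimAtInfty_one.sub ((hΓ.mul (hL.inv hLdet)).mul hM₁)
    rw [Matrix.smul_mul, ILC.X_inv_smul_mul_X_smul, ← ILC.gammaTilde_eq hqp hdet₁₁ hdet] at hPlim
    obtain ⟨P, hP⟩ := hPlim.exists_isAction
    refine ⟨hdet, _, _, hgain κ, hgain κ, by simp, by simp, ?_⟩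
    intro D Θ bθ bθhat yd u₀ hD hΘ hyd hu₀ htr
    obtain ⟨d, hd⟩ := hD.exists_hasTransform
    obtain ⟨w, hw⟩ := hΘ.exists_signals
    have hwa : ∀ k, ‖(w k).impulse‖ ≤ c * bθ := fun k =>
      (hc _).trans (mul_le_mul_of_nonneg_left (hw k).2.1 hc0)
    have hwb : ∀ k, ∀ t ∈ Icc 0 T, ‖(w k).reg t‖ ≤ c * bθhat := fun k t ht =>
      (hc _).trans (mul_le_mul_of_nonneg_left ((hw k).2.2 t ht) hc0)
    refine ⟨ILC.exists_isRun hT hG₁ hG₂ hΓ hd (fun k => (hw k).1) hyd hu₀ htr, ?_⟩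
    intro r u y hrun
    have hr0 : r 0 = M₂ *ᵥ d.impulse := by
      rw [hrun.ref_eq ⟨le_rfl, hT.le⟩, htr.apply_zero hG₁ hM₂ hd hT hyd.continuousOn]
    obtain ⟨z, hz0, hz⟩ := ILC.exists_hasTransform_reference hM₂ hd hrun.ref_contDiff
      hrun.ref_deriv_transformable hr0
    have hx := (hK.transform hz).add (hP.transform (ILC.hasTransform_self (hrun.input 0)))
    set x := K z + P (u 0) with hxdef
    have hx0 : x.impulse = 0 := by
      simp [hxdef, hK.impulse, hP.impulse, hz0, hrun.init_impulse]
    have huinf : ∀ᶠ s in ILC.halfPlanes, ILC.laplace x.reg s =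
        ILC.evalMat (Γ * (G₁ * Γ)⁻¹) s *ᵥ
          (ILC.laplace r s - ILC.evalMat G₂ s *ᵥ ILC.evalVec D s) +
        ILC.evalMat (ILC.gammaTilde hqp G₁ Γ) s *ᵥ (u 0).transform s := by
      filter_upwards [hx.2, ILC.evalMat_mul ((RatFunc.X : RatFunc ℝ)⁻¹ • Γ) (G₁ * Γ)⁻¹,
        ILC.evalMat_X_inv_smul Γ, ILC.evalMat_mul Γ (G₁ * Γ)⁻¹, ILC.eventually_ne_halfPlanes 0]
        with s h₁ h₂ h₃ h₄ h₅
      rw [ILC.transform_of_impulse_eq_zero hx0] at h₁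
      rw [h₁, h₂, h₃, h₄, Matrix.smul_mul, Matrix.smul_mulVec, Matrix.mulVec_smul, smul_smul,
        inv_mul_cancel₀ h₅, one_smul]
    -- the difference to the initial input, in terms of the initial output error
    have hdiff : ∀ᶠ s in ILC.halfPlanes, ILC.laplace x.reg s - (u 0).transform s =
        ILC.evalMat (Γ * (G₁ * Γ)⁻¹) s *ᵥ (ILC.laplace r s - ILC.evalMat G₂ s *ᵥ ILC.evalVec D s -
          ILC.evalMat G₁ s *ᵥ (u 0).transform s) := by
      filter_upwards [huinf, ILC.evalMat_sub 1 (Γ * (G₁ * Γ)⁻¹ * G₁),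
        ILC.evalMat_mul (Γ * (G₁ * Γ)⁻¹) G₁] with s h₁ h₂ h₃
      rw [h₁, ILC.gammaTilde_eq hqp hdet₁₁ hdet, h₂, h₃, ILC.evalMat_one, Matrix.sub_mulVec,
        Matrix.one_mulVec, ← Matrix.mulVec_mulVec]
      simp only [Matrix.mulVec_sub]
      abel
    have hG₁x : ∀ᶠ s in ILC.halfPlanes, ILC.evalMat G₁ s *ᵥ ILC.laplace x.reg s =
        ILC.laplace r s - ILC.evalMat G₂ s *ᵥ ILC.evalVec D s := by
      have h := ILC.evalMat_mul G₁ (Γ * (G₁ * Γ)⁻¹)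
      rw [← Matrix.mul_assoc, Matrix.mul_nonsing_inv _ (isUnit_iff_ne_zero.2 hdet)] at h
      filter_upwards [hdiff, h] with s h₁ h₂
      rw [← sub_add_cancel (ILC.laplace x.reg s) ((u 0).transform s), h₁, Matrix.mulVec_add,
        Matrix.mulVec_mulVec, ← h₂, ILC.evalMat_one, Matrix.one_mulVec, sub_add_cancel]
    have hproj : ∀ᶠ s in ILC.halfPlanes, (u 0).transform s - ILC.laplace x.reg s =
        ILC.evalMat Γ s *ᵥ (ILC.evalMat (G₁ * Γ)⁻¹ s *ᵥ
          (ILC.evalMat G₁ s *ᵥ ((u 0).transform s - ILC.laplace x.reg s))) := by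
      filter_upwards [hdiff, hG₁x, ILC.evalMat_mul Γ (G₁ * Γ)⁻¹] with s h₁ h₂ h₃
      rw [Matrix.mulVec_mulVec, ← h₃, Matrix.mulVec_sub (ILC.evalMat G₁ s), h₂, ← neg_sub, h₁,
        ← Matrix.mulVec_neg, neg_sub]
    have hrS : ILC.IsContSignal r := ⟨hrun.ref_contDiff.continuousOn, hrun.ref_transformable⟩
    have hgen : ILC.Generates G₁ G₂ D x.reg r := ⟨hx.1.2, hrS.2, hG₁x⟩
    obtain ⟨M, hM, hbd⟩ := hbound hrun (fun k => (hw k).1) (by positivity) (by positivity) hwa hwb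
      hx.1 hG₁x hproj
    obtain ⟨he, hu, h0⟩ := hκ hrun (fun k => (hw k).1) hwa hwb hx.1 hrS hgen hrun.ref_eq hM hbd
    refine ⟨x.reg, hx.1, huinf, he, hu, ⟨_, _, fun _ _ => rfl, hrun.ref_eq, hgen⟩,
      fun hdes => ?_, h0⟩
    obtain ⟨v, r', hvu, hr', hv⟩ := hdes
    obtain ⟨out, hout, houtc⟩ := ILC.exists_output hG₁ hM₂ hd
    obtain ⟨h₁, h₂, -⟩ := hout v hv.1
    obtain ⟨h₃, h₄, -⟩ := hout (u 0).reg (hrun.input 0).2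
    have hvu0 : EqOn (u 0).reg v (Icc 0 T) := hrun.init_eq.trans hvu.symm
    have hout0 : EqOn (out (u 0).reg) yd (Icc 0 T) :=
      (houtc T _ _ (hrun.input 0).2 hv.1 (ILC.prim_congr hvu0)).trans
        (hv.eqOn_of_isContSignal hT h₂ hr' hyd.continuousOn h₁)
    have hsub := (ILC.hasTransform_ofFun hrS).sub (ILC.hasTransform_ofFun h₃)
    have hp := hK.prim_eqOn (T := T) (x := (ILC.ofFun r - ILC.ofFun (out (u 0).reg)).reg) hsub.1
      (fun t ht => by simp [ILC.ofFun, hout0 ht, hrun.ref_eq ht]) hx.1.2 (hrun.input 0).2 <| by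
        filter_upwards [hdiff, h₄.2.2, hsub.2,
          ILC.evalMat_mul ((RatFunc.X : RatFunc ℝ)⁻¹ • Γ) (G₁ * Γ)⁻¹,
          ILC.evalMat_X_inv_smul Γ, ILC.evalMat_mul Γ (G₁ * Γ)⁻¹] with s e₁ e₂ e₃ e₄ e₅ e₆
        rw [ILC.transform_of_impulse_eq_zero (by simp [ILC.ofFun])] at e₃
        rw [ILC.transform_of_impulse_eq_zero hrun.init_impulse] at e₁
        rw [e₁, e₂, e₃, e₄, e₅, e₆, Matrix.smul_mul, Matrix.smul_mulVec]
        congr 2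
        abel
    have hae := ILC.ae_eq_of_prim_eqOn hx.1.2 (hrun.input 0).2 hp
    refine EqOn.trans (Measure.eqOn_of_ae_eq hae (hx.1.1.mono Icc_subset_Ici_self)
      ((hrun.input 0).1.mono Icc_subset_Ici_self) ?_) hrun.init_eq
    rw [interior_Icc, closure_Ioo hT.ne]
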